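/- Let $g\ge 0$ be an integer. For a positive definite quadratic form $Q$ on $\mathbb{R}^g$ let $M(Q)$ be the set of nonzero vectors of $\mathbb{Z}^g$ at which $Q$ attains its minimum over $\mathbb{Z}^g\setminus\{0\}$, and let $\sigma[Q]=\mathbb{R}_{\ge 0}\langle \xi\xi^t : \xi\in M(Q)\rangle$, a rational polyhedral cone in the space of real symmetric $g\times g$ matrices. Let $\Sigma_g^{P}$ (the perfect cone decomposition) consist of the cones $\sigma[Q]$, for all positive definite $Q$, together with the zero cone. The group $\mathrm{GL}_g(\mathbb{Z})$ acts on $\Sigma_g^{P}$ by $h\cdot X=hXh^t$; write $\sigma\sim\sigma'$ if $\sigma$ and $\sigma'$ lie in the same orbit. An orientation of a cone is an orientation of its linear span. A cone $\sigma\in\Sigma_g^{P}$ is alternating if every $h\in\mathrm{GL}_g(\mathbb{Z})$ with $h\sigma h^t=\sigma$ preserves the orientation of $\sigma$. Choose a set $\Gamma$ of representatives of the $\mathrm{GL}_g(\mathbb{Z})$-orbits of alternating cones, and an orientation $\omega_\sigma$ of each $\sigma\in\Gamma$; extend these orientations to all alternating cones by the action of $\mathrm{GL}_g(\mathbb{Z})$.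 For $n\in\mathbb{Z}$ let $\Gamma_n$ be the set of cones of dimension $n+1$ in $\Gamma$. If $\rho$ is an alternating facet of $\sigma$, let $\eta(\rho,\sigma)=1$ if $\omega_\rho$ is the orientation induced by $\omega_\sigma$, that is, if for a positive basis $(v_1,\dots,v_m)$ of $\mathbb{R}\rho$ and a vector $v\in\sigma\setminus\rho$ the basis $(v_1,\dots,v_m,v)$ of $\mathbb{R}\sigma$ is positive, and $\eta(\rho,\sigma)=-1$ otherwise. The perfect chain complex $P^{(g)}_\bullet$ has as $P^{(g)}_n$ the $\mathbb{Q}$-vector space with basis $\{e_\sigma\}_{\sigma\in\Gamma_n}$, and the differential $$\partial(e_\sigma)=\sum_{\sigma'\in\Gamma_{n-1}}\Bigl(\sum_{\rho}\eta(\rho,\sigma)\Bigr)e_{\sigma'}\qquad(\sigma\in\Gamma_n),$$ where the inner sum runs over the facets $\rho$ of $\sigma$ with $\rho\sim\sigma'$. Then, for every choice of representatives and orientations, $\partial^2=0$, and $H_k(P^{(g)}_\bullet)=0$ for every integer $k\le g-2$. -/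

import Mathlib

noncomputable section

namespace PerfectCone

/-- The real vector space of `g × g` matrices, in which the quadratic forms on `ℝ^g` are the
symmetric matrices. All the cones below lie in the subspace of symmetric matrices, so that faces,
linear spans and dimensions may be computed in the space of all matrices. -/
abbrev Mat (g : ℕ) : Type := Matrix (Fin g) (Fin g) ℝ

/-- Convex cones (containing `0`) in the space of `g × g` matrices. -/
abbrev Cone (g : ℕ) : Type := PointedCone ℝ (Mat g)

/-- An integer vector as a real vector. -/
def toReal {g : ℕ} (ξ : Fin g → ℤ) : Fin g → ℝ := fun i => (ξ i : ℝ)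

/-- The value `Q(ξ) = ξᵗ Q ξ` of a quadratic form at an integer vector. -/
def formValue {g : ℕ} (Q : Mat g) (ξ : Fin g → ℤ) : ℝ :=
  dotProduct (toReal ξ) (Matrix.mulVec Q (toReal ξ))

/-- The set `M(Q)` of minimal vectors of `Q`. -/
def minimalVectors {g : ℕ} (Q : Mat g) : Set (Fin g → ℤ) :=
  {ξ | ξ ≠ 0 ∧ ∀ ζ : Fin g → ℤ, ζ ≠ 0 → formValue Q ξ ≤ formValue Q ζ}

/-- The cone `σ[Q]`: the non-negative span of the rank one forms `ξ ξᵗ`, `ξ ∈ M(Q)`. -/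
def coneOfForm {g : ℕ} (Q : Mat g) : Cone g :=
  PointedCone.hull ℝ ((fun ξ => Matrix.vecMulVec (toReal ξ) (toReal ξ)) '' minimalVectors Q)

/-- The perfect cone decomposition: all cones `σ[Q]` with `Q` positive definite, together with the
zero cone, which is a face of each of them. -/
def perfectCones (g : ℕ) : Set (Cone g) :=
  {σ | σ = ⊥ ∨ ∃ Q : Mat g, Q.PosDef ∧ σ = coneOfForm Q}

/-- The linear map `X ↦ h X hᵗ` given by `h ∈ GL_g(ℤ)`. -/
def act {g : ℕ} (h : Matrix.GeneralLinearGroup (Fin g) ℤ) : Mat g →ₗ[ℝ] Mat g :=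
  LinearMap.mulRight ℝ ((h : Matrix (Fin g) (Fin g) ℤ).map (Int.cast : ℤ → ℝ)).transpose ∘ₗ
    LinearMap.mulLeft ℝ ((h : Matrix (Fin g) (Fin g) ℤ).map (Int.cast : ℤ → ℝ))

/-- Two cones are equivalent if they lie in the same `GL_g(ℤ)`-orbit. -/
def Equivalent {g : ℕ} (σ τ : Cone g) : Prop :=
  ∃ h : Matrix.GeneralLinearGroup (Fin g) ℤ, PointedCone.map (act h) σ = τ

/-- The linear span `ℝσ` of a cone. -/
abbrev linSpan {g : ℕ} (σ : Cone g) : Submodule ℝ (Mat g) := Submodule.span ℝ (σ : Set (Mat g))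

/-- The dimension of a cone is the dimension of its linear span. -/
def dim {g : ℕ} (σ : Cone g) : ℕ := Module.finrank ℝ (linSpan σ)

/-- A face of a cone is a nonempty subset that minimizes a linear functional on the cone. -/
def IsFace {g : ℕ} (ρ σ : Cone g) : Prop :=
  ∃ ℓ : Mat g →ₗ[ℝ] ℝ, (ρ : Set (Mat g)) = {x | x ∈ σ ∧ ∀ y ∈ σ, ℓ x ≤ ℓ y}

/-- A facet is a face of codimension one. -/
def IsFacet {g : ℕ} (ρ σ : Cone g) : Prop := IsFace ρ σ ∧ dim ρ + 1 = dim σ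

/-- An orientation of a cone is an orientation of its linear span. (A zero-dimensional cone has
two orientations, and the empty basis is positive for exactly one of them.) -/
abbrev ConeOrientation {g : ℕ} (σ : Cone g) : Type :=
  Orientation ℝ (linSpan σ) (Fin (Module.finrank ℝ (linSpan σ)))

/-- The ordered basis `b` of `ℝσ` is positively oriented. -/
def IsPositive {g : ℕ} {σ : Cone g} (ω : ConeOrientation σ) {m : ℕ}
    (b : Module.Basis (Fin m) ℝ (linSpan σ)) : Prop :=
  ∃ e : m = Module.finrank ℝ (linSpan σ), (b.reindex (finCongr e)).orientation = ω

/-- The action of `h`, which is supposed to map `σ` onto `τ`, carries the orientation `ω` of `σ` to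
the orientation `ω'` of `τ`. -/
def Carries {g : ℕ} (h : Matrix.GeneralLinearGroup (Fin g) ℤ) {σ τ : Cone g}
    (ω : ConeOrientation σ) (ω' : ConeOrientation τ) : Prop :=
  ∀ (m : ℕ) (b : Module.Basis (Fin m) ℝ (linSpan σ)) (b' : Module.Basis (Fin m) ℝ (linSpan τ)),
    (∀ i, (b' i : Mat g) = act h (b i : Mat g)) → (IsPositive ω b ↔ IsPositive ω' b')

/-- A cone is alternating if every element of `GL_g(ℤ)` that stabilizes it preserves its
orientations. -/
def IsAlternating {g : ℕ} (σ : Cone g) : Prop :=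
  ∀ h : Matrix.GeneralLinearGroup (Fin g) ℤ, PointedCone.map (act h) σ = σ →
    ∀ ω : ConeOrientation σ, Carries h ω ω

/-- `ω'` is the orientation of the facet `ρ` of `σ` induced by the orientation `ω` of `σ`: a basis
`(v₁, …, vₙ)` of `ℝρ` is positive if and only if `(v₁, …, vₙ, v)` is a positive basis of `ℝσ`,
for `v` in `σ` but not in `ρ`. All such `v`, in particular all generators of rays of `σ` that are
not contained in `ρ`, lie strictly on one side of `ℝρ` in `ℝσ`. -/
def IsInduced {g : ℕ} {σ ρ : Cone g} (ω : ConeOrientation σ) (ω' : ConeOrientation ρ) : Prop :=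
  ∀ (m : ℕ) (b' : Module.Basis (Fin m) ℝ (linSpan ρ))
    (b : Module.Basis (Fin (m + 1)) ℝ (linSpan σ)),
    (∀ i : Fin m, (b i.castSucc : Mat g) = (b' i : Mat g)) →
      (b (Fin.last m) : Mat g) ∈ σ → (b (Fin.last m) : Mat g) ∉ ρ →
        (IsPositive ω' b' ↔ IsPositive ω b)

/-- `Γ` is a set of representatives of the `GL_g(ℤ)`-orbits of alternating perfect cones. -/
def IsSystemOfRepresentatives {g : ℕ} (Γ : Set (Cone g)) : Prop :=
  (∀ τ ∈ Γ, τ ∈ perfectCones g ∧ IsAlternating τ) ∧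
    ∀ σ ∈ perfectCones g, IsAlternating σ → ∃! τ : Cone g, τ ∈ Γ ∧ Equivalent τ σ

section Complex

variable {g : ℕ} (Γ : Set (Cone g)) (ω : ∀ σ : Γ, ConeOrientation σ.1)

open Classical in
/-- The sign of a facet `ρ` of `σ` that is equivalent to `σ'`: it is `1` if the orientation that
`GL_g(ℤ)` carries from `σ'` to `ρ` is the one that `σ` induces on `ρ`, and `-1` otherwise. -/
def facetSign (σ' σ : Γ) (ρ : Cone g) : ℚ :=
  if ∃ (h : Matrix.GeneralLinearGroup (Fin g) ℤ) (ωρ : ConeOrientation ρ),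
      PointedCone.map (act h) σ'.1 = ρ ∧ Carries h (ω σ') ωρ ∧ IsInduced (ω σ) ωρ
  then 1 else -1

/-- The incidence number `δ(σ', σ)`: the sum of the signs of the (finitely many) facets of `σ` that
are equivalent to `σ'`. -/
def incidence (σ' σ : Γ) : ℚ :=
  ∑ᶠ ρ ∈ {ρ : Cone g | IsFacet ρ σ.1 ∧ Equivalent σ'.1 ρ}, facetSign Γ ω σ' σ ρ

/-- The set `Γ_n` of the representatives of dimension `n + 1`. -/
abbrev Rep (n : ℤ) : Type := {σ : Γ // (dim σ.1 : ℤ) = n + 1}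

/-- The rational vector space `P_n` with basis `Γ_n`. -/
abbrev Chains (n : ℤ) : Type := Rep Γ n →₀ ℚ

/-- The differential `∂ : P_{n+1} → P_n`, with `∂ e_σ = ∑_{σ'} δ(σ', σ) e_{σ'}`, where `σ'` runs
through `Γ_n` (only finitely many terms are nonzero). -/
def boundary (n : ℤ) : Chains Γ (n + 1) →ₗ[ℚ] Chains Γ n :=
  Finsupp.linearCombination ℚ fun σ : Rep Γ (n + 1) =>
    ∑ᶠ σ' : Rep Γ n, Finsupp.single σ' (incidence Γ ω σ'.1 σ.1)

/-- The perfect chain complex `P_•`, given that its differential squares to zero. -/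
def perfectComplex (hd : ∀ n : ℤ, boundary Γ ω n ∘ₗ boundary Γ ω (n + 1) = 0) :
    ChainComplex (ModuleCat.{0} ℚ) ℤ :=
  ChainComplex.of (fun n => ModuleCat.of ℚ (Chains Γ n))
    (fun n => ModuleCat.ofHom (boundary Γ ω n))
    (fun n => by rw [← ModuleCat.ofHom_comp, hd n, ModuleCat.ofHom_zero])

end Complex

end PerfectCone

end

noncomputable section

namespace PerfectCone

/-! ### Faces and facets of polyhedral cones -/

section Faces

variable {g : ℕ}

/-! The vanishing comes from a contracting homotopy that is available for cones of dimension less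
than `g`. Such a cone `σ` is spanned by fewer than `g` forms `ξξᵗ`, so a primitive integral
functional `φ` kills all the `ξ` involved (`exists_isComplement`). Choose an integral `c` with `φ(c)
= 1`. If `Q` defines `σ` and is scaled so that its minimum is one, then `Q(x - φ(x)c) + φ(x)²` has
the same minimal vectors together with `±c`, so the sum of `σ` and the ray of `ccᵗ` is again perfect
(`perfect_sup_ray`). Two choices of `(c, φ)` differ by an element of `GL_g(ℤ)` that fixes `σ`
pointwise (`exists_gl_fixing`), so the larger cone is well defined up to equivalence. Call such a
complementary ray a coloop.

Let `H` send the class of `σ` to that of `σ + ray c` if `σ` has no coloop, and to zero otherwise.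
Exchanging two coloops and fixing the rest reverses the orientation, so cones with two coloops are
zero in the complex (`cls_eq_zero_of_two_coloops`). The facets of `σ + ray c` are `σ` and the cones
`ρ + ray c` for the facets `ρ` of `σ` (`bd_sup_ray`). It follows that `∂H + H∂ = id` in dimensions
less than `g` (`boundary_homotopy_add`). Degree `k` consists of cones of dimension `k + 1`, whence
the range `k ≤ g - 2`.

Orientations are encoded by alternating forms on the whole matrix space, compared on the span of a
cone up to a positive factor (`SameOn`). The induced orientation of a facet is the contraction with
a vector outside the facet, and all signs come from the anticommutation of two contractions
(`contr_contr`). Every oriented perfect cone gets a class `cls`, which is zero if the cone is not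
alternating. Odd, invariant functions of oriented cones factor through this class (`map_cls`), so
`∂` and `H` may be computed on actual cones instead of representatives. Since faces of perfect cones
are perfect (`perfect_of_isFace`) and a facet of a facet lies in exactly two facets
(`exists_other_facet`), the terms of `∂²` cancel in pairs. -/

theorem isFace_iff {ρ σ : Cone g} : IsFace ρ σ ↔
    ∃ ℓ : Mat g →ₗ[ℝ] ℝ, (∀ y ∈ σ, 0 ≤ ℓ y) ∧ ∀ x, x ∈ ρ ↔ x ∈ σ ∧ ℓ x = 0 := by
  constructor
  · rintro ⟨ℓ, h⟩
    have h' : ∀ x, x ∈ ρ ↔ x ∈ σ ∧ ∀ y ∈ σ, ℓ x ≤ ℓ y := fun x => by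
      have := Set.ext_iff.1 h x
      simpa using this
    have h0 : ∀ y ∈ σ, 0 ≤ ℓ y := by
      simpa using ((h' 0).1 ρ.zero_mem).2
    refine ⟨ℓ, h0, fun x => (h' x).trans ?_⟩
    refine and_congr_right fun hx => ⟨fun H => le_antisymm ?_ (h0 x hx), fun H y hy => ?_⟩
    · simpa using H 0 σ.zero_mem
    · rw [H]; exact h0 y hy
  · rintro ⟨ℓ, h0, h⟩
    refine ⟨ℓ, Set.ext fun x => (h x).trans ?_⟩
    refine and_congr_right fun hx => ⟨fun H y hy => ?_, fun H => le_antisymm ?_ (h0 x hx)⟩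
    · rw [H]; exact h0 y hy
    · simpa using H 0 σ.zero_mem

theorem nonneg_of_mem_hull {G : Set (Mat g)} {ℓ : Mat g →ₗ[ℝ] ℝ} (h : ∀ x ∈ G, 0 ≤ ℓ x)
    {x : Mat g} (hx : x ∈ PointedCone.hull ℝ G) : 0 ≤ ℓ x := by
  induction hx using Submodule.span_induction with
  | mem x hx => exact h x hx
  | zero => simp
  | add x y _ _ hx hy => rw [map_add]; exact add_nonneg hx hy
  | smul a x _ hx =>
    have : a • x = (a : ℝ) • x := rfl
    rw [this, map_smul]; exact mul_nonneg a.2 hx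

theorem eq_zero_of_mem_hull {G : Set (Mat g)} {ℓ : Mat g →ₗ[ℝ] ℝ} (h : ∀ x ∈ G, ℓ x = 0)
    {x : Mat g} (hx : x ∈ PointedCone.hull ℝ G) : ℓ x = 0 := by
  refine le_antisymm ?_ (nonneg_of_mem_hull (fun x hx => (h x hx).ge) hx)
  have := nonneg_of_mem_hull (ℓ := -ℓ) (fun x hx => by simp [h x hx]) hx
  simpa using this

/-- A sum of nonnegative terms vanishes only if each term does. Hence a face is generated by the
generators that it contains, and a polyhedral cone has finitely many faces. -/
theorem mem_hull_sep_iff {G : Set (Mat g)} {ℓ : Mat g →ₗ[ℝ] ℝ} (h : ∀ x ∈ G, 0 ≤ ℓ x)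
    {x : Mat g} : x ∈ PointedCone.hull ℝ {y ∈ G | ℓ y = 0} ↔ x ∈ PointedCone.hull ℝ G ∧ ℓ x = 0 := by
  constructor
  · intro hx
    exact ⟨Submodule.span_mono (Set.sep_subset _ _) hx, eq_zero_of_mem_hull (fun y hy => hy.2) hx⟩
  · rintro ⟨hx, hx0⟩
    induction hx using Submodule.span_induction with
    | mem x hx => exact Submodule.subset_span ⟨hx, hx0⟩
    | zero => exact Submodule.zero_mem _
    | add x y hx' hy' hx hy =>
      have h1 := nonneg_of_mem_hull h hx'
      have h2 := nonneg_of_mem_hull h hy'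
      rw [map_add] at hx0
      exact Submodule.add_mem _ (hx (by linarith)) (hy (by linarith))
    | smul a x _ hx =>
      have e : a • x = (a : ℝ) • x := rfl
      rw [e, map_smul, smul_eq_mul, mul_eq_zero] at hx0
      rcases hx0 with ha | hx0
      · rw [e, ha, zero_smul]; exact Submodule.zero_mem _
      · exact Submodule.smul_mem _ _ (hx hx0)

theorem IsFace.le {ρ σ : Cone g} (h : IsFace ρ σ) : ρ ≤ σ := by
  obtain ⟨ℓ, -, h⟩ := isFace_iff.1 h
  exact fun x hx => ((h x).1 hx).1

theorem linSpan_mono {ρ σ : Cone g} (h : ρ ≤ σ) : linSpan ρ ≤ linSpan σ :=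
  Submodule.span_mono h

theorem mem_linSpan {σ : Cone g} {x : Mat g} (hx : x ∈ σ) : x ∈ linSpan σ :=
  Submodule.subset_span hx

theorem eq_zero_of_mem_linSpan {ρ : Cone g} {V : Type*} [AddCommGroup V] [Module ℝ V]
    {ℓ : Mat g →ₗ[ℝ] V} (h : ∀ x ∈ ρ, ℓ x = 0)
    {x : Mat g} (hx : x ∈ linSpan ρ) : ℓ x = 0 := by
  have : linSpan ρ ≤ LinearMap.ker ℓ := Submodule.span_le.2 fun x hx => h x hx
  exact this hx

theorem IsFace.mem_of_mem_linSpan {ρ σ : Cone g} (h : IsFace ρ σ) {x : Mat g} (hx : x ∈ σ)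
    (hx' : x ∈ linSpan ρ) : x ∈ ρ := by
  obtain ⟨ℓ, -, h⟩ := isFace_iff.1 h
  exact (h x).2 ⟨hx, eq_zero_of_mem_linSpan (fun y hy => ((h y).1 hy).2) hx'⟩

theorem linSpan_hull (G : Set (Mat g)) :
    linSpan (PointedCone.hull ℝ G) = Submodule.span ℝ G :=
  le_antisymm (Submodule.span_le.2 (PointedCone.hull_le_span (R := ℝ) G))
    (Submodule.span_mono PointedCone.subset_hull)

/-- The face of a cone in which a linear functional vanishes. -/
def zeroFace (ℓ : Mat g →ₗ[ℝ] ℝ) (σ : Cone g) : Cone g :=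
  σ ⊓ PointedCone.ofSubmodule (LinearMap.ker ℓ)

theorem mem_zeroFace {ℓ : Mat g →ₗ[ℝ] ℝ} {σ : Cone g} {x : Mat g} :
    x ∈ zeroFace ℓ σ ↔ x ∈ σ ∧ ℓ x = 0 := by
  simp [zeroFace]

theorem isFace_zeroFace {ℓ : Mat g →ₗ[ℝ] ℝ} {σ : Cone g} (h : ∀ y ∈ σ, 0 ≤ ℓ y) :
    IsFace (zeroFace ℓ σ) σ :=
  isFace_iff.2 ⟨ℓ, h, fun _ => mem_zeroFace⟩

theorem isFace_iff_eq_zeroFace {ρ σ : Cone g} : IsFace ρ σ ↔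
    ∃ ℓ : Mat g →ₗ[ℝ] ℝ, (∀ y ∈ σ, 0 ≤ ℓ y) ∧ ρ = zeroFace ℓ σ := by
  rw [isFace_iff]
  refine exists_congr fun ℓ => and_congr_right fun _ => ?_
  simp only [SetLike.ext_iff, mem_zeroFace]

theorem zeroFace_hull {G : Set (Mat g)} {ℓ : Mat g →ₗ[ℝ] ℝ} (h : ∀ x ∈ G, 0 ≤ ℓ x) :
    zeroFace ℓ (PointedCone.hull ℝ G) = PointedCone.hull ℝ {y ∈ G | ℓ y = 0} :=
  SetLike.ext fun _ => mem_zeroFace.trans (mem_hull_sep_iff h).symm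

/-- A cone is polyhedral if it is generated by a finite set. -/
def IsPolyhedral (σ : Cone g) : Prop := ∃ G : Set (Mat g), G.Finite ∧ σ = PointedCone.hull ℝ G

theorem IsPolyhedral.finite_faces {σ : Cone g} (h : IsPolyhedral σ) :
    {ρ | IsFace ρ σ}.Finite := by
  obtain ⟨G, hG, rfl⟩ := h
  refine (hG.finite_subsets.image (fun S => PointedCone.hull ℝ S)).subset ?_
  intro ρ hρ
  obtain ⟨ℓ, h0, rfl⟩ := isFace_iff_eq_zeroFace.1 hρ
  exact ⟨_, Set.sep_subset _ _, (zeroFace_hull fun x hx => h0 x (PointedCone.subset_hull hx)).symm⟩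

theorem exists_sub_smul_mem {A B : Submodule ℝ (Mat g)} (hAB : A ≤ B)
    (h : Module.finrank ℝ A + 1 = Module.finrank ℝ B) {v : Mat g} (hv : v ∈ B) (hvA : v ∉ A)
    {x : Mat g} (hx : x ∈ B) : ∃ t : ℝ, x - t • v ∈ A := by
  have hle : A ⊔ Submodule.span ℝ {v} ≤ B :=
    sup_le hAB ((Submodule.span_singleton_le_iff_mem _ _).2 hv)
  have hlt : A < A ⊔ Submodule.span ℝ {v} :=
    lt_of_le_of_ne le_sup_left fun e => hvA (e ▸ (Submodule.mem_sup_right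
      (Submodule.mem_span_singleton_self v)))
  have := Submodule.finrank_lt_finrank_of_lt hlt
  have e := Submodule.eq_of_le_of_finrank_le hle (by omega)
  rw [← e] at hx
  obtain ⟨a, ha, b, hb, rfl⟩ := Submodule.mem_sup.1 hx
  obtain ⟨t, rfl⟩ := Submodule.mem_span_singleton.1 hb
  exact ⟨t, by simpa using ha⟩

theorem IsFacet.le {ρ σ : Cone g} (h : IsFacet ρ σ) : ρ ≤ σ := h.1.le

theorem IsFacet.exists_mem_notMem {ρ σ : Cone g} (h : IsFacet ρ σ) : ∃ v ∈ σ, v ∉ ρ := by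
  by_contra! H
  have : ρ = σ := le_antisymm h.le H
  have := h.2
  subst ρ
  omega

theorem dim_lt_of_isFace {ρ σ : Cone g} (h : IsFace ρ σ) (hne : ρ ≠ σ) : dim ρ < dim σ := by
  apply Submodule.finrank_lt_finrank_of_lt
  refine lt_of_le_of_ne (linSpan_mono h.le) fun e => hne (le_antisymm h.le fun x hx => ?_)
  exact h.mem_of_mem_linSpan hx (e ▸ mem_linSpan hx)

theorem dim_zeroFace_lt {σ : Cone g} {ℓ : Mat g →ₗ[ℝ] ℝ} (h0 : ∀ y ∈ σ, 0 ≤ ℓ y) {x : Mat g}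
    (hx : x ∈ σ) (hℓ : ℓ x ≠ 0) : dim (zeroFace ℓ σ) < dim σ :=
  dim_lt_of_isFace (isFace_zeroFace h0) fun e => hℓ (mem_zeroFace.1 (e ▸ hx)).2

/-- A facet of a facet of a polyhedral cone lies in exactly one other facet, and is the
intersection of the two. -/
theorem exists_other_facet {σ ρ τ : Cone g} (hσ : IsPolyhedral σ) (hρ : IsFacet ρ σ)
    (hτ : IsFacet τ ρ) :
    ∃ ρ' : Cone g, ρ' ≠ ρ ∧ IsFacet ρ' σ ∧ IsFacet τ ρ' ∧ (∀ x ∈ ρ, x ∈ ρ' → x ∈ τ) ∧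
      ∀ ρ'' : Cone g, IsFacet ρ'' σ → IsFacet τ ρ'' → ρ'' = ρ ∨ ρ'' = ρ' := by
  obtain ⟨G, hG, rfl⟩ := hσ
  set σ := PointedCone.hull ℝ G with hσ
  obtain ⟨ℓ₁, h1, m1⟩ := isFace_iff.1 hρ.1
  obtain ⟨ℓ₂, h2, m2⟩ := isFace_iff.1 hτ.1
  have hGσ : ∀ x ∈ G, x ∈ σ := fun x hx => PointedCone.subset_hull hx
  -- a functional on `σ` that cuts out `τ`
  obtain ⟨N, hN⟩ : ∃ N : ℝ, ∀ x ∈ G, ℓ₁ x ≠ 0 → 0 < N * ℓ₁ x + ℓ₂ x := by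
    -- There are finitely many generators, so `N` can dominate `(1 - ℓ₂) / ℓ₁` on those with `ℓ₁ >
    -- 0`. There `N ℓ₁ + ℓ₂ ≥ 1`, although `ℓ₂` is controlled on `ρ` only.
    obtain ⟨N, hN⟩ := (hG.image fun x => (1 - ℓ₂ x) / ℓ₁ x).bddAbove
    refine ⟨N, fun x hx hne => ?_⟩
    have hpos : 0 < ℓ₁ x := lt_of_le_of_ne (h1 x (hGσ x hx)) hne.symm
    have := (div_le_iff₀ hpos).1 (hN (Set.mem_image_of_mem _ hx))
    linarith
  obtain ⟨ℓ, hℓ⟩ : ∃ ℓ : Mat g →ₗ[ℝ] ℝ, ℓ = N • ℓ₁ + ℓ₂ := ⟨_, rfl⟩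
  have hℓa : ∀ x, ℓ x = N * ℓ₁ x + ℓ₂ x := fun x => by simp [hℓ]
  have hG0 : ∀ x ∈ G, ℓ₁ x = 0 → x ∈ ρ := fun x hx e => (m1 x).2 ⟨hGσ x hx, e⟩
  have hℓG : ∀ x ∈ G, 0 ≤ ℓ x := fun x hx => by
    by_cases e : ℓ₁ x = 0
    · rw [hℓa, e, mul_zero, zero_add]; exact h2 x (hG0 x hx e)
    · rw [hℓa]; exact (hN x hx e).le
  have hℓσ : ∀ x ∈ σ, 0 ≤ ℓ x := fun x hx => nonneg_of_mem_hull hℓG hx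
  have hℓρ : ∀ x ∈ ρ, ℓ x = ℓ₂ x := fun x hx => by rw [hℓa, ((m1 x).1 hx).2]; ring
  have hℓτ : ∀ x, x ∈ τ ↔ x ∈ σ ∧ ℓ x = 0 := by
    intro x
    constructor
    · intro hx
      have h' := (m2 x).1 hx
      exact ⟨hρ.le h'.1, by rw [hℓρ x h'.1, h'.2]⟩
    · intro hx
      rw [← mem_hull_sep_iff hℓG] at hx
      have : PointedCone.hull ℝ {y ∈ G | ℓ y = 0} ≤ τ := by
        refine Submodule.span_le.2 ?_
        rintro y ⟨hy, hy0⟩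
        have : ℓ₁ y = 0 := by
          by_contra hne
          have := hN y hy hne
          rw [← hℓa] at this
          exact this.ne' hy0
        have hyρ := hG0 y hy this
        exact (m2 y).2 ⟨hyρ, by rw [← hℓρ y hyρ, hy0]⟩
      exact this hx
  -- the largest slope
  have hex : ∃ w ∈ G, 0 < ℓ w ∧ 0 < ℓ₁ w := by
    obtain ⟨v, hv, hvρ⟩ := hρ.exists_mem_notMem
    by_contra! H
    have : ∀ x ∈ G, ℓ₁ x = 0 := fun x hx => by
      by_contra hne
      have hp := hN x hx hne
      rw [← hℓa] at hp
      exact hne (le_antisymm (H x hx hp) (h1 x (hGσ x hx)))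
    exact hvρ ((m1 v).2 ⟨hv, eq_zero_of_mem_hull this hv⟩)
  -- Modulo the span of `τ` the cone is planar with coordinates `(ℓ, ℓ₁)`, and `ρ` is its edge `ℓ₁ =
  -- 0`. The other edge is the ray of maximal slope `M`, cut out by `M ℓ - ℓ₁`.
  obtain ⟨w, ⟨hwG, hwℓ⟩, hwmax⟩ := Set.exists_max_image {w ∈ G | 0 < ℓ w} (fun x => ℓ₁ x / ℓ x)
    (hG.subset (Set.sep_subset _ _)) (hex.imp fun w hw => ⟨hw.1, hw.2.1⟩)
  obtain ⟨M, hM⟩ : ∃ M, M = ℓ₁ w / ℓ w := ⟨_, rfl⟩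
  have hMw : ℓ₁ w = M * ℓ w := by rw [hM]; field_simp
  have hMpos : 0 < M := by
    obtain ⟨z, hz, hz1, hz2⟩ := hex
    have : ℓ₁ z / ℓ z ≤ ℓ₁ w / ℓ w := hwmax z ⟨hz, hz1⟩
    rw [hM]
    exact lt_of_lt_of_le (by positivity) this
  have hwσ := hGσ w hwG
  have hw1 : 0 < ℓ₁ w := by rw [hMw]; positivity
  have hℓ'G : ∀ x ∈ G, 0 ≤ (M • ℓ - ℓ₁) x := fun x hx => by
    simp only [LinearMap.sub_apply, LinearMap.smul_apply, smul_eq_mul]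
    rcases (hℓG x hx).eq_or_lt with e | hpos
    · have : x ∈ τ := (hℓτ x).2 ⟨hGσ x hx, e.symm⟩
      have := ((m1 x).1 (hτ.le this)).2
      rw [this, ← e]; simp
    · have : ℓ₁ x / ℓ x ≤ ℓ₁ w / ℓ w := hwmax x ⟨hx, hpos⟩
      rw [← hM, div_le_iff₀ hpos] at this
      linarith
  have hℓ'σ : ∀ x ∈ σ, 0 ≤ (M • ℓ - ℓ₁) x := fun x hx => nonneg_of_mem_hull hℓ'G hx
  have hmem : ∀ x, x ∈ zeroFace (M • ℓ - ℓ₁) σ ↔ x ∈ σ ∧ ℓ₁ x = M * ℓ x := fun x => by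
    rw [mem_zeroFace]
    simp only [LinearMap.sub_apply, LinearMap.smul_apply, smul_eq_mul, sub_eq_zero]
    exact and_congr_right fun _ => eq_comm
  obtain ⟨u, huρ, huτ⟩ := hτ.exists_mem_notMem
  have huσ := hρ.le huρ
  have hu1 : ℓ₁ u = 0 := ((m1 u).1 huρ).2
  have huℓ : 0 < ℓ u := lt_of_le_of_ne (hℓσ u huσ) fun e => huτ ((hℓτ u).2 ⟨huσ, e.symm⟩)
  have hτρ' : τ ≤ zeroFace (M • ℓ - ℓ₁) σ := fun x hx => by
    rw [hmem, ((hℓτ x).1 hx).2, ((m1 x).1 (hτ.le hx)).2]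
    exact ⟨((hℓτ x).1 hx).1, by simp⟩
  have hwρ' : w ∈ zeroFace (M • ℓ - ℓ₁) σ := (hmem w).2 ⟨hwσ, hMw⟩
  have hτface : IsFace τ (zeroFace (M • ℓ - ℓ₁) σ) := by
    refine isFace_iff.2 ⟨ℓ, fun y hy => hℓσ y ((hmem y).1 hy).1, fun x => ?_⟩
    refine ⟨fun hx => ⟨hτρ' hx, ((hℓτ x).1 hx).2⟩, fun hx => ?_⟩
    exact (hℓτ x).2 ⟨((hmem x).1 hx.1).1, hx.2⟩
  have hne : zeroFace (M • ℓ - ℓ₁) σ ≠ ρ := fun e => by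
    have := ((hmem u).1 (e ▸ huρ)).2
    rw [hu1] at this
    exact (mul_pos hMpos huℓ).ne this
  have hd1 : dim (zeroFace (M • ℓ - ℓ₁) σ) < dim σ := by
    refine dim_zeroFace_lt hℓ'σ huσ ?_
    simp [hu1, hMpos.ne', huℓ.ne']
  have hd2 : dim τ < dim (zeroFace (M • ℓ - ℓ₁) σ) :=
    dim_lt_of_isFace hτface fun e => hwℓ.ne' ((hℓτ w).1 (e ▸ hwρ')).2
  have hdρ := hρ.2
  have hdτ := hτ.2
  refine ⟨zeroFace (M • ℓ - ℓ₁) σ, hne, ⟨isFace_zeroFace hℓ'σ, by omega⟩, ⟨hτface, by omega⟩,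
    fun x hxρ hx => ?_, fun ρ'' h'' hτ'' => ?_⟩
  · have h3 := ((hmem x).1 hx)
    rw [((m1 x).1 hxρ).2] at h3
    refine (hℓτ x).2 ⟨h3.1, ?_⟩
    rcases mul_eq_zero.1 h3.2.symm with h | h
    · exact absurd h hMpos.ne'
    · exact h
  · have hU0 : ∀ y ∈ linSpan τ, ℓ y = 0 := fun y hy =>
      eq_zero_of_mem_linSpan (fun y hy => ((hℓτ y).1 hy).2) hy
    have hU1 : ∀ y ∈ linSpan τ, ℓ₁ y = 0 := fun y hy =>
      eq_zero_of_mem_linSpan (fun y hy => ((m1 y).1 (hτ.le hy)).2) hy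
    -- In the plane, `σ` is the quadrant spanned by the edge vectors `u` of `ρ` and `w` of the other
    -- facet. A functional defining a facet through `τ` is determined by its values at `u` and `w`,
    -- and exactly one of these must vanish.
    have hdec : ∀ x ∈ σ, ∃ a b : ℝ, 0 ≤ a ∧ 0 ≤ b ∧ x - b • w - a • u ∈ linSpan τ ∧
        ℓ₁ x = b * ℓ₁ w ∧ (M * ℓ x - ℓ₁ x) = a * (M * ℓ u) := by
      intro x hx
      obtain ⟨b, hb⟩ := exists_sub_smul_mem (linSpan_mono hρ.le) hρ.2 (mem_linSpan hwσ)
        (fun h => hw1.ne' (eq_zero_of_mem_linSpan (fun y hy => ((m1 y).1 hy).2) h)) (mem_linSpan hx)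
      obtain ⟨a, ha⟩ := exists_sub_smul_mem (linSpan_mono hτ.le) hτ.2 (mem_linSpan huρ)
        (fun h => huℓ.ne' (hU0 _ h)) hb
      have e0 := hU0 _ ha
      have e1 := hU1 _ ha
      simp only [map_sub, map_smul, smul_eq_mul, hu1] at e0 e1
      have e2 : ℓ₁ x = b * ℓ₁ w := by linarith
      have e3 : M * ℓ x - ℓ₁ x = a * (M * ℓ u) := by rw [e2, hMw]; linear_combination M * e0
      refine ⟨a, b, ?_, ?_, ha, e2, e3⟩
      · have := hℓ'σ x hx
        simp only [LinearMap.sub_apply, LinearMap.smul_apply, smul_eq_mul] at this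
        rw [e3] at this
        exact nonneg_of_mul_nonneg_left this (mul_pos hMpos huℓ)
      · have := h1 x hx
        rw [e2] at this
        exact nonneg_of_mul_nonneg_left this hw1
    obtain ⟨ℓ₃, h3, m3⟩ := isFace_iff.1 h''.1
    have hdec3 : ∀ x a b, x - b • w - a • u ∈ linSpan τ → ℓ₃ x = b * ℓ₃ w + a * ℓ₃ u := by
      intro x a b h
      have := eq_zero_of_mem_linSpan (fun y hy => ((m3 y).1 (hτ''.le hy)).2) h
      simp only [map_sub, map_smul, smul_eq_mul] at this
      linarith
    have h3u := h3 u huσ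
    have h3w := h3 w hwσ
    have hnot : ¬ (ℓ₃ u = 0 ∧ ℓ₃ w = 0) := by
      rintro ⟨hu, hw⟩
      obtain ⟨v, hv, hvρ⟩ := h''.exists_mem_notMem
      obtain ⟨a, b, -, -, hab, -⟩ := hdec v hv
      exact hvρ ((m3 v).2 ⟨hv, by rw [hdec3 v a b hab, hu, hw]; ring⟩)
    have hor : ℓ₃ u = 0 ∨ ℓ₃ w = 0 := by
      by_contra! H
      obtain ⟨x, hx, hxτ⟩ := hτ''.exists_mem_notMem
      obtain ⟨a, b, ha, hb, hab, -⟩ := hdec x (h''.le hx)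
      have e := ((m3 x).1 hx).2
      rw [hdec3 x a b hab] at e
      have p1 := mul_nonneg hb h3w
      have p2 := mul_nonneg ha h3u
      have ea : a = 0 := (mul_eq_zero.1 (by linarith : a * ℓ₃ u = 0)).resolve_right H.1
      have eb : b = 0 := (mul_eq_zero.1 (by linarith : b * ℓ₃ w = 0)).resolve_right H.2
      rw [ea, eb] at hab
      simp only [zero_smul, sub_zero] at hab
      exact hxτ ((hℓτ x).2 ⟨h''.le hx, hU0 _ hab⟩)
    rcases hor with hu | hw
    · left
      have hw : ℓ₃ w ≠ 0 := fun h => hnot ⟨hu, h⟩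
      refine SetLike.ext fun x => ?_
      rw [m3, m1]
      refine and_congr_right fun hx => ?_
      obtain ⟨a, b, -, -, hab, e1, -⟩ := hdec x hx
      rw [hdec3 x a b hab, e1, hu]
      simp [hw, hw1.ne']
    · right
      have hu : ℓ₃ u ≠ 0 := fun h => hnot ⟨h, hw⟩
      refine SetLike.ext fun x => ?_
      rw [m3, hmem]
      refine and_congr_right fun hx => ?_
      obtain ⟨a, b, -, -, hab, -, e1⟩ := hdec x hx
      rw [hdec3 x a b hab, hw, eq_comm (a := ℓ₁ x), ← sub_eq_zero (a := M * ℓ x), e1]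
      simp [hu, hMpos.ne', huℓ.ne']

end Faces

/-! ### Alternating forms, contraction and comparison of signs -/

section Forms

variable {g m : ℕ}

/-- Alternating forms of degree `m` on the space of matrices. -/
abbrev Form (g m : ℕ) : Type := Mat g [⋀^Fin m]→ₗ[ℝ] ℝ

/-- The two forms agree on `W` up to a positive factor. -/
def SameOn (W : Submodule ℝ (Mat g)) (D E : Form g m) : Prop :=
  ∃ c : ℝ, 0 < c ∧ ∀ x : Fin m → Mat g, (∀ i, x i ∈ W) → D x = c * E x

/-- The form restricts to a volume form of `W`. -/
def IsVol (W : Submodule ℝ (Mat g)) (D : Form g m) : Prop :=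
  Module.finrank ℝ W = m ∧ ∃ x : Fin m → Mat g, (∀ i, x i ∈ W) ∧ D x ≠ 0

namespace SameOn

variable {W : Submodule ℝ (Mat g)} {D E F : Form g m}

theorem refl (W : Submodule ℝ (Mat g)) (D : Form g m) : SameOn W D D :=
  ⟨1, one_pos, fun _ _ => (one_mul _).symm⟩

theorem of_eq (h : ∀ x : Fin m → Mat g, (∀ i, x i ∈ W) → D x = E x) : SameOn W D E :=
  ⟨1, one_pos, fun x hx => by rw [h x hx, one_mul]⟩

theorem symm (h : SameOn W D E) : SameOn W E D := by
  obtain ⟨c, hc, h⟩ := h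
  exact ⟨c⁻¹, by positivity, fun x hx => by rw [h x hx]; field_simp⟩

theorem trans (h : SameOn W D E) (h' : SameOn W E F) : SameOn W D F := by
  obtain ⟨c, hc, h⟩ := h
  obtain ⟨d, hd, h'⟩ := h'
  exact ⟨c * d, by positivity, fun x hx => by rw [h x hx, h' x hx]; ring⟩

theorem neg (h : SameOn W D E) : SameOn W (-D) (-E) := by
  obtain ⟨c, hc, h⟩ := h
  exact ⟨c, hc, fun x hx => by simp [h x hx]⟩

theorem isVol (h : SameOn W D E) (hD : IsVol W D) : IsVol W E := by
  obtain ⟨c, hc, h⟩ := h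
  obtain ⟨x, hx, hne⟩ := hD.2
  refine ⟨hD.1, x, hx, fun e => hne ?_⟩
  rw [h x hx, e, mul_zero]

end SameOn

theorem IsVol.neg {W : Submodule ℝ (Mat g)} {D : Form g m} (h : IsVol W D) : IsVol W (-D) :=
  ⟨h.1, h.2.imp fun x hx => ⟨hx.1, by simpa using hx.2⟩⟩

theorem IsVol.not_sameOn_neg {W : Submodule ℝ (Mat g)} {D : Form g m} (h : IsVol W D) :
    ¬ SameOn W D (-D) := by
  rintro ⟨c, hc, h'⟩
  obtain ⟨x, hx, hne⟩ := h.2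
  have := h' x hx
  simp only [AlternatingMap.neg_apply] at this
  have : (1 + c) * D x = 0 := by linear_combination this
  rcases mul_eq_zero.1 this with h | h
  · linarith
  · exact hne h

theorem apply_eq_mul_det {W : Submodule ℝ (Mat g)} (D : Form g m)
    (b : Module.Basis (Fin m) ℝ W) {x : Fin m → Mat g} (hx : ∀ i, x i ∈ W) :
    D x = D (fun i => (b i : Mat g)) * b.det (fun i => ⟨x i, hx i⟩) := by
  have := congrArg (fun f => f (fun i => (⟨x i, hx i⟩ : W)))
    ((D.compLinearMap W.subtype).eq_smul_basis_det b)
  simpa [Function.comp_def] using this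

theorem IsVol.apply_basis_ne_zero {W : Submodule ℝ (Mat g)} {D : Form g m} (h : IsVol W D)
    (b : Module.Basis (Fin m) ℝ W) : D (fun i => (b i : Mat g)) ≠ 0 := by
  intro e
  obtain ⟨x, hx, hne⟩ := h.2
  exact hne (by rw [apply_eq_mul_det D b hx, e, zero_mul])

theorem isVol_of_basis {W : Submodule ℝ (Mat g)} {D : Form g m} (b : Module.Basis (Fin m) ℝ W)
    (h : D (fun i => (b i : Mat g)) ≠ 0) : IsVol W D :=
  ⟨by simpa using Module.finrank_eq_card_basis b, _, fun i => (b i).2, h⟩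

/-- A basis of `W` indexed by `Fin m`. -/
theorem exists_basis {W : Submodule ℝ (Mat g)} (h : Module.finrank ℝ W = m) :
    Nonempty (Module.Basis (Fin m) ℝ W) := ⟨Module.finBasisOfFinrankEq ℝ W h⟩

theorem sameOn_of_basis {W : Submodule ℝ (Mat g)} {D E : Form g m} (b : Module.Basis (Fin m) ℝ W)
    (h : 0 < D (fun i => (b i : Mat g)) * E (fun i => (b i : Mat g))) : SameOn W D E := by
  have hE : E (fun i => (b i : Mat g)) ≠ 0 := fun e => by simp [e] at h
  refine ⟨D (fun i => (b i : Mat g)) / E (fun i => (b i : Mat g)), ?_, fun x hx => ?_⟩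
  · rw [div_eq_mul_inv, ← mul_pos_iff_of_pos_right (mul_self_pos.2 hE)]
    field_simp
    linarith
  · rw [apply_eq_mul_det D b hx, apply_eq_mul_det E b hx]
    field_simp

theorem SameOn.pos_iff {W : Submodule ℝ (Mat g)} {D E : Form g m} (h : SameOn W D E)
    {x : Fin m → Mat g} (hx : ∀ i, x i ∈ W) : 0 < D x ↔ 0 < E x := by
  obtain ⟨c, hc, h⟩ := h
  rw [h x hx]
  exact mul_pos_iff_of_pos_left hc

theorem sameOn_of_basis_iff {W : Submodule ℝ (Mat g)} {D E : Form g m} (hD : IsVol W D)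
    (hE : IsVol W E) (b : Module.Basis (Fin m) ℝ W)
    (h : 0 < D (fun i => (b i : Mat g)) ↔ 0 < E (fun i => (b i : Mat g))) : SameOn W D E := by
  refine sameOn_of_basis b ?_
  rcases (hD.apply_basis_ne_zero b).lt_or_gt with h1 | h1
  · rcases (hE.apply_basis_ne_zero b).lt_or_gt with h2 | h2
    · exact mul_pos_of_neg_of_neg h1 h2
    · exact absurd (h.2 h2) h1.not_gt
  · exact mul_pos h1 (h.1 h1)

theorem IsVol.sameOn_or {W : Submodule ℝ (Mat g)} {D E : Form g m} (hD : IsVol W D)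
    (hE : IsVol W E) : SameOn W D E ∨ SameOn W D (-E) := by
  obtain ⟨b⟩ := exists_basis hD.1
  by_cases h : 0 < D (fun i => (b i : Mat g)) ↔ 0 < E (fun i => (b i : Mat g))
  · exact Or.inl (sameOn_of_basis_iff hD hE b h)
  · refine Or.inr (sameOn_of_basis_iff hD hE.neg b ?_)
    have h1 := hD.apply_basis_ne_zero b
    have h2 := hE.apply_basis_ne_zero b
    simp only [AlternatingMap.neg_apply, Left.neg_pos_iff]
    rcases h1.lt_or_gt with h1 | h1 <;> rcases h2.lt_or_gt with h2 | h2 <;>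
      simp_all [not_lt_of_gt]

theorem exists_basis_snoc {R W : Submodule ℝ (Mat g)} (hRW : R ≤ W)
    (hW : Module.finrank ℝ R + 1 = Module.finrank ℝ W) {v : Mat g} (hv : v ∈ W) (hvR : v ∉ R)
    (b' : Module.Basis (Fin m) ℝ R) :
    ∃ b : Module.Basis (Fin (m + 1)) ℝ W,
      (∀ i : Fin m, (b i.castSucc : Mat g) = (b' i : Mat g)) ∧ (b (Fin.last m) : Mat g) = v := by
  have hm : Module.finrank ℝ R = m := by simpa using Module.finrank_eq_card_basis b'
  have hli : LinearIndependent ℝ (fun i => (b' i : Mat g)) :=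
    b'.linearIndependent.map' R.subtype (Submodule.ker_subtype R)
  have hspan : Submodule.span ℝ (Set.range fun i => (b' i : Mat g)) = R := by
    have : (Set.range fun i => (b' i : Mat g)) = R.subtype '' Set.range b' := by
      rw [← Set.range_comp]; rfl
    rw [this, Submodule.span_image, b'.span_eq, Submodule.map_top, Submodule.range_subtype]
  have hli' : LinearIndependent ℝ (Fin.snoc (fun i => (b' i : Mat g)) v : Fin (m + 1) → Mat g) :=
    linearIndependent_finSnoc.2 ⟨hli, by rwa [hspan]⟩
  have hmem : ∀ i, (Fin.snoc (fun i => (b' i : Mat g)) v : Fin (m + 1) → Mat g) i ∈ W := by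
    intro i
    refine Fin.lastCases ?_ (fun i => ?_) i
    · simpa using hv
    · simpa using hRW (b' i).2
  have hli'' : LinearIndependent ℝ (fun i => (⟨_, hmem i⟩ : W)) :=
    LinearIndependent.of_comp W.subtype hli'
  refine ⟨basisOfLinearIndependentOfCardEqFinrank hli'' (by simp [← hW, hm]), fun i => ?_, ?_⟩
  · simp
  · simp

/-- Contraction of the last argument of a form. -/
def contr (D : Form g (m + 1)) (v : Mat g) : Form g m := (-1 : ℝ) ^ m • D.curryLeft v

/-- The sign in `contr` moves the inserted vector from the first slot to the last, where `IsInduced`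
places the vector outside the facet. -/
theorem contr_apply (D : Form g (m + 1)) (v : Mat g) (x : Fin m → Mat g) :
    contr D v x = D (Fin.snoc x v : Fin (m + 1) → Mat g) := by
  have := D.map_insertNth (Fin.last m) v x
  rw [Fin.insertNth_last'] at this
  rw [this]
  simp [contr]

theorem contr_basis (D : Form g (m + 1)) {R W : Submodule ℝ (Mat g)}
    (b' : Module.Basis (Fin m) ℝ R) (b : Module.Basis (Fin (m + 1)) ℝ W)
    (h : ∀ i : Fin m, (b i.castSucc : Mat g) = (b' i : Mat g)) :
    contr D (b (Fin.last m) : Mat g) (fun i => (b' i : Mat g)) = D (fun i => (b i : Mat g)) := by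
  rw [contr_apply]
  congr 1
  funext i
  refine Fin.lastCases ?_ (fun i => ?_) i
  · simp
  · simp [h]

theorem contr_neg (D : Form g (m + 1)) (v : Mat g) : contr (-D) v = -contr D v := by
  ext x; simp [contr_apply]

theorem contr_add (D : Form g (m + 1)) (v w : Mat g) :
    contr D (v + w) = contr D v + contr D w := by
  simp [contr]

theorem contr_smul (D : Form g (m + 1)) (c : ℝ) (v : Mat g) :
    contr D (c • v) = c • contr D v := by
  rw [contr, contr, map_smul, smul_comm]

/-- Polarize the vanishing of the double contraction with a single vector. This is the source of all
cancellations, in `∂² = 0` as in the homotopy formula. -/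
theorem contr_contr (D : Form g (m + 2)) (v w : Mat g) :
    contr (contr D v) w = -contr (contr D w) v := by
  have key : ∀ u : Mat g, contr (contr D u) u = 0 := fun u => by
    ext x
    simp only [contr_apply, AlternatingMap.zero_apply]
    refine D.map_eq_zero_of_eq _ (i := (Fin.last m).castSucc) (j := Fin.last (m + 1)) ?_ ?_
    · simp
    · exact (Fin.castSucc_lt_last _).ne
  have h := key (v + w)
  have hadd : ∀ A B : Form g (m + 1), ∀ u, contr (A + B) u = contr A u + contr B u := by
    intro A B u; ext x; simp [contr_apply]
  rw [contr_add, contr_add, hadd, hadd, key, key, zero_add, add_zero] at h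
  exact eq_neg_of_add_eq_zero_right h

theorem IsVol.contr {R W : Submodule ℝ (Mat g)} (hRW : R ≤ W)
    (hW : Module.finrank ℝ R + 1 = Module.finrank ℝ W) {v : Mat g} (hv : v ∈ W) (hvR : v ∉ R)
    {D : Form g (m + 1)} (hD : IsVol W D) : IsVol R (contr D v) := by
  obtain ⟨b'⟩ := exists_basis (W := R) (m := m) (by have := hD.1; omega)
  obtain ⟨b, hb, rfl⟩ := exists_basis_snoc hRW hW hv hvR b'
  exact isVol_of_basis b' (by rw [contr_basis D b' b hb]; exact hD.apply_basis_ne_zero b)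

theorem SameOn.contr {R W : Submodule ℝ (Mat g)} {D E : Form g (m + 1)} (h : SameOn W D E)
    (hRW : R ≤ W) {v : Mat g} (hv : v ∈ W) : SameOn R (contr D v) (contr E v) := by
  obtain ⟨c, hc, h⟩ := h
  refine ⟨c, hc, fun x hx => ?_⟩
  rw [contr_apply, contr_apply]
  refine h _ fun i => Fin.lastCases ?_ (fun i => ?_) i
  · simpa using hv
  · simpa using hRW (hx i)

/-- The difference `w - c • v` contributes nothing, because `m + 1` vectors of an `m`-dimensional
space are dependent. So only the side of `R` on which the vector lies matters. -/
theorem sameOn_contr_of_sub_mem {R : Submodule ℝ (Mat g)} (hR : Module.finrank ℝ R = m)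
    (D : Form g (m + 1)) {v w : Mat g} {c : ℝ} (hc : 0 < c) (h : w - c • v ∈ R) :
    SameOn R (contr D w) (contr D v) := by
  refine ⟨c, hc, fun x hx => ?_⟩
  have e : contr D w x = contr D (w - c • v) x + c * contr D v x := by
    have : w = (w - c • v) + c • v := by abel
    conv_lhs => rw [this, contr_add, contr_smul]
    simp
  rw [e, add_eq_right, contr_apply]
  apply AlternatingMap.map_linearDependent
  intro hli
  have hmem : ∀ i, (Fin.snoc x (w - c • v) : Fin (m + 1) → Mat g) i ∈ R := fun i => by
    refine Fin.lastCases ?_ (fun i => ?_) i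
    · simpa using h
    · simpa using hx i
  have hli' : LinearIndependent ℝ
      (fun i => (⟨(Fin.snoc x (w - c • v) : Fin (m + 1) → Mat g) i, hmem i⟩ : R)) :=
    LinearIndependent.of_comp R.subtype hli
  have := hli'.fintype_card_le_finrank
  simp [hR] at this

/-- Two volume forms agree up to sign, and contraction with a vector outside a hyperplane detects
the sign. Orientations of `σ + ray c` can therefore be compared on `σ`. -/
theorem sameOn_of_contr {R W : Submodule ℝ (Mat g)} (hRW : R ≤ W)
    (hW : Module.finrank ℝ R + 1 = Module.finrank ℝ W) {v : Mat g} (hv : v ∈ W) (hvR : v ∉ R)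
    {D E : Form g (m + 1)} (hD : IsVol W D) (hE : IsVol W E)
    (h : SameOn R (PerfectCone.contr D v) (PerfectCone.contr E v)) : SameOn W D E := by
  refine (hD.sameOn_or hE).resolve_right fun h' => ?_
  have h'' := h'.contr hRW hv
  rw [contr_neg] at h''
  exact (hE.contr hRW hW hv hvR).not_sameOn_neg (h.symm.trans h'')

theorem sameOn_comp_iff {W : Submodule ℝ (Mat g)} {f : Mat g →ₗ[ℝ] Mat g} {D E : Form g m} :
    SameOn W (D.compLinearMap f) (E.compLinearMap f) ↔ SameOn (W.map f) D E := by
  refine exists_congr fun c => and_congr_right fun _ => ⟨fun h x hx => ?_, fun h x hx => ?_⟩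
  · choose y hy hyx using hx
    have := h y hy
    simp only [AlternatingMap.compLinearMap_apply, hyx] at this
    exact this
  · simpa using h (fun i => f (x i)) fun i => Submodule.mem_map_of_mem (hx i)

theorem isVol_comp_iff {W : Submodule ℝ (Mat g)} {f : Mat g →ₗ[ℝ] Mat g}
    (hf : Function.Injective f) {D : Form g m} :
    IsVol W (D.compLinearMap f) ↔ IsVol (W.map f) D := by
  have : Module.finrank ℝ (W.map f) = Module.finrank ℝ W :=
    ((Submodule.equivMapOfInjective f hf W).finrank_eq).symm
  rw [IsVol, IsVol, this]
  refine and_congr_right fun _ => ⟨?_, ?_⟩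
  · rintro ⟨x, hx, hne⟩
    exact ⟨fun i => f (x i), fun i => Submodule.mem_map_of_mem (hx i), by simpa using hne⟩
  · rintro ⟨x, hx, hne⟩
    choose y hy hyx using hx
    exact ⟨y, hy, by simpa [hyx] using hne⟩

theorem contr_comp (D : Form g (m + 1)) (f : Mat g →ₗ[ℝ] Mat g) (v : Mat g) :
    contr (D.compLinearMap f) v = (contr D (f v)).compLinearMap f := by
  ext x
  simp only [contr_apply, AlternatingMap.compLinearMap_apply]
  congr 1
  funext i
  refine Fin.lastCases ?_ (fun i => ?_) i <;> simp

end Forms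

/-! ### Forms representing orientations of cones -/

section Orientations

variable {g m : ℕ}

/-- The form represents the orientation. -/
def Represents {σ : Cone g} (ω : ConeOrientation σ) (D : Form g m) : Prop :=
  IsVol (linSpan σ) D ∧ ∀ b : Module.Basis (Fin m) ℝ (linSpan σ),
    IsPositive ω b ↔ 0 < D (fun i => (b i : Mat g))

theorem represents_of_ray {σ : Cone g} (D : Form g (Module.finrank ℝ (linSpan σ)))
    (f : linSpan σ [⋀^Fin (Module.finrank ℝ (linSpan σ))]→ₗ[ℝ] ℝ) (hf : f ≠ 0)
    (h : ∀ x : Fin (Module.finrank ℝ (linSpan σ)) → linSpan σ, D (fun i => (x i : Mat g)) = f x) :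
    Represents (rayOfNeZero ℝ f hf : ConeOrientation σ) D := by
  constructor
  · let b := Module.finBasis ℝ (linSpan σ)
    refine isVol_of_basis b ?_
    rw [h]
    exact (f.map_basis_ne_zero_iff b).2 hf
  · intro b
    have hb : f b ≠ 0 := (f.map_basis_ne_zero_iff b).2 hf
    have hdet : b.det ≠ 0 := b.det_ne_zero
    rw [h]
    have : IsPositive (rayOfNeZero ℝ f hf : ConeOrientation σ) b ↔
        b.orientation = rayOfNeZero ℝ f hf := by
      constructor
      · rintro ⟨e, he⟩
        simpa using he
      · intro he
        exact ⟨rfl, by simpa using he⟩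
    rw [this, Module.Basis.orientation, ray_eq_iff]
    conv_lhs => rw [f.eq_smul_basis_det b]
    exact sameRay_smul_right_iff_of_ne hdet hb

/-- A linear retraction onto the span extends the intrinsic volume form to the ambient space. Forms
on a common space make it possible to relate different cones without transport between their spans.
-/
theorem exists_represents {σ : Cone g} (ω : ConeOrientation σ) :
    ∃ D : Form g (Module.finrank ℝ (linSpan σ)), Represents ω D := by
  obtain ⟨P, hP⟩ := (linSpan σ).subtype.exists_leftInverse_of_injective
    (Submodule.ker_subtype _)
  have hω : ω = rayOfNeZero ℝ ω.someVector ω.someVector_ne_zero := ω.someVector_ray.symm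
  refine ⟨ω.someVector.compLinearMap P, ?_⟩
  rw [hω]
  refine represents_of_ray _ _ _ fun x => ?_
  rw [← hω]
  simp only [AlternatingMap.compLinearMap_apply]
  congr 1
  funext i
  exact LinearMap.congr_fun hP (x i)

theorem exists_orientation {σ : Cone g} {D : Form g m} (hD : IsVol (linSpan σ) D) :
    ∃ ω : ConeOrientation σ, Represents ω D := by
  obtain ⟨rfl, x, hx, hne⟩ := hD
  refine ⟨rayOfNeZero ℝ (D.compLinearMap (linSpan σ).subtype) fun e => hne ?_,
    represents_of_ray D _ _ fun x => rfl⟩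
  exact congrArg (fun f => f fun i => (⟨x i, hx i⟩ : linSpan σ)) e

theorem Represents.sameOn {σ : Cone g} {ω : ConeOrientation σ} {D E : Form g m}
    (hD : Represents ω D) (hE : Represents ω E) : SameOn (linSpan σ) D E := by
  obtain ⟨b⟩ := exists_basis hD.1.1
  exact sameOn_of_basis_iff hD.1 hE.1 b ((hD.2 b).symm.trans (hE.2 b))

theorem Represents.of_sameOn {σ : Cone g} {ω : ConeOrientation σ} {D E : Form g m}
    (hD : Represents ω D) (h : SameOn (linSpan σ) D E) : Represents ω E :=
  ⟨h.isVol hD.1, fun b => (hD.2 b).trans (h.pos_iff fun i => (b i).2)⟩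

end Orientations

/-! ### Positive definite forms and perfection of faces -/

section PerfectForms

open Matrix

variable {g : ℕ}

/-- The rank one form `ξ ξᵗ`. -/
def rankOne (ξ : Fin g → ℤ) : Mat g := vecMulVec (toReal ξ) (toReal ξ)

theorem dotProduct_mulVec_eq_sum (Q : Mat g) (x : Fin g → ℝ) :
    x ⬝ᵥ Q *ᵥ x = ∑ i, ∑ j, Q i j * (x i * x j) := by
  simp only [dotProduct, mulVec, Finset.mul_sum]
  exact Finset.sum_congr rfl fun i _ => Finset.sum_congr rfl fun j _ => by ring

theorem dotProduct_mulVec_smul_smul (Q : Mat g) (a : ℝ) (x : Fin g → ℝ) :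
    (a • x) ⬝ᵥ Q *ᵥ (a • x) = a ^ 2 * (x ⬝ᵥ Q *ᵥ x) := by
  rw [mulVec_smul, dotProduct_smul, smul_dotProduct, smul_eq_mul, smul_eq_mul]; ring

theorem continuous_dotProduct_mulVec (Q : Mat g) :
    Continuous fun x : Fin g → ℝ => x ⬝ᵥ Q *ᵥ x := by
  simp only [dotProduct_mulVec_eq_sum]
  fun_prop

theorem exists_pos_mul_norm_sq_le {Q : Mat g} (hQ : Q.PosDef) :
    ∃ c : ℝ, 0 < c ∧ ∀ x : Fin g → ℝ, c * ‖x‖ ^ 2 ≤ x ⬝ᵥ Q *ᵥ x := by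
  -- The unit sphere is empty exactly when `g = 0`; otherwise the minimum on it is the constant.
  rcases (Metric.sphere (0 : Fin g → ℝ) 1).eq_empty_or_nonempty with he | hne
  · refine ⟨1, one_pos, fun x => ?_⟩
    have hx : x = 0 := by
      by_contra hx
      have : ‖x‖⁻¹ • x ∈ Metric.sphere (0 : Fin g → ℝ) 1 := by
        simp [norm_smul, hx]
      rw [he] at this
      exact this
    simp [hx]
  · obtain ⟨u, hu, hmin⟩ := (isCompact_sphere (0 : Fin g → ℝ) 1).exists_isMinOn hne
      (continuous_dotProduct_mulVec Q).continuousOn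
    have hu0 : u ≠ 0 := by rintro rfl; simp at hu
    have hpos : 0 < u ⬝ᵥ Q *ᵥ u := by simpa using hQ.dotProduct_mulVec_pos hu0
    refine ⟨_, hpos, fun x => ?_⟩
    by_cases hx : x = 0
    · simp [hx]
    have hx' : ‖x‖ ≠ 0 := by simpa using hx
    have hmem : ‖x‖⁻¹ • x ∈ Metric.sphere (0 : Fin g → ℝ) 1 := by simp [norm_smul, hx]
    have := hmin hmem
    simp only [Set.mem_ofPred_eq] at this
    rw [dotProduct_mulVec_smul_smul, inv_pow, inv_mul_eq_div, le_div_iff₀ (by positivity)] at this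
    exact this

theorem exists_abs_le_mul {Q : Mat g} (hQ : Q.PosDef) (H : Mat g) :
    ∃ C : ℝ, 0 ≤ C ∧ ∀ x : Fin g → ℝ, |x ⬝ᵥ H *ᵥ x| ≤ C * (x ⬝ᵥ Q *ᵥ x) := by
  obtain ⟨c, hc, h⟩ := exists_pos_mul_norm_sq_le hQ
  refine ⟨(∑ i, ∑ j, |H i j|) / c, by positivity, fun x => ?_⟩
  calc |x ⬝ᵥ H *ᵥ x| ≤ ∑ i, ∑ j, |H i j| * ‖x‖ ^ 2 := by
        rw [dotProduct_mulVec_eq_sum]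
        refine (Finset.abs_sum_le_sum_abs _ _).trans (Finset.sum_le_sum fun i _ => ?_)
        refine (Finset.abs_sum_le_sum_abs _ _).trans (Finset.sum_le_sum fun j _ => ?_)
        rw [abs_mul, abs_mul, sq]
        gcongr
        · exact norm_le_pi_norm x i
        · exact norm_le_pi_norm x j
    _ = (∑ i, ∑ j, |H i j|) / c * (c * ‖x‖ ^ 2) := by
        simp only [← Finset.sum_mul]; field_simp
    _ ≤ _ := by gcongr; exact h x

theorem toReal_eq_zero {ξ : Fin g → ℤ} : toReal ξ = 0 ↔ ξ = 0 := by
  simp [toReal, funext_iff]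

theorem toReal_dotProduct (ξ ζ : Fin g → ℤ) : toReal ξ ⬝ᵥ toReal ζ = ((ξ ⬝ᵥ ζ : ℤ) : ℝ) := by
  simp [toReal, dotProduct]

theorem formValue_pos {Q : Mat g} (hQ : Q.PosDef) {ξ : Fin g → ℤ} (hξ : ξ ≠ 0) :
    0 < formValue Q ξ := by
  exact hQ.dotProduct_mulVec_pos (mt toReal_eq_zero.1 hξ)

theorem formValue_zero (Q : Mat g) : formValue Q 0 = 0 := by
  simp [formValue, toReal_eq_zero.2 rfl]

theorem formValue_smul (a : ℝ) (Q : Mat g) (ξ : Fin g → ℤ) :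
    formValue (a • Q) ξ = a * formValue Q ξ := by
  simp [formValue, smul_mulVec]

theorem finite_formValue_le {Q : Mat g} (hQ : Q.PosDef) (C : ℝ) :
    {ξ : Fin g → ℤ | formValue Q ξ ≤ C}.Finite := by
  obtain ⟨c, hc, h⟩ := exists_pos_mul_norm_sq_le hQ
  obtain ⟨N, hN⟩ := exists_nat_gt (C / c)
  refine (Set.finite_Icc (fun _ => -(N : ℤ) - 1) (fun _ : Fin g => (N : ℤ) + 1)).subset
    fun ξ hξ => ?_
  have h1 : c * ‖toReal ξ‖ ^ 2 ≤ C := (h _).trans hξ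
  have h2 : ‖toReal ξ‖ ^ 2 < N := by
    refine lt_of_le_of_lt ?_ hN
    rw [le_div_iff₀ hc]; linarith
  have h3 : ∀ i, |ξ i| ≤ N + 1 := fun i => by
    have h4 : |(ξ i : ℝ)| ≤ ‖toReal ξ‖ := norm_le_pi_norm (toReal ξ) i
    have h5 : |(ξ i : ℝ)| ≤ N + 1 := by nlinarith [norm_nonneg (toReal ξ)]
    exact_mod_cast h5
  exact ⟨fun i => by have := (abs_le.1 (h3 i)).1; simp only; omega,
    fun i => (abs_le.1 (h3 i)).2⟩

/-- The form is positive definite and its value at nonzero integral vectors is at least one. -/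
def Admissible (Q : Mat g) : Prop := Q.PosDef ∧ ∀ ζ : Fin g → ℤ, ζ ≠ 0 → 1 ≤ formValue Q ζ

/-- The cone generated by the rank one forms at which the form has value one. -/
def unitCone (Q : Mat g) : Cone g := PointedCone.hull ℝ (rankOne '' {ξ | formValue Q ξ = 1})

theorem ne_zero_of_formValue_eq_one {Q : Mat g} {ξ : Fin g → ℤ} (h : formValue Q ξ = 1) :
    ξ ≠ 0 := by
  rintro rfl
  rw [formValue_zero] at h
  exact zero_ne_one h

/-- Scaling the minimum to one replaces minimality by the condition `formValue Q ζ ≥ 1`, which need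
not be attained. The zero cone is thereby included on the same footing: it comes from `2 • 1`, whose
values at nonzero integral vectors are at least two. -/
theorem mem_perfectCones_iff {σ : Cone g} :
    σ ∈ perfectCones g ↔ ∃ Q : Mat g, Admissible Q ∧ σ = unitCone Q := by
  have bot_of_empty : ∀ Q : Mat g, {ξ | formValue Q ξ = 1} = ∅ → unitCone Q = ⊥ := fun Q h => by
    rw [unitCone, h, Set.image_empty]; exact Submodule.span_empty
  constructor
  · rintro (rfl | ⟨Q, hQ, rfl⟩)
    · have hv : ∀ ζ : Fin g → ℤ, ζ ≠ 0 → 2 ≤ formValue ((2 : ℝ) • (1 : Mat g)) ζ := by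
        intro ζ hζ
        have e : formValue (1 : Mat g) ζ = ((ζ ⬝ᵥ ζ : ℤ) : ℝ) := by
          rw [formValue, one_mulVec, toReal_dotProduct]
        have hp := formValue_pos (PosDef.one (n := Fin g) (R := ℝ)) hζ
        rw [e] at hp
        have : (1 : ℤ) ≤ ζ ⬝ᵥ ζ := by exact_mod_cast hp
        have : (1 : ℝ) ≤ ((ζ ⬝ᵥ ζ : ℤ) : ℝ) := by exact_mod_cast this
        rw [formValue_smul, e]
        linarith
      refine ⟨(2 : ℝ) • 1, ⟨PosDef.one.smul two_pos, fun ζ hζ => by linarith [hv ζ hζ]⟩, ?_⟩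
      refine (bot_of_empty _ ?_).symm
      refine Set.eq_empty_of_forall_notMem fun ξ (hξ : _ = _) => ?_
      have := hv ξ (ne_zero_of_formValue_eq_one hξ)
      linarith
    · rcases (minimalVectors Q).eq_empty_or_nonempty with he | ⟨ξ, hξ, hmin⟩
      -- Only finitely many integral vectors lie below a given value, so a nonzero vector would
      -- yield a minimal one. This case is `g = 0`.
      · have h0 : ∀ ζ : Fin g → ℤ, ζ = 0 := by
          intro ζ
          by_contra hζ
          obtain ⟨ξ, hξ, hmin⟩ := Set.exists_min_image
            {ξ : Fin g → ℤ | formValue Q ξ ≤ formValue Q ζ ∧ ξ ≠ 0} (formValue Q)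
            ((finite_formValue_le hQ (formValue Q ζ)).subset fun x hx => hx.1) ⟨ζ, le_rfl, hζ⟩
          have : ξ ∈ minimalVectors Q := by
            refine ⟨hξ.2, fun z hz => ?_⟩
            by_cases hle : formValue Q z ≤ formValue Q ζ
            · exact hmin z ⟨hle, hz⟩
            · exact hξ.1.trans (not_le.1 hle).le
          rw [he] at this
          exact this
        refine ⟨Q, ⟨hQ, fun ζ hζ => absurd (h0 ζ) hζ⟩, ?_⟩
        rw [bot_of_empty, coneOfForm, he, Set.image_empty]
        · exact Submodule.span_empty
        · exact Set.eq_empty_of_forall_notMem fun ξ hξ => ne_zero_of_formValue_eq_one hξ (h0 ξ)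
      · have hp := formValue_pos hQ hξ
        have hset : {ζ | formValue ((formValue Q ξ)⁻¹ • Q) ζ = 1} = minimalVectors Q := by
          ext ζ
          simp only [Set.mem_ofPred_eq, minimalVectors, formValue_smul]
          rw [inv_mul_eq_iff_eq_mul₀ hp.ne', mul_one]
          constructor
          · intro h
            refine ⟨?_, fun z hz => h ▸ hmin z hz⟩
            rintro rfl
            rw [formValue_zero] at h
            exact hp.ne h
          · rintro ⟨h0, h⟩
            exact le_antisymm (h ξ hξ) (hmin ζ h0)
        refine ⟨(formValue Q ξ)⁻¹ • Q, ⟨hQ.smul (inv_pos.2 hp), fun ζ hζ => ?_⟩, ?_⟩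
        · rw [formValue_smul, inv_mul_eq_div, le_div_iff₀ hp, one_mul]
          exact hmin ζ hζ
        · rw [unitCone, hset]; rfl
  · rintro ⟨Q, hQ, rfl⟩
    rcases {ξ | formValue Q ξ = 1}.eq_empty_or_nonempty with he | ⟨ξ, hξ⟩
    · exact Or.inl (bot_of_empty Q he)
    · refine Or.inr ⟨Q, hQ.1, ?_⟩
      have : minimalVectors Q = {ξ | formValue Q ξ = 1} := by
        ext ζ
        constructor
        · rintro ⟨h0, h⟩
          exact le_antisymm (hξ ▸ h ξ (ne_zero_of_formValue_eq_one hξ)) (hQ.2 ζ h0)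
        · intro (h : _ = _)
          exact ⟨ne_zero_of_formValue_eq_one h, fun z hz => h ▸ hQ.2 z hz⟩
      rw [coneOfForm, this]; rfl

theorem isPolyhedral_of_perfect {σ : Cone g} (h : σ ∈ perfectCones g) : IsPolyhedral σ := by
  obtain ⟨Q, hQ, rfl⟩ := mem_perfectCones_iff.1 h
  exact ⟨_, ((finite_formValue_le hQ.1 1).subset fun ξ hξ => le_of_eq hξ).image _, rfl⟩

/-- The symmetric matrix that represents a linear functional on the symmetric matrices. -/
def functionalForm (ℓ : Mat g →ₗ[ℝ] ℝ) : Mat g :=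
  Matrix.of fun i j => (ℓ (Matrix.single i j 1) + ℓ (Matrix.single j i 1)) / 2

theorem dotProduct_functionalForm (ℓ : Mat g →ₗ[ℝ] ℝ) (x : Fin g → ℝ) :
    x ⬝ᵥ functionalForm ℓ *ᵥ x = ℓ (vecMulVec x x) := by
  have h1 : ℓ (vecMulVec x x) = ∑ i, ∑ j, ℓ (Matrix.single i j 1) * (x i * x j) := by
    conv_lhs => rw [matrix_eq_sum_single (vecMulVec x x)]
    simp only [map_sum]
    refine Finset.sum_congr rfl fun i _ => Finset.sum_congr rfl fun j _ => ?_
    have : Matrix.single i j (vecMulVec x x i j) = (x i * x j) • Matrix.single i j (1 : ℝ) := by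
      rw [Matrix.smul_single]; simp [vecMulVec_apply]
    rw [this, map_smul, smul_eq_mul, mul_comm]
  have h2 : ℓ (vecMulVec x x) = ∑ i, ∑ j, ℓ (Matrix.single j i 1) * (x i * x j) := by
    rw [h1, Finset.sum_comm]
    exact Finset.sum_congr rfl fun i _ => Finset.sum_congr rfl fun j _ => by ring
  rw [dotProduct_mulVec_eq_sum]
  have h3 : ∑ i, ∑ j, functionalForm ℓ i j * (x i * x j) =
      (∑ i, ∑ j, ℓ (Matrix.single i j 1) * (x i * x j) +
        ∑ i, ∑ j, ℓ (Matrix.single j i 1) * (x i * x j)) / 2 := by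
    rw [← Finset.sum_add_distrib, Finset.sum_div]
    refine Finset.sum_congr rfl fun i _ => ?_
    rw [← Finset.sum_add_distrib, Finset.sum_div]
    refine Finset.sum_congr rfl fun j _ => ?_
    rw [functionalForm, of_apply]; ring
  rw [h3, ← h1, ← h2]; ring

theorem isHermitian_functionalForm (ℓ : Mat g →ₗ[ℝ] ℝ) : (functionalForm ℓ).IsHermitian := by
  ext i j
  simp [functionalForm, add_comm]

theorem formValue_add_smul (Q H : Mat g) (ε : ℝ) (ξ : Fin g → ℤ) :
    formValue (Q + ε • H) ξ = formValue Q ξ + ε * formValue H ξ := by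
  simp [formValue, add_mulVec, smul_mulVec, dotProduct_add]

/-- Perturb `Q` to `Q + ε H`, where `H` represents the functional that cuts out the face. Minimal
vectors in the face keep the value one and the other minimal vectors rise above it. For small `ε`
the remaining vectors stay above one, because their values start at `1 + δ` and `|H| ≤ C Q`. -/
theorem perfect_of_isFace {σ ρ : Cone g} (hσ : σ ∈ perfectCones g) (hρ : IsFace ρ σ) :
    ρ ∈ perfectCones g := by
  rw [mem_perfectCones_iff] at hσ ⊢
  obtain ⟨Q, hQ, rfl⟩ := hσ
  obtain ⟨ℓ, h0, rfl⟩ := isFace_iff_eq_zeroFace.1 hρ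
  set H := functionalForm ℓ with hH
  have hval : ∀ ξ, formValue H ξ = ℓ (rankOne ξ) := fun ξ => dotProduct_functionalForm ℓ _
  have h1 : ∀ ξ, formValue Q ξ = 1 → 0 ≤ ℓ (rankOne ξ) := fun ξ hξ =>
    h0 _ (PointedCone.subset_hull ⟨ξ, hξ, rfl⟩)
  obtain ⟨C, hC, hCQ⟩ := exists_abs_le_mul hQ.1 H
  -- the gap between the minimum and the other values
  obtain ⟨δ, hδ, hgap⟩ : ∃ δ : ℝ, 0 < δ ∧ ∀ ξ : Fin g → ℤ, ξ ≠ 0 → formValue Q ξ ≠ 1 →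
      1 + δ ≤ formValue Q ξ := by
    rcases ({ξ : Fin g → ℤ | formValue Q ξ ≤ 2 ∧ (ξ ≠ 0 ∧ formValue Q ξ ≠ 1)}).eq_empty_or_nonempty
      with he | hne
    · refine ⟨1, one_pos, fun ξ hξ h => ?_⟩
      by_contra hlt
      have : ξ ∈ {ξ : Fin g → ℤ | formValue Q ξ ≤ 2 ∧ (ξ ≠ 0 ∧ formValue Q ξ ≠ 1)} :=
        ⟨by linarith, hξ, h⟩
      rw [he] at this
      exact this
    · obtain ⟨ζ, hζ, hmin⟩ := Set.exists_min_image _ (formValue Q)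
        ((finite_formValue_le hQ.1 2).subset fun x hx => hx.1) hne
      have hζ1 : 1 < formValue Q ζ := lt_of_le_of_ne (hQ.2 ζ hζ.2.1) hζ.2.2.symm
      refine ⟨formValue Q ζ - 1, by linarith, fun ξ hξ h => ?_⟩
      by_cases hle : formValue Q ξ ≤ 2
      · linarith [hmin ξ ⟨hle, hξ, h⟩]
      · linarith [hζ.1]
  obtain ⟨ε, hε, hεC⟩ : ∃ ε : ℝ, 0 < ε ∧ 1 < (1 - ε * C) * (1 + δ) := by
    -- With this `ε` the perturbation costs at most `δ / 2` of the gap; `C + 1` replaces `C` because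
    -- `C` may be zero.
    refine ⟨δ / (2 * (C + 1) * (1 + δ)), by positivity, ?_⟩
    have e : (1 - δ / (2 * (C + 1) * (1 + δ)) * C) * (1 + δ) = 1 + δ - δ / 2 * (C / (C + 1)) := by
      field_simp
    rw [e]
    have : C / (C + 1) ≤ 1 := by rw [div_le_one (by positivity)]; linarith
    nlinarith
  have hεC0 : 0 < 1 - ε * C := by
    by_contra h
    nlinarith
  have hlow : ∀ x : Fin g → ℝ, (1 - ε * C) * (x ⬝ᵥ Q *ᵥ x) ≤ x ⬝ᵥ (Q + ε • H) *ᵥ x := by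
    intro x
    have h2 := (abs_le.1 (hCQ x)).1
    have : x ⬝ᵥ (Q + ε • H) *ᵥ x = x ⬝ᵥ Q *ᵥ x + ε * (x ⬝ᵥ H *ᵥ x) := by
      simp [add_mulVec, smul_mulVec, dotProduct_add]
    rw [this]
    nlinarith
  have hbig : ∀ ξ : Fin g → ℤ, ξ ≠ 0 → formValue Q ξ ≠ 1 → 1 < formValue (Q + ε • H) ξ := by
    intro ξ hξ h
    calc 1 < (1 - ε * C) * (1 + δ) := hεC
      _ ≤ (1 - ε * C) * formValue Q ξ := by
        have := hgap ξ hξ h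
        gcongr
      _ ≤ _ := hlow _
  have hv := formValue_add_smul Q H ε
  refine ⟨Q + ε • H, ⟨PosDef.of_dotProduct_mulVec_pos ?_ fun x hx => ?_, fun ζ hζ => ?_⟩, ?_⟩
  · have : (ε • H).IsHermitian := by
      rw [IsHermitian, conjTranspose_smul, (isHermitian_functionalForm ℓ).eq]; simp [hH]
    exact hQ.1.isHermitian.add this
  · have hp : 0 < x ⬝ᵥ Q *ᵥ x := by simpa using hQ.1.dotProduct_mulVec_pos hx
    have := hlow x
    rw [star_trivial]
    exact lt_of_lt_of_le (mul_pos hεC0 hp) this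
  · by_cases h : formValue Q ζ = 1
    · rw [hv, h, hval]
      have := mul_nonneg hε.le (h1 ζ h)
      linarith
    · exact (hbig ζ hζ h).le
  · rw [unitCone, zeroFace_hull fun x hx => h0 x (PointedCone.subset_hull hx), unitCone]
    congr 1
    ext X
    constructor
    · rintro ⟨⟨ξ, hξ, rfl⟩, h⟩
      refine ⟨ξ, ?_, rfl⟩
      have hξ : formValue Q ξ = 1 := hξ
      simp [hv, hval, h, hξ]
    · rintro ⟨ξ, hξ, rfl⟩
      have hξ : formValue (Q + ε • H) ξ = 1 := hξ
      have hξ0 := ne_zero_of_formValue_eq_one hξ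
      have hQ1 : formValue Q ξ = 1 := by
        by_contra h
        exact (hbig ξ hξ0 h).ne' hξ
      refine ⟨⟨ξ, hQ1, rfl⟩, ?_⟩
      rw [hv, hQ1, hval] at hξ
      have : ε * ℓ (rankOne ξ) = 0 := by linarith
      exact (mul_eq_zero.1 this).resolve_left hε.ne'

/-! ### The action of `GL_g(ℤ)` and the addition of a ray -/

theorem dotProduct_conj (Q P : Mat g) (x : Fin g → ℝ) :
    x ⬝ᵥ (Pᵀ * Q * P) *ᵥ x = (P *ᵥ x) ⬝ᵥ Q *ᵥ (P *ᵥ x) := by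
  rw [mul_assoc, ← mulVec_mulVec, ← mulVec_mulVec, dotProduct_mulVec, vecMul_transpose]

/-- The group of integral invertible matrices. -/
abbrev Gl (g : ℕ) : Type := GeneralLinearGroup (Fin g) ℤ

/-- An integral matrix as a real matrix. -/
def realMat (h : Gl g) : Mat g := (h : Matrix (Fin g) (Fin g) ℤ).map (Int.cast : ℤ → ℝ)

theorem realMat_eq (h : Gl g) :
    realMat h = (Int.castRingHom ℝ).mapMatrix (h : Matrix (Fin g) (Fin g) ℤ) := rfl

theorem realMat_mul (h k : Gl g) : realMat (h * k) = realMat h * realMat k := by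
  simp only [realMat_eq, Units.val_mul, map_mul]

theorem realMat_one : realMat (1 : Gl g) = 1 := by
  simp only [realMat_eq, Units.val_one, map_one]

theorem toReal_mulVec (h : Gl g) (ξ : Fin g → ℤ) :
    toReal ((h : Matrix (Fin g) (Fin g) ℤ) *ᵥ ξ) = realMat h *ᵥ toReal ξ := by
  funext i
  exact RingHom.map_mulVec (Int.castRingHom ℝ) _ _ _

theorem act_apply (h : Gl g) (X : Mat g) : act h X = realMat h * X * (realMat h)ᵀ := rfl

theorem act_one : act (1 : Gl g) = LinearMap.id := by
  ext1 X; simp [act_apply, realMat_one]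

theorem act_mul (h k : Gl g) : act (h * k) = act h ∘ₗ act k := by
  ext1 X
  simp only [act_apply, realMat_mul, transpose_mul, LinearMap.comp_apply, mul_assoc]

theorem act_inv_act (h : Gl g) (X : Mat g) : act h⁻¹ (act h X) = X := by
  rw [← LinearMap.comp_apply, ← act_mul, inv_mul_cancel, act_one, LinearMap.id_apply]

theorem act_act_inv (h : Gl g) (X : Mat g) : act h (act h⁻¹ X) = X := by
  rw [← LinearMap.comp_apply, ← act_mul, mul_inv_cancel, act_one, LinearMap.id_apply]

theorem act_injective (h : Gl g) : Function.Injective (act h) :=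
  Function.LeftInverse.injective (act_inv_act h)

theorem act_rankOne (h : Gl g) (ξ : Fin g → ℤ) :
    act h (rankOne ξ) = rankOne ((h : Matrix (Fin g) (Fin g) ℤ) *ᵥ ξ) := by
  rw [act_apply, rankOne, rankOne, toReal_mulVec, mul_vecMulVec, vecMulVec_mul, vecMul_transpose]

/-- The action of the integral invertible matrices on cones. -/
abbrev move (h : Gl g) (σ : Cone g) : Cone g := PointedCone.map (act h) σ

theorem mem_move {h : Gl g} {σ : Cone g} {x : Mat g} : x ∈ move h σ ↔ ∃ y ∈ σ, act h y = x :=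
  PointedCone.mem_map

theorem act_mem_move (h : Gl g) {σ : Cone g} {x : Mat g} : act h x ∈ move h σ ↔ x ∈ σ := by
  rw [mem_move]
  exact ⟨fun ⟨y, hy, e⟩ => act_injective h e ▸ hy, fun hx => ⟨x, hx, rfl⟩⟩

theorem move_one (σ : Cone g) : move 1 σ = σ := by
  ext x; simp [act_one]

theorem move_move (h k : Gl g) (σ : Cone g) : move h (move k σ) = move (h * k) σ := by
  ext x; simp [act_mul]

theorem move_inv_move (h : Gl g) (σ : Cone g) : move h⁻¹ (move h σ) = σ := by
  rw [move_move, inv_mul_cancel, move_one]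

theorem move_move_inv (h : Gl g) (σ : Cone g) : move h (move h⁻¹ σ) = σ := by
  rw [move_move, mul_inv_cancel, move_one]

theorem move_injective (h : Gl g) : Function.Injective (move h) :=
  Function.LeftInverse.injective (move_inv_move h)

theorem move_hull (h : Gl g) (G : Set (Mat g)) :
    move h (PointedCone.hull ℝ G) = PointedCone.hull ℝ (act h '' G) :=
  Submodule.map_span _ G

theorem move_sup (h : Gl g) (σ τ : Cone g) : move h (σ ⊔ τ) = move h σ ⊔ move h τ :=
  Submodule.map_sup _ _ _

theorem linSpan_move (h : Gl g) (σ : Cone g) : linSpan (move h σ) = (linSpan σ).map (act h) := by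
  rw [linSpan, linSpan, Submodule.map_span]
  congr 1

theorem dim_move (h : Gl g) (σ : Cone g) : dim (move h σ) = dim σ := by
  rw [dim, linSpan_move, dim]
  exact ((Submodule.equivMapOfInjective _ (act_injective h) _).finrank_eq).symm

theorem IsFace.move {ρ σ : Cone g} (hρ : IsFace ρ σ) (h : Gl g) :
    IsFace (move h ρ) (PerfectCone.move h σ) := by
  obtain ⟨ℓ, h0, hm⟩ := isFace_iff.1 hρ
  refine isFace_iff.2 ⟨ℓ ∘ₗ act h⁻¹, fun y hy => ?_, fun x => ?_⟩
  · obtain ⟨z, hz, rfl⟩ := mem_move.1 hy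
    simpa [act_inv_act] using h0 z hz
  · obtain ⟨z, rfl⟩ : ∃ z, x = act h z := ⟨_, (act_act_inv h x).symm⟩
    rw [act_mem_move, act_mem_move, hm, LinearMap.comp_apply, act_inv_act]

theorem IsFacet.move {ρ σ : Cone g} (hρ : IsFacet ρ σ) (h : Gl g) :
    IsFacet (move h ρ) (PerfectCone.move h σ) :=
  ⟨hρ.1.move h, by rw [dim_move, dim_move]; exact hρ.2⟩

theorem perfect_move {σ : Cone g} (hσ : σ ∈ perfectCones g) (h : Gl g) :
    move h σ ∈ perfectCones g := by
  rw [mem_perfectCones_iff] at hσ ⊢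
  obtain ⟨Q, hQ, rfl⟩ := hσ
  set B := realMat h⁻¹ with hB
  have hBinv : ∀ x : Fin g → ℝ, realMat h *ᵥ (B *ᵥ x) = x := fun x => by
    rw [mulVec_mulVec, hB, ← realMat_mul, mul_inv_cancel, realMat_one, one_mulVec]
  have hmul : ∀ ξ : Fin g → ℤ, (h : Matrix (Fin g) (Fin g) ℤ) *ᵥ
      ((h⁻¹ : Gl g) : Matrix (Fin g) (Fin g) ℤ) *ᵥ ξ = ξ := fun ξ => by
    rw [mulVec_mulVec, ← Units.val_mul, mul_inv_cancel, Units.val_one, one_mulVec]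
  have hmul' : ∀ ξ : Fin g → ℤ, ((h⁻¹ : Gl g) : Matrix (Fin g) (Fin g) ℤ) *ᵥ
      (h : Matrix (Fin g) (Fin g) ℤ) *ᵥ ξ = ξ := fun ξ => by
    rw [mulVec_mulVec, ← Units.val_mul, inv_mul_cancel, Units.val_one, one_mulVec]
  have hv : ∀ ξ, formValue (Bᵀ * Q * B) ξ =
      formValue Q (((h⁻¹ : Gl g) : Matrix (Fin g) (Fin g) ℤ) *ᵥ ξ) := fun ξ => by
    rw [formValue, dotProduct_conj, formValue, toReal_mulVec]
  refine ⟨Bᵀ * Q * B, ⟨PosDef.of_dotProduct_mulVec_pos ?_ fun x hx => ?_, fun ζ hζ => ?_⟩, ?_⟩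
  · exact isHermitian_conjTranspose_mul_mul B hQ.1.isHermitian
  · rw [star_trivial, dotProduct_conj]
    refine hQ.1.dotProduct_mulVec_pos fun e => hx ?_
    have e : B *ᵥ x = 0 := e
    rw [← hBinv x, e, mulVec_zero]
  · rw [hv]
    refine hQ.2 _ fun e => hζ ?_
    rw [← hmul ζ, e, mulVec_zero]
  · rw [unitCone, move_hull, unitCone]
    congr 1
    ext X
    constructor
    · rintro ⟨_, ⟨ξ, hξ, rfl⟩, rfl⟩
      refine ⟨(h : Matrix (Fin g) (Fin g) ℤ) *ᵥ ξ, ?_, (act_rankOne h ξ).symm⟩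
      change formValue _ _ = 1
      rw [hv, hmul']
      exact hξ
    · rintro ⟨ξ, hξ, rfl⟩
      refine ⟨_, ⟨_, (hv ξ).symm.trans hξ, rfl⟩, ?_⟩
      rw [act_rankOne, hmul]

theorem dotProduct_eq_zero_of_rankOne_mulVec {ξ φ : Fin g → ℤ} (hξ : ξ ≠ 0)
    (h : rankOne ξ *ᵥ toReal φ = 0) : φ ⬝ᵥ ξ = 0 := by
  rw [rankOne, vecMulVec_mulVec, toReal_dotProduct] at h
  have : ((ξ ⬝ᵥ φ : ℤ) : ℝ) = 0 := by
    rcases smul_eq_zero.1 h with h | h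
    · simpa using h
    · exact absurd (toReal_eq_zero.1 h) hξ
  rw [dotProduct_comm]
  exact_mod_cast this

/-- The ray generated by a rank one form. -/
def ray (c : Fin g → ℤ) : Cone g := PointedCone.hull ℝ {rankOne c}

theorem rankOne_neg (c : Fin g → ℤ) : rankOne (-c) = rankOne c := by
  ext i j; simp [rankOne, vecMulVec_apply, toReal]

/-- With `P` the projection onto `ker φ` along `c`, the form `Q ∘ P + φ²` takes the value `Q(ξ -
φ(ξ)c) + φ(ξ)²` at `ξ`, and `ξ - φ(ξ)c` is again integral. The value is one only if `φ(ξ) = 0` and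
`Q(ξ) = 1`, or if `φ(ξ) = ±1` and the first term vanishes, that is `ξ = ±c`. -/
theorem perfect_sup_ray {σ : Cone g} (hσ : σ ∈ perfectCones g) {c φ : Fin g → ℤ}
    (hc : φ ⬝ᵥ c = 1) (hφ : ∀ X ∈ σ, X *ᵥ toReal φ = 0) : σ ⊔ ray c ∈ perfectCones g := by
  rw [mem_perfectCones_iff] at hσ ⊢
  obtain ⟨Q, hQ, rfl⟩ := hσ
  have h0 : ∀ ξ, formValue Q ξ = 1 → φ ⬝ᵥ ξ = 0 := fun ξ hξ =>
    dotProduct_eq_zero_of_rankOne_mulVec (ne_zero_of_formValue_eq_one hξ)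
      (hφ _ (PointedCone.subset_hull ⟨ξ, hξ, rfl⟩))
  set P : Mat g := 1 - vecMulVec (toReal c) (toReal φ) with hP
  have hPx : ∀ x, P *ᵥ x = x - (toReal φ ⬝ᵥ x) • toReal c := fun x => by
    rw [hP, sub_mulVec, one_mulVec, vecMulVec_mulVec]; simp
  have hval : ∀ x : Fin g → ℝ, x ⬝ᵥ (Pᵀ * Q * P + vecMulVec (toReal φ) (toReal φ)) *ᵥ x =
      (P *ᵥ x) ⬝ᵥ Q *ᵥ (P *ᵥ x) + (toReal φ ⬝ᵥ x) ^ 2 := fun x => by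
    rw [add_mulVec, dotProduct_add, dotProduct_conj, vecMulVec_mulVec]
    simp [dotProduct_comm x]; ring
  have hval' : ∀ ξ : Fin g → ℤ, formValue (Pᵀ * Q * P + vecMulVec (toReal φ) (toReal φ)) ξ =
      formValue Q (ξ - (φ ⬝ᵥ ξ) • c) + ((φ ⬝ᵥ ξ : ℤ) : ℝ) ^ 2 := fun ξ => by
    rw [formValue, hval, hPx, toReal_dotProduct, formValue]
    have : toReal ξ - ((φ ⬝ᵥ ξ : ℤ) : ℝ) • toReal c = toReal (ξ - (φ ⬝ᵥ ξ) • c) := by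
      funext i; simp [toReal]
    rw [this]
  have hnn : ∀ ξ, 0 ≤ formValue Q ξ := fun ξ => by
    by_cases h : ξ = 0
    · rw [h, formValue_zero]
    · exact (formValue_pos hQ.1 h).le
  have hsq : ∀ n : ℤ, n ≠ 0 → (1 : ℝ) ≤ (n : ℝ) ^ 2 := fun n hn => by
    have : (1 : ℤ) ≤ n ^ 2 := by have := sq_pos_of_ne_zero hn; omega
    exact_mod_cast this
  refine ⟨Pᵀ * Q * P + vecMulVec (toReal φ) (toReal φ),
    ⟨PosDef.of_dotProduct_mulVec_pos ?_ fun x hx => ?_, fun ζ hζ => ?_⟩, ?_⟩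
  · refine (isHermitian_conjTranspose_mul_mul P hQ.1.isHermitian).add ?_
    ext i j; simp [vecMulVec_apply, mul_comm]
  · rw [star_trivial, hval]
    by_cases h : toReal φ ⬝ᵥ x = 0
    · have : P *ᵥ x = x := by rw [hPx, h, zero_smul, sub_zero]
      rw [this, h]
      simpa using hQ.1.dotProduct_mulVec_pos hx
    · have h1 : 0 ≤ (P *ᵥ x) ⬝ᵥ Q *ᵥ (P *ᵥ x) := by
        simpa using hQ.1.posSemidef.dotProduct_mulVec_nonneg (P *ᵥ x)
      positivity
  · rw [hval']
    by_cases h : φ ⬝ᵥ ζ = 0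
    · rw [h, zero_smul, sub_zero]
      simpa using hQ.2 ζ hζ
    · linarith [hnn (ζ - (φ ⬝ᵥ ζ) • c), hsq _ h]
  · have hset : rankOne '' {ξ | formValue (Pᵀ * Q * P + vecMulVec (toReal φ) (toReal φ)) ξ = 1} =
        rankOne '' {ξ | formValue Q ξ = 1} ∪ {rankOne c} := by
      ext X
      constructor
      · rintro ⟨ξ, hξ, rfl⟩
        have hξ : formValue _ ξ = 1 := hξ
        rw [hval'] at hξ
        by_cases h : φ ⬝ᵥ ξ = 0
        · left
          rw [h, zero_smul, sub_zero] at hξ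
          exact ⟨ξ, by simpa using hξ, rfl⟩
        · right
          have h1 := hsq _ h
          have h2 := hnn (ξ - (φ ⬝ᵥ ξ) • c)
          have h3 : ((φ ⬝ᵥ ξ : ℤ) : ℝ) ^ 2 = 1 := by linarith
          have h4 : formValue Q (ξ - (φ ⬝ᵥ ξ) • c) = 0 := by linarith
          have h5 : ξ - (φ ⬝ᵥ ξ) • c = 0 := by
            by_contra hne
            exact (formValue_pos hQ.1 hne).ne' h4
          have h6 : (φ ⬝ᵥ ξ) ^ 2 = 1 := by exact_mod_cast h3
          rw [sub_eq_zero] at h5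
          rcases sq_eq_one_iff.1 h6 with h7 | h7
          · rw [h5, h7, one_smul]; rfl
          · rw [h5, h7, neg_smul, one_smul, rankOne_neg]; rfl
      · rintro (⟨ξ, hξ, rfl⟩ | rfl)
        · refine ⟨ξ, ?_, rfl⟩
          change formValue _ ξ = 1
          rw [hval', h0 ξ hξ, zero_smul, sub_zero]
          simpa using hξ
        · refine ⟨c, ?_, rfl⟩
          change formValue _ c = 1
          rw [hval', hc]
          simp [formValue_zero]
    rw [unitCone, unitCone, hset, ray]
    exact (Submodule.span_union _ _).symm

end PerfectForms

/-! ### Translation of orientation statements into forms -/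

section Bridge

variable {g m : ℕ}

/-- The pull-back of a form along the action of an integral matrix. -/
abbrev pull (h : Gl g) (D : Form g m) : Form g m := D.compLinearMap (act h)

theorem pull_neg (h : Gl g) (D : Form g m) : pull h (-D) = -pull h D := rfl

theorem pull_pull (h k : Gl g) (D : Form g m) : pull k (pull h D) = pull (h * k) D := by
  ext x; simp [act_mul]

theorem sameOn_pull_iff {h : Gl g} {σ : Cone g} {D E : Form g m} :
    SameOn (linSpan σ) (pull h D) (pull h E) ↔ SameOn (linSpan (move h σ)) D E := by
  rw [linSpan_move, sameOn_comp_iff]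

theorem isVol_pull_iff {h : Gl g} {σ : Cone g} {D : Form g m} :
    IsVol (linSpan σ) (pull h D) ↔ IsVol (linSpan (move h σ)) D := by
  rw [linSpan_move, isVol_comp_iff (act_injective h)]

theorem exists_basis_map (h : Gl g) {σ : Cone g} (b : Module.Basis (Fin m) ℝ (linSpan σ)) :
    ∃ b' : Module.Basis (Fin m) ℝ (linSpan (move h σ)), ∀ i, (b' i : Mat g) = act h (b i) :=
  ⟨b.map ((Submodule.equivMapOfInjective (act h) (act_injective h) (linSpan σ)).trans
    (LinearEquiv.ofEq _ _ (linSpan_move h σ).symm)), fun i => by simp⟩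

theorem carries_iff {h : Gl g} {σ τ : Cone g} (hστ : move h σ = τ) {ω : ConeOrientation σ}
    {ω' : ConeOrientation τ} {D D' : Form g m} (hD : Represents ω D) (hD' : Represents ω' D') :
    Carries h ω ω' ↔ SameOn (linSpan σ) D (pull h D') := by
  subst hστ
  constructor
  · intro H
    obtain ⟨b⟩ := exists_basis hD.1.1
    obtain ⟨b', hb'⟩ := exists_basis_map h b
    refine sameOn_of_basis_iff hD.1 (isVol_pull_iff.2 hD'.1) b ?_
    rw [← hD.2 b, H m b b' hb', hD'.2 b']
    simp [hb']
  · intro H m' b b' hb'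
    obtain rfl : m' = m := by
      rw [← hD.1.1]; simpa using (Module.finrank_eq_card_basis b).symm
    rw [hD.2 b, hD'.2 b', H.pos_iff fun i => (b i).2]
    simp [hb']

theorem IsFacet.finrank_eq {ρ σ : Cone g} (hρ : IsFacet ρ σ) {D : Form g (m + 1)}
    (hD : IsVol (linSpan σ) D) : Module.finrank ℝ (linSpan ρ) = m := by
  have h1 : Module.finrank ℝ (linSpan ρ) + 1 = Module.finrank ℝ (linSpan σ) := hρ.2
  have := hD.1
  omega

theorem IsFacet.isVol_contr {ρ σ : Cone g} (hρ : IsFacet ρ σ) {D : Form g (m + 1)}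
    (hD : IsVol (linSpan σ) D) {v : Mat g} (hv : v ∈ σ) (hvρ : v ∉ ρ) :
    IsVol (linSpan ρ) (contr D v) :=
  hD.contr (linSpan_mono hρ.le) hρ.2 (mem_linSpan hv) fun h => hvρ (hρ.1.mem_of_mem_linSpan hv h)

/-- The functional that defines the facet is positive at both vectors, so they lie on the same side
and the induced orientation does not depend on the vector. -/
theorem IsFacet.sameOn_contr {ρ σ : Cone g} (hρ : IsFacet ρ σ) {D : Form g (m + 1)}
    (hD : IsVol (linSpan σ) D) {v w : Mat g} (hv : v ∈ σ) (hvρ : v ∉ ρ) (hw : w ∈ σ)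
    (hwρ : w ∉ ρ) : SameOn (linSpan ρ) (contr D w) (contr D v) := by
  obtain ⟨c, hc⟩ := exists_sub_smul_mem (linSpan_mono hρ.le) hρ.2 (mem_linSpan hv)
    (fun h => hvρ (hρ.1.mem_of_mem_linSpan hv h)) (mem_linSpan hw)
  refine sameOn_contr_of_sub_mem (hρ.finrank_eq hD) D ?_ hc
  obtain ⟨ℓ, h0, hm⟩ := isFace_iff.1 hρ.1
  have hpos : ∀ x ∈ σ, x ∉ ρ → 0 < ℓ x := fun x hx hxρ =>
    lt_of_le_of_ne (h0 x hx) fun e => hxρ ((hm x).2 ⟨hx, e.symm⟩)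
  have e := eq_zero_of_mem_linSpan (fun y hy => ((hm y).1 hy).2) hc
  simp only [map_sub, map_smul, smul_eq_mul, sub_eq_zero] at e
  have := hpos w hw hwρ
  rw [e] at this
  exact pos_of_mul_pos_left this (hpos v hv hvρ).le

theorem isInduced_iff {ρ σ : Cone g} (hρ : IsFacet ρ σ) {ω : ConeOrientation σ}
    {ω' : ConeOrientation ρ} {D : Form g (m + 1)} {D' : Form g m} (hD : Represents ω D)
    (hD' : Represents ω' D') {v : Mat g} (hv : v ∈ σ) (hvρ : v ∉ ρ) :
    IsInduced ω ω' ↔ SameOn (linSpan ρ) D' (contr D v) := by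
  constructor
  · intro H
    obtain ⟨b'⟩ := exists_basis hD'.1.1
    obtain ⟨b, hb, rfl⟩ := exists_basis_snoc (linSpan_mono hρ.le) hρ.2 (mem_linSpan hv)
      (fun h => hvρ (hρ.1.mem_of_mem_linSpan hv h)) b'
    refine sameOn_of_basis_iff hD'.1 (hρ.isVol_contr hD.1 hv hvρ) b' ?_
    rw [← hD'.2 b', H m b' b hb hv hvρ, hD.2 b, contr_basis D b' b hb]
  · intro H m' b' b hb hw hwρ
    obtain rfl : m' = m := by
      rw [← hD'.1.1]; simpa using (Module.finrank_eq_card_basis b').symm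
    rw [hD.2 b, hD'.2 b', ← contr_basis D b' b hb]
    exact (H.trans (hρ.sameOn_contr hD.1 hw hwρ hv hvρ)).pos_iff fun i => (b' i).2

theorem IsAlternating.sameOn {σ : Cone g} (hσ : IsAlternating σ) {h : Gl g} (hh : move h σ = σ)
    {D : Form g m} (hD : IsVol (linSpan σ) D) : SameOn (linSpan σ) D (pull h D) := by
  obtain ⟨ω, hω⟩ := exists_orientation hD
  exact (carries_iff hh hω hω).1 (hσ h hh ω)

theorem exists_sameOn_neg {σ : Cone g} (hσ : ¬ IsAlternating σ) {D : Form g m}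
    (hD : IsVol (linSpan σ) D) :
    ∃ h : Gl g, move h σ = σ ∧ SameOn (linSpan σ) (pull h D) (-D) := by
  simp only [IsAlternating, not_forall] at hσ
  obtain ⟨h, hh, ω, hω⟩ := hσ
  have hh : move h σ = σ := hh
  obtain ⟨E, hE⟩ : ∃ E : Form g m, Represents ω E := by
    obtain rfl := hD.1
    exact exists_represents ω
  rw [carries_iff hh hE hE] at hω
  have hEh : IsVol (linSpan σ) (pull h E) := isVol_pull_iff.2 (by rw [hh]; exact hE.1)
  have h1 := (hE.1.sameOn_or hEh).resolve_left hω
  refine ⟨h, hh, ?_⟩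
  rcases hD.sameOn_or hE.1 with h2 | h2
  · have h3 : SameOn (linSpan σ) (pull h D) (pull h E) := sameOn_pull_iff.2 (by rwa [hh])
    have h4 := h1.neg
    rw [neg_neg] at h4
    exact h3.trans (h4.symm.trans h2.symm.neg)
  · have h3 : SameOn (linSpan σ) (pull h D) (pull h (-E)) := sameOn_pull_iff.2 (by rwa [hh])
    have h4 := h2.neg
    rw [neg_neg] at h4
    exact h3.trans (h1.symm.trans h4.symm)

theorem Equivalent.refl (σ : Cone g) : Equivalent σ σ := ⟨1, move_one σ⟩

theorem Equivalent.dim_eq {σ τ : Cone g} (h : Equivalent σ τ) : dim τ = dim σ := by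
  obtain ⟨h, rfl⟩ := h
  exact dim_move h σ

theorem IsSystemOfRepresentatives.eq_of_equivalent {Γ : Set (Cone g)}
    (hΓ : IsSystemOfRepresentatives Γ) {σ τ : Γ} (h : Equivalent σ.1 τ.1) : σ = τ :=
  Subtype.ext ((hΓ.2 τ.1 (hΓ.1 _ τ.2).1 (hΓ.1 _ τ.2).2).unique ⟨σ.2, h⟩ ⟨τ.2, .refl _⟩)

end Bridge

/-! ### Classes of oriented cones -/

section Classes

variable {g m : ℕ} (Γ : Set (Cone g)) (ω : ∀ σ : Γ, ConeOrientation σ.1)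

/-- An element of `GL_g(ℤ)` carries the representative `τ` with its orientation to `σ` with the
orientation given by the form. -/
def Reps (τ : Γ) (σ : Cone g) (D : Form g m) : Prop :=
  ∃ h : Gl g, move h τ.1 = σ ∧ Represents (ω τ) (pull h D)

open Classical in
/-- The basis vector of the only element of a set, and zero if there is no such element. -/
def indic (S : Set Γ) : Γ →₀ ℚ := if h : ∃ τ, S = {τ} then Finsupp.single h.choose 1 else 0

theorem indic_singleton (τ : Γ) : indic Γ {τ} = Finsupp.single τ 1 := by
  have h : ∃ τ', ({τ} : Set Γ) = {τ'} := ⟨τ, rfl⟩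
  rw [indic, dif_pos h]
  rw [← Set.singleton_injective h.choose_spec]

theorem indic_empty : indic Γ ∅ = 0 :=
  dif_neg fun ⟨τ, h⟩ => (Set.singleton_ne_empty τ) h.symm

/-- The class of an oriented cone in the perfect chain complex. -/
def cls (σ : Cone g) (D : Form g m) : Γ →₀ ℚ :=
  indic Γ {τ | Reps Γ ω τ σ D} - indic Γ {τ | Reps Γ ω τ σ (-D)}

theorem cls_neg (σ : Cone g) (D : Form g m) : cls Γ ω σ (-D) = -cls Γ ω σ D := by
  rw [cls, cls, neg_neg, neg_sub]

variable {Γ ω}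

theorem Reps.congr {τ : Γ} {σ : Cone g} {D E : Form g m} (h : SameOn (linSpan σ) D E)
    (hD : Reps Γ ω τ σ D) : Reps Γ ω τ σ E := by
  obtain ⟨k, rfl, hk⟩ := hD
  exact ⟨k, rfl, hk.of_sameOn (sameOn_pull_iff.2 h)⟩

theorem Reps.equivalent {τ : Γ} {σ : Cone g} {D : Form g m} (h : Reps Γ ω τ σ D) :
    Equivalent τ.1 σ := h.imp fun _ h => h.1

theorem cls_congr {σ : Cone g} {D E : Form g m} (h : SameOn (linSpan σ) D E) :
    cls Γ ω σ D = cls Γ ω σ E := by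
  rw [cls, cls]
  congr 2 <;> ext τ
  · exact ⟨.congr h, .congr h.symm⟩
  · exact ⟨.congr h.neg, .congr h.symm.neg⟩

theorem reps_move_iff {τ : Γ} {σ : Cone g} {D : Form g m} {h : Gl g} :
    Reps Γ ω τ (move h σ) D ↔ Reps Γ ω τ σ (pull h D) := by
  constructor
  · rintro ⟨k, hk, hr⟩
    refine ⟨h⁻¹ * k, ?_, ?_⟩
    · rw [← move_move, hk, move_inv_move]
    · rw [pull_pull, mul_inv_cancel_left]; exact hr
  · rintro ⟨k, rfl, hr⟩
    refine ⟨h * k, (move_move h k _).symm, ?_⟩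
    rw [pull_pull] at hr; exact hr

theorem cls_move (h : Gl g) (σ : Cone g) (D : Form g m) :
    cls Γ ω (move h σ) D = cls Γ ω σ (pull h D) := by
  simp only [cls, reps_move_iff, pull_neg]

/-- If both `D` and `-D` came from `ω τ`, some stabilizing element would reverse the orientation of
the alternating cone `τ`; hence the second term of `cls` is zero. -/
theorem cls_eq_single (hΓ : IsSystemOfRepresentatives Γ) {τ : Γ} {D : Form g m}
    (hD : Represents (ω τ) D) : cls Γ ω τ.1 D = Finsupp.single τ 1 := by
  have h1 : {τ' | Reps Γ ω τ' τ.1 D} = {τ} := by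
    ext τ'
    refine ⟨fun h => hΓ.eq_of_equivalent h.equivalent, ?_⟩
    rintro rfl
    refine ⟨1, move_one _, ?_⟩
    rw [pull, act_one]
    exact hD
  have h2 : {τ' | Reps Γ ω τ' τ.1 (-D)} = ∅ := by
    refine Set.eq_empty_of_forall_notMem fun τ' h => ?_
    obtain rfl := hΓ.eq_of_equivalent h.equivalent
    obtain ⟨k, hk, hr⟩ := h
    have h3 := (hΓ.1 _ τ'.2).2.sameOn hk hD.1
    have h4 : SameOn (linSpan τ'.1) D (-pull k D) := hD.sameOn hr
    exact hD.1.not_sameOn_neg (h4.trans h3.symm.neg)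
  rw [cls, h1, h2, indic_singleton, indic_empty, sub_zero]

theorem cls_eq_of_reps (hΓ : IsSystemOfRepresentatives Γ) {τ : Γ} {σ : Cone g} {D : Form g m}
    (h : Reps Γ ω τ σ D) : cls Γ ω σ D = Finsupp.single τ 1 := by
  obtain ⟨k, rfl, hr⟩ := h
  rw [cls_move, cls_eq_single hΓ hr]

theorem reps_or_reps_neg {τ : Γ} {σ : Cone g} {D : Form g m} (hD : IsVol (linSpan σ) D)
    (h : Equivalent τ.1 σ) : Reps Γ ω τ σ D ∨ Reps Γ ω τ σ (-D) := by
  obtain ⟨k, rfl⟩ := h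
  obtain ⟨E, hE⟩ : ∃ E : Form g m, Represents (ω τ) E := by
    have := isVol_pull_iff.2 hD
    obtain rfl := this.1
    exact exists_represents _
  exact (hE.1.sameOn_or (isVol_pull_iff.2 hD)).imp (fun h => ⟨k, rfl, hE.of_sameOn h⟩)
    fun h => ⟨k, rfl, hE.of_sameOn h⟩

/-- Invariance under `h` and oddness give `cls = -cls`. Every vanishing caused by an orientation
reversing symmetry is obtained in this way. -/
theorem cls_eq_zero_of_sameOn_neg {σ : Cone g} {D : Form g m} {h : Gl g} (hh : move h σ = σ)
    (hD : SameOn (linSpan σ) (pull h D) (-D)) : cls Γ ω σ D = 0 := by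
  have h1 : cls Γ ω σ D = -cls Γ ω σ D := by
    conv_lhs => rw [← hh]
    rw [cls_move, cls_congr hD, cls_neg]
  exact self_eq_neg.1 h1

/-- A function of oriented cones that is odd and invariant under `GL_g(ℤ)` factors through the
class of the oriented cone. -/
theorem map_cls (hΓ : IsSystemOfRepresentatives Γ) {V : Type*} [AddCommGroup V] [Module ℚ V]
    (L : (Γ →₀ ℚ) →ₗ[ℚ] V) (F : Cone g → Form g m → V)
    (hL : ∀ (τ : Γ) (D : Form g m), Represents (ω τ) D → L (Finsupp.single τ 1) = F τ.1 D)
    (hneg : ∀ σ ∈ perfectCones g, ∀ D, IsVol (linSpan σ) D → F σ (-D) = -F σ D)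
    (hmove : ∀ σ ∈ perfectCones g, ∀ (h : Gl g) D, IsVol (linSpan (move h σ)) D →
      F (move h σ) D = F σ (pull h D))
    (hcongr : ∀ σ ∈ perfectCones g, ∀ D E, IsVol (linSpan σ) D → SameOn (linSpan σ) D E →
      F σ D = F σ E)
    {σ : Cone g} (hσ : σ ∈ perfectCones g) {D : Form g m} (hD : IsVol (linSpan σ) D) :
    L (cls Γ ω σ D) = F σ D := by
  by_cases halt : IsAlternating σ
  · obtain ⟨τ, hτΓ, hτ⟩ := (hΓ.2 σ hσ halt).exists
    have key : ∀ E : Form g m, Reps Γ ω ⟨τ, hτΓ⟩ σ E → L (cls Γ ω σ E) = F σ E := by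
      intro E hE
      rw [cls_eq_of_reps hΓ hE]
      obtain ⟨k, rfl, hr⟩ := hE
      rw [hL _ _ hr]
      exact (hmove _ (hΓ.1 _ hτΓ).1 k E (isVol_pull_iff.1 hr.1)).symm
    rcases reps_or_reps_neg (τ := ⟨τ, hτΓ⟩) hD hτ with h | h
    · exact key D h
    · have := key (-D) h
      rw [cls_neg, map_neg, hneg σ hσ D hD] at this
      exact neg_injective this
  -- The same symmetry that kills the class gives `F σ D = -F σ D`, and rational coefficients allow
  -- division by two.
  · obtain ⟨h, hh, hs⟩ := exists_sameOn_neg halt hD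
    rw [cls_eq_zero_of_sameOn_neg hh hs, map_zero]
    have hv : IsVol (linSpan (move h σ)) D := by rwa [hh]
    have h1 : F σ D = -F σ D := by
      conv_lhs => rw [← hh]
      rw [hmove σ hσ h D hv, hcongr σ hσ _ _ (isVol_pull_iff.2 hv) hs, hneg σ hσ D hD]
    have h2 : (2 : ℚ) • F σ D = 0 := by
      rw [two_smul]; nth_rw 1 [h1]; exact neg_add_cancel _
    exact ((smul_eq_zero.1 h2).resolve_left two_ne_zero).symm

end Classes

/-! ### The boundary on oriented cones and its square -/

section Boundary

variable {g m : ℕ} (Γ : Set (Cone g)) (ω : ∀ σ : Γ, ConeOrientation σ.1)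

open Classical in
/-- A vector of `σ` outside of `ρ`. -/
def outer (ρ σ : Cone g) : Mat g := if h : ∃ v ∈ σ, v ∉ ρ then h.choose else 0

theorem IsFacet.outer_spec {ρ σ : Cone g} (h : IsFacet ρ σ) : outer ρ σ ∈ σ ∧ outer ρ σ ∉ ρ := by
  have := h.exists_mem_notMem
  rw [outer, dif_pos this]
  exact this.choose_spec

open Classical in
/-- The facets of a cone, if their number is finite. -/
def facetFinset (σ : Cone g) : Finset (Cone g) :=
  if h : {ρ | IsFacet ρ σ}.Finite then h.toFinset else ∅

/-- The boundary of an oriented cone. -/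
def bd : {m : ℕ} → Cone g → Form g m → (Γ →₀ ℚ)
  -- A cone of dimension zero has no facets.
  | 0, _, _ => 0
  | _ + 1, σ, D => ∑ ρ ∈ facetFinset σ, cls Γ ω ρ (contr D (outer ρ σ))

/-- A form that represents the orientation of a representative. -/
def volForm (τ : Γ) : Form g (Module.finrank ℝ (linSpan τ.1)) := (exists_represents (ω τ)).choose

theorem represents_volForm (τ : Γ) : Represents (ω τ) (volForm Γ ω τ) :=
  (exists_represents (ω τ)).choose_spec

/-- The differential on the sum of all chain groups. -/
def totalBoundary : (Γ →₀ ℚ) →ₗ[ℚ] (Γ →₀ ℚ) :=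
  Finsupp.linearCombination ℚ fun τ : Γ => bd Γ ω τ.1 (volForm Γ ω τ)

variable {Γ ω}

theorem finite_facets {σ : Cone g} (hσ : σ ∈ perfectCones g) : {ρ | IsFacet ρ σ}.Finite :=
  (isPolyhedral_of_perfect hσ).finite_faces.subset fun _ h => h.1

theorem perfect_of_isFacet {σ ρ : Cone g} (hσ : σ ∈ perfectCones g) (hρ : IsFacet ρ σ) :
    ρ ∈ perfectCones g := perfect_of_isFace hσ hρ.1

theorem cls_contr_eq {σ ρ : Cone g} (hρ : IsFacet ρ σ) {D : Form g (m + 1)}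
    (hD : IsVol (linSpan σ) D) {v : Mat g} (hv : v ∈ σ) (hvρ : v ∉ ρ) :
    cls Γ ω ρ (contr D (outer ρ σ)) = cls Γ ω ρ (contr D v) :=
  cls_congr (hρ.sameOn_contr hD hv hvρ hρ.outer_spec.1 hρ.outer_spec.2)

theorem isFacet_of_mem {σ ρ : Cone g} (h : ρ ∈ facetFinset σ) : IsFacet ρ σ := by
  rw [facetFinset] at h
  split_ifs at h with hf
  · simpa using h
  · simp at h

theorem mem_facetFinset {σ ρ : Cone g} (hσ : σ ∈ perfectCones g) :
    ρ ∈ facetFinset σ ↔ IsFacet ρ σ := by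
  rw [facetFinset, dif_pos (finite_facets hσ)]
  simp

theorem bd_congr {σ : Cone g} {D E : Form g m} (h : SameOn (linSpan σ) D E) :
    bd Γ ω σ D = bd Γ ω σ E := by
  cases m with
  | zero => rfl
  | succ m =>
    refine Finset.sum_congr rfl fun ρ hρ => ?_
    have hρ := isFacet_of_mem hρ
    exact cls_congr (h.contr (linSpan_mono hρ.le) (mem_linSpan hρ.outer_spec.1))

theorem bd_neg (σ : Cone g) (D : Form g m) : bd Γ ω σ (-D) = -bd Γ ω σ D := by
  cases m with
  | zero => simp [bd]
  | succ m => simp only [bd, contr_neg, cls_neg, Finset.sum_neg_distrib]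

theorem bd_move {σ : Cone g} (hσ : σ ∈ perfectCones g) (h : Gl g) {D : Form g m}
    (hD : IsVol (linSpan (move h σ)) D) : bd Γ ω (move h σ) D = bd Γ ω σ (pull h D) := by
  cases m with
  | zero => rfl
  | succ m =>
    refine (Finset.sum_bij (fun ρ _ => move h ρ) (fun ρ hρ => ?_) (fun _ _ _ _ e =>
      move_injective h e) (fun ρ hρ => ?_) fun ρ hρ => ?_).symm
    · exact (mem_facetFinset (perfect_move hσ h)).2 ((isFacet_of_mem hρ).move h)
    · refine ⟨move h⁻¹ ρ, (mem_facetFinset hσ).2 ?_, move_move_inv h ρ⟩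
      have := (isFacet_of_mem hρ).move h⁻¹
      rwa [move_inv_move] at this
    · have hρ := isFacet_of_mem hρ
      have hv := hρ.outer_spec
      rw [cls_contr_eq (hρ.move h) hD ((act_mem_move h).2 hv.1) (mt (act_mem_move h).1 hv.2),
        cls_move, pull, contr_comp]

/-- The geometric boundary is odd and invariant, so `map_cls` applies. The differential can then be
iterated on facets that are not chosen representatives or not alternating. -/
theorem totalBoundary_cls (hΓ : IsSystemOfRepresentatives Γ) {σ : Cone g}
    (hσ : σ ∈ perfectCones g) {D : Form g m} (hD : IsVol (linSpan σ) D) :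
    totalBoundary Γ ω (cls Γ ω σ D) = bd Γ ω σ D := by
  refine map_cls hΓ (totalBoundary Γ ω) (fun σ D => bd Γ ω σ D) (fun τ D hD => ?_)
    (fun σ _ D _ => bd_neg σ D) (fun σ hσ h D hD => bd_move hσ h hD)
    (fun σ _ D E _ h => bd_congr h) hσ hD
  rw [totalBoundary, Finsupp.linearCombination_single, one_smul]
  obtain rfl := hD.1.1
  exact bd_congr ((represents_volForm Γ ω τ).sameOn hD)

theorem totalBoundary_bd (hΓ : IsSystemOfRepresentatives Γ) {σ : Cone g}
    (hσ : σ ∈ perfectCones g) {D : Form g (m + 1)} (hD : IsVol (linSpan σ) D) :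
    totalBoundary Γ ω (bd Γ ω σ D) =
      ∑ ρ ∈ facetFinset σ, bd Γ ω ρ (contr D (outer ρ σ)) := by
  rw [bd, map_sum]
  refine Finset.sum_congr rfl fun ρ hρ => ?_
  have hρ := isFacet_of_mem hρ
  exact totalBoundary_cls hΓ (perfect_of_isFacet hσ hρ)
    (hρ.isVol_contr hD hρ.outer_spec.1 hρ.outer_spec.2)

/-- The contributions of a face of codimension two to the square of the differential cancel. -/
theorem sum_cls_contr_contr {σ τ : Cone g} (hσ : σ ∈ perfectCones g) {D : Form g (m + 2)}
    (hD : IsVol (linSpan σ) D) (s : Finset (Cone g))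
    (hs : ∀ ρ, ρ ∈ s ↔ IsFacet ρ σ ∧ IsFacet τ ρ) :
    ∑ ρ ∈ s, cls Γ ω τ (contr (contr D (outer ρ σ)) (outer τ ρ)) = 0 := by
  classical
  rcases s.eq_empty_or_nonempty with rfl | ⟨ρ, hρ⟩
  · simp
  obtain ⟨hρσ, hτρ⟩ := (hs ρ).1 hρ
  obtain ⟨ρ', hne, hρ'σ, hτρ', hint, huniq⟩ :=
    exists_other_facet (isPolyhedral_of_perfect hσ) hρσ hτρ
  have hs' : s = {ρ, ρ'} := by
    ext υ
    rw [hs, Finset.mem_insert, Finset.mem_singleton]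
    refine ⟨fun h => huniq υ h.1 h.2, ?_⟩
    rintro (rfl | rfl)
    · exact ⟨hρσ, hτρ⟩
    · exact ⟨hρ'σ, hτρ'⟩
  rw [hs', Finset.sum_pair hne.symm]
  obtain ⟨v, hv, hvτ⟩ := hτρ.exists_mem_notMem
  obtain ⟨w, hw, hwτ⟩ := hτρ'.exists_mem_notMem
  -- As `ρ` and `ρ'` meet only in `τ`, the vector `w` lies outside `ρ` and `v` outside `ρ'`. The two
  -- terms contract with the same pair of vectors in opposite orders.
  have hvρ' : v ∉ ρ' := fun h => hvτ (hint v hv h)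
  have hwρ : w ∉ ρ := fun h => hwτ (hint w h hw)
  have key : ∀ {ρ : Cone g} {v w : Mat g}, IsFacet ρ σ → IsFacet τ ρ → v ∈ ρ → v ∉ τ → w ∈ σ →
      w ∉ ρ → cls Γ ω τ (contr (contr D (outer ρ σ)) (outer τ ρ)) =
        cls Γ ω τ (contr (contr D w) v) := by
    intro ρ v w hρσ hτρ hv hvτ hw hwρ
    have ho := hρσ.outer_spec
    rw [cls_contr_eq hτρ (hρσ.isVol_contr hD ho.1 ho.2) hv hvτ]
    exact cls_congr ((hρσ.sameOn_contr hD hw hwρ ho.1 ho.2).contr (linSpan_mono hτρ.le)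
      (mem_linSpan hv))
  rw [key hρσ hτρ hv hvτ (hρ'σ.le hw) hwρ, key hρ'σ hτρ' hw hwτ (hρσ.le hv) hvρ',
    contr_contr, cls_neg, neg_add_cancel]

theorem totalBoundary_totalBoundary (hΓ : IsSystemOfRepresentatives Γ) (x : Γ →₀ ℚ) :
    totalBoundary Γ ω (totalBoundary Γ ω x) = 0 := by
  have key : ∀ {m : ℕ} {σ : Cone g}, σ ∈ perfectCones g → ∀ {D : Form g m},
      IsVol (linSpan σ) D → totalBoundary Γ ω (bd Γ ω σ D) = 0 := by
    intro m σ hσ D hD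
    match m, D, hD with
    | 0, D, _ => simp [bd]
    | 1, D, hD => rw [totalBoundary_bd hΓ hσ hD]; simp [bd]
    | m + 2, D, hD =>
      classical
      rw [totalBoundary_bd hΓ hσ hD]
      simp only [bd]
      rw [Finset.sum_comm' (t' := (facetFinset σ).biUnion facetFinset)
        (s' := fun τ => (facetFinset σ).filter fun ρ => τ ∈ facetFinset ρ)]
      · refine Finset.sum_eq_zero fun τ _ => sum_cls_contr_contr hσ hD _ fun ρ => ?_
        rw [Finset.mem_filter, mem_facetFinset hσ]
        exact and_congr_right fun h => mem_facetFinset (perfect_of_isFacet hσ h)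
      · intro ρ τ
        simp only [Finset.mem_filter, Finset.mem_biUnion]
        exact ⟨fun h => ⟨h, ρ, h⟩, fun h => h.1⟩
  induction x using Finsupp.induction_linear with
  | zero => simp
  | add x y hx hy => rw [map_add, map_add, hx, hy, add_zero]
  | single τ a =>
    have : Finsupp.single τ a = a • Finsupp.single τ (1 : ℚ) := by simp
    rw [this, map_smul, map_smul, ← cls_eq_single hΓ (represents_volForm Γ ω τ),
      totalBoundary_cls hΓ (hΓ.1 _ τ.2).1 (represents_volForm Γ ω τ).1,
      key (hΓ.1 _ τ.2).1 (represents_volForm Γ ω τ).1, smul_zero]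

end Boundary

/-! ### Comparison with the graded perfect chain complex -/

section Comparison

variable {g m : ℕ} {Γ : Set (Cone g)} {ω : ∀ σ : Γ, ConeOrientation σ.1}

theorem indic_apply_of_notMem {S : Set Γ} {τ : Γ} (h : τ ∉ S) : indic Γ S τ = 0 := by
  rw [indic]
  split_ifs with hS
  · refine Finsupp.single_eq_of_ne fun e => h ?_
    have := hS.choose_spec
    rw [this, e]; rfl
  · rfl

theorem cls_apply_of_not_equivalent {τ : Γ} {σ : Cone g} {D : Form g m}
    (h : ¬ Equivalent τ.1 σ) : cls Γ ω σ D τ = 0 := by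
  rw [cls, Finsupp.sub_apply, indic_apply_of_notMem fun hr => h (Reps.equivalent hr),
    indic_apply_of_notMem fun hr => h (Reps.equivalent hr), sub_zero]

open Classical in
theorem cls_apply (hΓ : IsSystemOfRepresentatives Γ) {τ : Γ} {σ : Cone g} {D : Form g m}
    (hD : IsVol (linSpan σ) D) (h : Equivalent τ.1 σ) :
    cls Γ ω σ D τ = if Reps Γ ω τ σ D then 1 else -1 := by
  split_ifs with hr
  · rw [cls_eq_of_reps hΓ hr, Finsupp.single_eq_same]
  · have h' := cls_eq_of_reps hΓ ((reps_or_reps_neg (ω := ω) hD h).resolve_left hr)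
    rw [cls_neg, neg_eq_iff_eq_neg] at h'
    rw [h', Finsupp.neg_apply, Finsupp.single_eq_same]

open Classical in
theorem facetSign_eq {τ σ : Γ} {ρ : Cone g} (hρ : IsFacet ρ σ.1) {D : Form g (m + 1)}
    (hD : Represents (ω σ) D) {v : Mat g} (hv : v ∈ σ.1) (hvρ : v ∉ ρ) :
    facetSign Γ ω τ σ ρ = if Reps Γ ω τ ρ (contr D v) then 1 else -1 := by
  have hvol := hρ.isVol_contr hD.1 hv hvρ
  rw [facetSign]
  refine if_congr ?_ rfl rfl
  constructor
  · rintro ⟨h, ωρ, hh, hc, hi⟩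
    obtain ⟨E, hE⟩ : ∃ E : Form g m, Represents ωρ E := by
      obtain rfl := hvol.1
      exact exists_represents ωρ
    have hh : move h τ.1 = ρ := hh
    have h1 := (isInduced_iff hρ hD hE hv hvρ).1 hi
    have h2 : Represents ωρ (contr D v) := hE.of_sameOn h1
    have hpv : IsVol (linSpan τ.1) (pull h (contr D v)) := isVol_pull_iff.2 (by rwa [hh])
    obtain ⟨F, hF⟩ : ∃ F : Form g m, Represents (ω τ) F := by
      obtain rfl := hpv.1
      exact exists_represents (ω τ)
    exact ⟨h, hh, hF.of_sameOn ((carries_iff hh hF h2).1 hc)⟩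
  · rintro ⟨h, hh, hr⟩
    obtain ⟨ωρ, hωρ⟩ := exists_orientation hvol
    exact ⟨h, ωρ, hh, (carries_iff hh hr hωρ).2 (.refl _ _),
      (isInduced_iff hρ hD hωρ hv hvρ).2 (.refl _ _)⟩

theorem bd_apply_ne_zero {τ : Γ} {σ : Cone g} {D : Form g m} (h : bd Γ ω σ D τ ≠ 0) :
    dim τ.1 + 1 = dim σ := by
  cases m with
  | zero => exact absurd rfl h
  | succ m =>
    rw [bd, Finsupp.finsetSum_apply] at h
    obtain ⟨ρ, hρ, hne⟩ := Finset.exists_ne_zero_of_sum_ne_zero h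
    have he : Equivalent τ.1 ρ := by
      by_contra he
      exact hne (cls_apply_of_not_equivalent he)
    rw [← he.dim_eq]
    exact (isFacet_of_mem hρ).2

/-- Term by term, a facet equivalent to `τ` contributes its sign to the coefficient of `τ`, and any
other facet contributes zero. -/
theorem incidence_eq (hΓ : IsSystemOfRepresentatives Γ) (τ σ : Γ) {D : Form g m}
    (hD : Represents (ω σ) D) : incidence Γ ω τ σ = bd Γ ω σ.1 D τ := by
  classical
  have hset : {ρ : Cone g | IsFacet ρ σ.1 ∧ Equivalent τ.1 ρ} =
      (((facetFinset σ.1).filter fun ρ => Equivalent τ.1 ρ : Finset (Cone g)) :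
        Set (Cone g)) := by
    ext ρ
    simp [mem_facetFinset (hΓ.1 _ σ.2).1]
  rw [incidence, hset, finsum_mem_coe_finset]
  cases m with
  | zero =>
    have : facetFinset σ.1 = ∅ := Finset.eq_empty_of_forall_notMem fun ρ hρ => by
      have h1 := (isFacet_of_mem hρ).2
      have h2 : dim σ.1 = 0 := hD.1.1
      omega
    rw [this]; rfl
  | succ m =>
    rw [bd, Finsupp.finsetSum_apply, Finset.sum_filter]
    refine Finset.sum_congr rfl fun ρ hρ => ?_
    have hρ := isFacet_of_mem hρ
    have ho := hρ.outer_spec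
    split_ifs with he
    · rw [facetSign_eq hρ hD ho.1 ho.2, cls_apply hΓ (hρ.isVol_contr hD.1 ho.1 ho.2) he]
    · rw [cls_apply_of_not_equivalent he]

theorem finsum_single_apply {α : Type*} {f : α → ℚ} (hf : f.support.Finite) (a : α) :
    (∑ᶠ b, Finsupp.single b (f b)) a = f a := by
  classical
  rw [finsum_eq_sum_of_support_subset (s := hf.toFinset)]
  · rw [Finsupp.finsetSum_apply]
    simp only [Finsupp.single_apply]
    rw [Finset.sum_ite_eq']
    simp [eq_comm]
  · intro b hb
    rw [Set.Finite.coe_toFinset]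
    rw [Function.mem_support] at hb ⊢
    exact fun h => hb (by rw [h, Finsupp.single_zero])

variable (Γ) in
/-- The inclusion of the chain group of one degree into the sum of all chain groups. -/
def chainsInclusion (n : ℤ) : Chains Γ n →ₗ[ℚ] (Γ →₀ ℚ) :=
  Finsupp.lmapDomain ℚ ℚ Subtype.val

theorem chainsInclusion_injective (n : ℤ) : Function.Injective (chainsInclusion Γ n) :=
  Finsupp.mapDomain_injective Subtype.val_injective

theorem chainsInclusion_boundary (hΓ : IsSystemOfRepresentatives Γ) (n : ℤ)
    (x : Chains Γ (n + 1)) : chainsInclusion Γ n (boundary Γ ω n x) =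
      totalBoundary Γ ω (chainsInclusion Γ (n + 1) x) := by
  suffices h : chainsInclusion Γ n ∘ₗ boundary Γ ω n =
      totalBoundary Γ ω ∘ₗ chainsInclusion Γ (n + 1) from LinearMap.congr_fun h x
  ext σ τ
  simp only [LinearMap.comp_apply, Finsupp.lsingle_apply]
  have hinc : ∀ τ : Γ, incidence Γ ω τ σ.1 = bd Γ ω σ.1.1 (volForm Γ ω σ.1) τ := fun τ =>
    incidence_eq hΓ τ σ.1 (represents_volForm Γ ω σ.1)
  rw [boundary, Finsupp.linearCombination_single, one_smul, chainsInclusion, chainsInclusion,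
    Finsupp.lmapDomain_apply, Finsupp.lmapDomain_apply, Finsupp.mapDomain_single, totalBoundary,
    Finsupp.linearCombination_single, one_smul]
  -- A `finsum` with infinite support would be zero by convention; finiteness comes from the finite
  -- support of `bd`.
  have hfin : (Function.support fun σ' : Rep Γ n => incidence Γ ω σ'.1 σ.1).Finite := by
    simp only [hinc]
    exact (bd Γ ω σ.1.1 (volForm Γ ω σ.1)).hasFiniteSupport.preimage
      Subtype.val_injective.injOn
  by_cases hτ : (dim τ.1 : ℤ) = n + 1
  · have : τ = (⟨τ, hτ⟩ : Rep Γ n).1 := rfl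
    rw [this, Finsupp.mapDomain_apply Subtype.val_injective, finsum_single_apply hfin, hinc]
  · rw [Finsupp.mapDomain_of_notMem_range]
    · by_contra hne
      have := bd_apply_ne_zero (Ne.symm hne)
      have := σ.2
      apply hτ
      omega
    · rintro ⟨τ', rfl⟩
      exact hτ τ'.2

theorem boundary_comp_boundary (hΓ : IsSystemOfRepresentatives Γ) (n : ℤ) :
    boundary Γ ω n ∘ₗ boundary Γ ω (n + 1) = 0 := by
  refine LinearMap.ext fun x => chainsInclusion_injective n ?_
  rw [LinearMap.comp_apply, chainsInclusion_boundary hΓ, chainsInclusion_boundary hΓ,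
    totalBoundary_totalBoundary hΓ, LinearMap.zero_apply, map_zero]

theorem mem_range_chainsInclusion {n : ℤ} {x : Γ →₀ ℚ}
    (h : ∀ τ, x τ ≠ 0 → (dim τ.1 : ℤ) = n + 1) : ∃ y : Chains Γ n, chainsInclusion Γ n y = x := by
  refine ⟨x.comapDomain Subtype.val Subtype.val_injective.injOn, ?_⟩
  exact Finsupp.mapDomain_comapDomain _ Subtype.val_injective x fun τ hτ =>
    ⟨⟨τ, h τ (Finsupp.mem_support_iff.1 hτ)⟩, rfl⟩

theorem chainsInclusion_apply_ne_zero {n : ℤ} {x : Chains Γ n} {τ : Γ}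
    (h : chainsInclusion Γ n x τ ≠ 0) : (dim τ.1 : ℤ) = n + 1 := by
  by_contra hτ
  refine h (Finsupp.mapDomain_of_notMem_range _ _ ?_)
  rintro ⟨τ', rfl⟩
  exact hτ τ'.2

/-- The homology vanishes in a degree in which the total differential is exact. -/
theorem isZero_homology (hΓ : IsSystemOfRepresentatives Γ)
    (hd : ∀ n : ℤ, boundary Γ ω n ∘ₗ boundary Γ ω (n + 1) = 0) (k : ℤ)
    (h : ∀ x : Γ →₀ ℚ, (∀ τ, x τ ≠ 0 → (dim τ.1 : ℤ) = k + 1) → totalBoundary Γ ω x = 0 →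
      ∃ y : Γ →₀ ℚ, (∀ τ, y τ ≠ 0 → (dim τ.1 : ℤ) = k + 2) ∧ totalBoundary Γ ω y = x) :
    CategoryTheory.Limits.IsZero ((perfectComplex Γ ω hd).homology k) := by
  obtain ⟨j, rfl⟩ : ∃ j : ℤ, k = j + 1 := ⟨k - 1, by ring⟩
  have key : ∀ x : Chains Γ (j + 1), boundary Γ ω j x = 0 → ∃ y, boundary Γ ω (j + 1) y = x := by
    intro x hx
    obtain ⟨y, hy, hyx⟩ := h (chainsInclusion Γ (j + 1) x)
      (fun τ hτ => chainsInclusion_apply_ne_zero hτ)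
      (by rw [← chainsInclusion_boundary hΓ, hx, map_zero])
    obtain ⟨z, rfl⟩ := mem_range_chainsInclusion (n := j + 1 + 1) fun τ hτ => by
      rw [hy τ hτ]; ring
    exact ⟨z, chainsInclusion_injective _ (by rw [chainsInclusion_boundary hΓ]; exact hyx)⟩
  rw [← HomologicalComplex.exactAt_iff_isZero_homology,
    HomologicalComplex.exactAt_iff' _ (j + 1 + 1) (j + 1) j (by simp) (by simp),
    CategoryTheory.ShortComplex.moduleCat_exact_iff]
  intro x hx
  have e1 : (perfectComplex Γ ω hd).d (j + 1) j = ModuleCat.ofHom (boundary Γ ω j) :=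
    ChainComplex.of_d (fun n => ModuleCat.of ℚ (Chains Γ n))
      (fun n => ModuleCat.ofHom (boundary Γ ω n)) j
  have e2 : (perfectComplex Γ ω hd).d (j + 1 + 1) (j + 1) =
      ModuleCat.ofHom (boundary Γ ω (j + 1)) :=
    ChainComplex.of_d (fun n => ModuleCat.of ℚ (Chains Γ n))
      (fun n => ModuleCat.ofHom (boundary Γ ω n)) (j + 1)
  change (perfectComplex Γ ω hd).d (j + 1) j x = 0 at hx
  change ∃ y, (perfectComplex Γ ω hd).d (j + 1 + 1) (j + 1) y = x
  rw [e1] at hx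
  rw [e2]
  exact key x hx

end Comparison

/-! ### Splittings and automorphisms of lattices -/

section Lattices

/-- A linear functional with value one at a vector splits the module. -/
def splitEquiv {E : Type*} [AddCommGroup E] (φ : E →ₗ[ℤ] ℤ) (c : E) (h : φ c = 1) :
    E ≃ₗ[ℤ] LinearMap.ker φ × ℤ where
  toFun x := (⟨x - φ x • c, by simp [h]⟩, φ x)
  invFun p := p.1 + p.2 • c
  map_add' x y := by
    ext
    · simp [add_smul]; abel
    · simp
  map_smul' a x := by
    ext
    · simp [smul_sub, mul_smul]
    · simp
  left_inv x := by simp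
  right_inv p := by
    have h1 : φ (p.1 : E) = 0 := p.1.2
    have h2 : φ (p.1 + p.2 • c) = p.2 := by rw [map_add, map_smul, h1, h]; simp
    ext
    · change (p.1 : E) + p.2 • c - φ (p.1 + p.2 • c) • c = p.1
      rw [h2]; abel
    · exact h2

/-- Both functionals split the lattice as a kernel plus `ℤ`, and the two kernels are free of the
same rank. So any two primitive vectors are related by an automorphism. -/
theorem exists_equiv_apply_eq {E : Type*} [AddCommGroup E] [Module.Free ℤ E] [Module.Finite ℤ E]
    {φ φ' : E →ₗ[ℤ] ℤ} {c c' : E} (h : φ c = 1) (h' : φ' c' = 1) :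
    ∃ θ : E ≃ₗ[ℤ] E, θ c = c' := by
  have hr : Module.finrank ℤ (LinearMap.ker φ) = Module.finrank ℤ (LinearMap.ker φ') := by
    have h1 := (splitEquiv φ c h).finrank_eq
    have h2 := (splitEquiv φ' c' h').finrank_eq
    rw [Module.finrank_prod] at h1 h2
    omega
  refine ⟨(splitEquiv φ c h).trans (((LinearEquiv.ofFinrankEq _ _ hr).prodCongr
    (LinearEquiv.refl ℤ ℤ)).trans (splitEquiv φ' c' h').symm), ?_⟩
  rw [LinearEquiv.trans_apply, LinearEquiv.trans_apply, LinearEquiv.symm_apply_eq]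
  have e1 : splitEquiv φ c h c = (0, 1) := by
    ext <;> simp [splitEquiv, h]
  have e2 : splitEquiv φ' c' h' c' = (0, 1) := by
    ext <;> simp [splitEquiv, h']
  rw [e1, e2]
  simp

/-- Two vectors that are split off by functionals vanishing on a given set are exchanged by an
automorphism of the lattice that fixes the set pointwise. -/
theorem exists_equiv_fixing {N : Type*} [AddCommGroup N] [Module.Finite ℤ N] (S : Set N)
    {φ φ' : N →ₗ[ℤ] ℤ} {c c' : N} (h : φ c = 1) (h' : φ' c' = 1) (hS : ∀ x ∈ S, φ x = 0)
    (hS' : ∀ x ∈ S, φ' x = 0) : ∃ e : N ≃ₗ[ℤ] N, e c = c' ∧ ∀ x ∈ S, e x = x := by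
  -- `K` contains `S`, the functionals `φ` and `φ'` descend to `N ⧸ K`, and this quotient is
  -- torsion-free, hence free, so that the quotient map splits.
  let K : Submodule ℤ N := ⨅ ψ : {ψ : N →ₗ[ℤ] ℤ // ∀ x ∈ S, ψ x = 0}, LinearMap.ker ψ.1
  have hK : ∀ x, x ∈ K ↔ ∀ ψ : N →ₗ[ℤ] ℤ, (∀ x ∈ S, ψ x = 0) → ψ x = 0 := fun x => by
    simp [K, Submodule.mem_iInf]
  have hKφ : ∀ {ψ : N →ₗ[ℤ] ℤ}, (∀ x ∈ S, ψ x = 0) → K ≤ LinearMap.ker ψ :=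
    fun {ψ} hψ x hx => (hK x).1 hx ψ hψ
  have htf : Module.IsTorsionFree ℤ (N ⧸ K) := by
    refine Module.IsTorsionFree.of_smul_eq_zero fun n x hx => ?_
    obtain ⟨y, rfl⟩ := K.mkQ_surjective x
    rw [← map_smul, Submodule.mkQ_apply, Submodule.Quotient.mk_eq_zero] at hx
    by_cases hn : n = 0
    · exact Or.inl hn
    · right
      rw [Submodule.mkQ_apply, Submodule.Quotient.mk_eq_zero, hK]
      intro ψ hψ
      have := (hK _).1 hx ψ hψ
      rw [map_smul, smul_eq_mul] at this
      exact (mul_eq_zero.1 this).resolve_left hn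
  have hfree : Module.Free ℤ (N ⧸ K) := inferInstance
  obtain ⟨s₀, hs₀⟩ := Module.projective_lifting_property K.mkQ LinearMap.id K.mkQ_surjective
  -- A section `s₀` is corrected by a multiple of the descended `ψ`, with values in `K`, so that it
  -- sends the class of `d` to `d` itself.
  have key : ∀ {ψ : N →ₗ[ℤ] ℤ} {d : N}, ψ d = 1 → (∀ x ∈ S, ψ x = 0) →
      ∃ s : (N ⧸ K) →ₗ[ℤ] N, (∀ q, K.mkQ (s q) = q) ∧ s (K.mkQ d) = d := by
    intro ψ d hd hψ
    have h0 : ∀ q, K.mkQ (s₀ q) = q := fun q => LinearMap.congr_fun hs₀ q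
    refine ⟨s₀ + (K.liftQ ψ (hKφ hψ)).smulRight (d - s₀ (K.mkQ d)), fun q => ?_, ?_⟩
    · simp only [LinearMap.add_apply, LinearMap.smulRight_apply, map_add, map_smul, map_sub, h0,
        sub_self, smul_zero, add_zero]
    · have : K.liftQ ψ (hKφ hψ) (K.mkQ d) = 1 := hd
      simp only [LinearMap.add_apply, LinearMap.smulRight_apply, this, one_smul]
      abel
  obtain ⟨s, hs, hsc⟩ := key h hS
  obtain ⟨s', hs', hsc'⟩ := key h' hS'
  obtain ⟨θ, hθ⟩ := exists_equiv_apply_eq (φ := K.liftQ φ (hKφ hS)) (φ' := K.liftQ φ' (hKφ hS'))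
    (c := K.mkQ c) (c' := K.mkQ c') h h'
  -- The automorphism is the identity on `K` and follows `θ` on the quotient, which is embedded by
  -- `s` in the source and by `s'` in the target.
  refine ⟨LinearEquiv.ofLinearMap
    (LinearMap.id - s ∘ₗ K.mkQ + s' ∘ₗ θ.toLinearMap ∘ₗ K.mkQ)
    (LinearMap.id - s' ∘ₗ K.mkQ + s ∘ₗ θ.symm.toLinearMap ∘ₗ K.mkQ) ?_ ?_, ?_, fun x hx => ?_⟩
  · ext x
    simp [-Submodule.mkQ_apply, hs, hs']
  · ext x
    simp [-Submodule.mkQ_apply, hs, hs']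
  · simp [-Submodule.mkQ_apply, hsc, hsc', hθ]
  · have : K.mkQ x = 0 := by
      rw [Submodule.mkQ_apply, Submodule.Quotient.mk_eq_zero, hK]
      exact fun ψ hψ => hψ x hx
    simp [-Submodule.mkQ_apply, this]

/-- Divide by the greatest common divisor of the entries and use Bézout's identity. -/
theorem exists_dotProduct_eq_one {g : ℕ} {φ : Fin g → ℤ} (hφ : φ ≠ 0) :
    ∃ (d : ℤ) (ψ c : Fin g → ℤ), d ≠ 0 ∧ φ = d • ψ ∧ ψ ⬝ᵥ c = 1 := by
  obtain ⟨d, hd⟩ := (IsPrincipalIdealRing.principal (Ideal.span (Set.range φ))).principal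
  have hmem : ∀ i, ∃ a, a * d = φ i := fun i => by
    have : φ i ∈ Ideal.span (Set.range φ) := Ideal.subset_span ⟨i, rfl⟩
    rw [hd] at this
    exact Submodule.mem_span_singleton.1 this
  choose ψ hψ using hmem
  have hd0 : d ≠ 0 := by
    rintro rfl
    exact hφ (funext fun i => by simp [← hψ i])
  have hdm : d ∈ Ideal.span (Set.range φ) := by
    rw [hd]; exact Submodule.mem_span_singleton_self d
  obtain ⟨c, hc⟩ := Ideal.mem_span_range_iff_exists_fun.1 hdm
  refine ⟨d, ψ, c, hd0, funext fun i => by simp [← hψ i, mul_comm], ?_⟩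
  have : d * (ψ ⬝ᵥ c) = d * 1 := by
    rw [mul_one]
    conv_rhs => rw [← hc]
    rw [dotProduct, Finset.mul_sum]
    exact Finset.sum_congr rfl fun i _ => by rw [← hψ i]; ring
  exact mul_left_cancel₀ hd0 this

end Lattices

/-! ### Existence and uniqueness of complements -/

section Complements

open Matrix

variable {g : ℕ}

/-- The vector `c` spans a complement to the lattice of the integral vectors in `ker φ`, and the
forms in the cone `σ` are supported in the latter. -/
def IsComplement (σ : Cone g) (c φ : Fin g → ℤ) : Prop :=
  φ ⬝ᵥ c = 1 ∧ ∀ X ∈ σ, X *ᵥ toReal φ = 0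

theorem IsComplement.mono {σ ρ : Cone g} {c φ : Fin g → ℤ} (h : IsComplement σ c φ)
    (hρ : ρ ≤ σ) : IsComplement ρ c φ := ⟨h.1, fun X hX => h.2 X (hρ hX)⟩

/-- The linear map `X ↦ X φ`. -/
def mulVecMap (φ : Fin g → ℝ) : Mat g →ₗ[ℝ] (Fin g → ℝ) where
  toFun X := X *ᵥ φ
  map_add' X Y := add_mulVec X Y φ
  map_smul' a X := smul_mulVec a X φ

theorem rankOne_mulVec_eq_zero {ξ φ : Fin g → ℤ} (h : φ ⬝ᵥ ξ = 0) :
    rankOne ξ *ᵥ toReal φ = 0 := by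
  rw [rankOne, vecMulVec_mulVec, toReal_dotProduct, dotProduct_comm, h]
  simp

/-- The span of `σ` has a basis of fewer than `g` forms `ξξᵗ`, and fewer than `g` integral vectors
have a common nonzero integral annihilator. This is the only place where the bound on the dimension
produces anything. -/
theorem exists_isComplement {σ : Cone g} (hσ : σ ∈ perfectCones g) (hdim : dim σ < g) :
    ∃ c φ, IsComplement σ c φ := by
  obtain ⟨Q, hQ, rfl⟩ := mem_perfectCones_iff.1 hσ
  set G := rankOne '' {ξ | formValue Q ξ = 1} with hG
  obtain ⟨f, hfG, hfspan, -⟩ := Submodule.exists_fun_fin_finrank_span_eq ℝ G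
  have hr : Module.finrank ℝ (Submodule.span ℝ G) < g := by
    have : dim (unitCone Q) = Module.finrank ℝ (Submodule.span ℝ G) := by
      rw [dim, unitCone, linSpan_hull]
    omega
  choose ξ hξ hξf using hfG
  -- Zero rows make the matrix of the `ξ i` square; its determinant then vanishes, which yields an
  -- integral kernel vector.
  let A : Matrix (Fin g) (Fin g) ℤ := Matrix.of fun i =>
    if h : i.1 < Module.finrank ℝ (Submodule.span ℝ G) then ξ ⟨i, h⟩ else 0
  have hA : A.det = 0 := by
    refine det_eq_zero_of_row_eq_zero ⟨_, hr⟩ fun j => ?_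
    simp [A]
  obtain ⟨φ, hφ, hAφ⟩ := exists_mulVec_eq_zero_iff.2 hA
  have hξφ : ∀ i, ξ i ⬝ᵥ φ = 0 := fun i => by
    have := congrFun hAφ ⟨i, i.2.trans hr⟩
    simpa [A, mulVec] using this
  obtain ⟨d, ψ, c, hd, rfl, hψc⟩ := exists_dotProduct_eq_one hφ
  refine ⟨c, ψ, hψc, fun X hX => ?_⟩
  have hX' : X ∈ Submodule.span ℝ (Set.range f) := by
    rw [hfspan, ← linSpan_hull]
    exact mem_linSpan hX
  have hle : Submodule.span ℝ (Set.range f) ≤ LinearMap.ker (mulVecMap (toReal ψ)) := by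
    refine Submodule.span_le.2 ?_
    rintro _ ⟨i, rfl⟩
    change f i *ᵥ toReal ψ = 0
    have h1 : ξ i ⬝ᵥ ψ = 0 := by
      have := hξφ i
      rw [dotProduct_smul, smul_eq_mul] at this
      exact (mul_eq_zero.1 this).resolve_left hd
    rw [← hξf i, rankOne_mulVec_eq_zero (by rw [dotProduct_comm, h1])]
  exact hle hX'

/-- The lattice automorphism fixes all vectors of value one, hence all generators of `σ`. This makes
the homotopy independent of the chosen complement. -/
theorem exists_gl_fixing {σ : Cone g} (hσ : σ ∈ perfectCones g) {c φ c' φ' : Fin g → ℤ}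
    (h : IsComplement σ c φ) (h' : IsComplement σ c' φ') :
    ∃ k : Gl g, (k : Matrix (Fin g) (Fin g) ℤ) *ᵥ c = c' ∧ ∀ X ∈ σ, act k X = X := by
  obtain ⟨Q, hQ, rfl⟩ := mem_perfectCones_iff.1 hσ
  have hz : ∀ {c φ}, IsComplement (unitCone Q) c φ → ∀ ξ ∈ {ξ | formValue Q ξ = 1},
      dotProductBilin ℤ ℤ φ ξ = 0 := by
    intro c φ h ξ hξ
    exact dotProduct_eq_zero_of_rankOne_mulVec (ne_zero_of_formValue_eq_one hξ)
      (h.2 _ (PointedCone.subset_hull ⟨ξ, hξ, rfl⟩))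
  obtain ⟨e, hec, heS⟩ := exists_equiv_fixing {ξ | formValue Q ξ = 1}
    (φ := dotProductBilin ℤ ℤ φ) (φ' := dotProductBilin ℤ ℤ φ') h.1 h'.1 (hz h) (hz h')
  let k : Gl g := GeneralLinearGroup.toLin.symm (LinearMap.GeneralLinearGroup.ofLinearEquiv e)
  have hk : ∀ x, (k : Matrix (Fin g) (Fin g) ℤ) *ᵥ x = e x := fun x => by
    have : (k : Matrix (Fin g) (Fin g) ℤ) = LinearMap.toMatrix' e.toLinearMap := rfl
    rw [this, LinearMap.toMatrix'_mulVec]; rfl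
  refine ⟨k, by rw [hk, hec], fun X hX => ?_⟩
  have : X ∈ LinearMap.ker (act k - LinearMap.id) := by
    refine (Submodule.span_le (p := LinearMap.ker (act k - LinearMap.id))
      (s := rankOne '' {ξ | formValue Q ξ = 1})).2 ?_ ?_
    · rintro _ ⟨ξ, hξ, rfl⟩
      change act k (rankOne ξ) - rankOne ξ = 0
      rw [act_rankOne, hk, heS ξ hξ, sub_self]
    · rw [← linSpan_hull]; exact mem_linSpan hX
  rw [LinearMap.mem_ker, LinearMap.sub_apply, sub_eq_zero] at this
  exact this

end Complements

/-! ### Adding a complementary ray: facets and orientations -/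

section Coloops

open Matrix

variable {g m : ℕ}

/-- The linear functional `X ↦ φᵗ X φ`. -/
def valueAt (φ : Fin g → ℤ) : Mat g →ₗ[ℝ] ℝ where
  toFun X := toReal φ ⬝ᵥ X *ᵥ toReal φ
  map_add' X Y := by rw [add_mulVec, dotProduct_add]
  map_smul' a X := by rw [smul_mulVec, dotProduct_smul]; rfl

theorem valueAt_rankOne {φ c : Fin g → ℤ} (h : φ ⬝ᵥ c = 1) : valueAt φ (rankOne c) = 1 := by
  change toReal φ ⬝ᵥ rankOne c *ᵥ toReal φ = 1
  rw [rankOne, vecMulVec_mulVec, toReal_dotProduct, dotProduct_comm c, h]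
  simp [toReal_dotProduct, h]

theorem IsComplement.valueAt_eq_zero {σ : Cone g} {c φ : Fin g → ℤ} (h : IsComplement σ c φ)
    {X : Mat g} (hX : X ∈ linSpan σ) : valueAt φ X = 0 := by
  refine eq_zero_of_mem_linSpan (fun Y hY => ?_) hX
  change toReal φ ⬝ᵥ Y *ᵥ toReal φ = 0
  rw [h.2 Y hY, dotProduct_zero]

theorem mem_ray {c : Fin g → ℤ} {x : Mat g} : x ∈ ray c ↔ ∃ t : ℝ, 0 ≤ t ∧ t • rankOne c = x := by
  rw [ray, PointedCone.hull, Submodule.mem_span_singleton]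
  exact ⟨fun ⟨a, ha⟩ => ⟨a, a.2, ha⟩, fun ⟨t, ht, h⟩ => ⟨⟨t, ht⟩, h⟩⟩

theorem rankOne_mem_ray (c : Fin g → ℤ) : rankOne c ∈ ray c :=
  mem_ray.2 ⟨1, zero_le_one, one_smul _ _⟩

theorem rankOne_mem_sup (σ : Cone g) (c : Fin g → ℤ) : rankOne c ∈ σ ⊔ ray c :=
  Submodule.mem_sup_right (rankOne_mem_ray c)

theorem mem_sup_ray {σ : Cone g} {c : Fin g → ℤ} {x : Mat g} :
    x ∈ σ ⊔ ray c ↔ ∃ y ∈ σ, ∃ t : ℝ, 0 ≤ t ∧ y + t • rankOne c = x := by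
  rw [Submodule.mem_sup]
  refine exists_congr fun y => and_congr_right fun _ => ⟨?_, ?_⟩
  · rintro ⟨z, hz, rfl⟩
    obtain ⟨t, ht, rfl⟩ := mem_ray.1 hz
    exact ⟨t, ht, rfl⟩
  · rintro ⟨t, ht, rfl⟩
    exact ⟨_, mem_ray.2 ⟨t, ht, rfl⟩, rfl⟩

theorem IsComplement.valueAt_add {σ : Cone g} {c φ : Fin g → ℤ} (h : IsComplement σ c φ)
    {y : Mat g} (hy : y ∈ σ) (t : ℝ) : valueAt φ (y + t • rankOne c) = t := by
  rw [map_add, map_smul, h.valueAt_eq_zero (mem_linSpan hy), valueAt_rankOne h.1]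
  simp

theorem IsComplement.mem_iff {σ : Cone g} {c φ : Fin g → ℤ} (h : IsComplement σ c φ) {x : Mat g} :
    x ∈ σ ↔ x ∈ σ ⊔ ray c ∧ valueAt φ x = 0 := by
  constructor
  · exact fun hx => ⟨Submodule.mem_sup_left hx, h.valueAt_eq_zero (mem_linSpan hx)⟩
  · rintro ⟨hx, h0⟩
    obtain ⟨y, hy, t, -, rfl⟩ := mem_sup_ray.1 hx
    rw [h.valueAt_add hy] at h0
    rw [h0, zero_smul, add_zero]
    exact hy

theorem IsComplement.rankOne_notMem_linSpan {σ : Cone g} {c φ : Fin g → ℤ}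
    (h : IsComplement σ c φ) : rankOne c ∉ linSpan σ := fun hc => by
  have := h.valueAt_eq_zero hc
  rw [valueAt_rankOne h.1] at this
  exact one_ne_zero this

theorem IsComplement.rankOne_notMem {σ : Cone g} {c φ : Fin g → ℤ}
    (h : IsComplement σ c φ) : rankOne c ∉ σ := fun hc => h.rankOne_notMem_linSpan (mem_linSpan hc)

theorem linSpan_sup_ray (σ : Cone g) (c : Fin g → ℤ) :
    linSpan (σ ⊔ ray c) = linSpan σ ⊔ Submodule.span ℝ {rankOne c} := by
  refine le_antisymm (Submodule.span_le.2 fun x hx => ?_) (sup_le (linSpan_mono le_sup_left) ?_)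
  · obtain ⟨y, hy, t, -, rfl⟩ := mem_sup_ray.1 hx
    exact Submodule.add_mem_sup (mem_linSpan hy)
      (Submodule.smul_mem _ _ (Submodule.mem_span_singleton_self _))
  · rw [Submodule.span_singleton_le_iff_mem]
    exact mem_linSpan (rankOne_mem_sup σ c)

theorem IsComplement.dim_sup_ray {σ : Cone g} {c φ : Fin g → ℤ} (h : IsComplement σ c φ) :
    dim σ + 1 = dim (σ ⊔ ray c) := by
  have h1 := Submodule.finrank_sup_add_finrank_inf_eq (linSpan σ) (Submodule.span ℝ {rankOne c})
  have h2 : linSpan σ ⊓ Submodule.span ℝ {rankOne c} = ⊥ := by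
    rw [eq_bot_iff]
    rintro x ⟨hx, hxc⟩
    obtain ⟨t, rfl⟩ := Submodule.mem_span_singleton.1 hxc
    have := h.valueAt_eq_zero hx
    rw [map_smul, valueAt_rankOne h.1, smul_eq_mul, mul_one] at this
    simp [this]
  have h3 : rankOne c ≠ 0 := fun e => h.rankOne_notMem (e ▸ σ.zero_mem)
  rw [h2, finrank_bot, finrank_span_singleton h3, ← linSpan_sup_ray] at h1
  rw [dim, dim]
  omega

theorem IsComplement.isFacet {σ : Cone g} {c φ : Fin g → ℤ} (h : IsComplement σ c φ) :
    IsFacet σ (σ ⊔ ray c) := by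
  refine ⟨isFace_iff.2 ⟨valueAt φ, fun y hy => ?_, fun x => h.mem_iff⟩, h.dim_sup_ray⟩
  obtain ⟨z, hz, t, ht, rfl⟩ := mem_sup_ray.1 hy
  rwa [h.valueAt_add hz]

theorem IsComplement.isFacet_sup_ray {σ ρ : Cone g} {c φ : Fin g → ℤ} (h : IsComplement σ c φ)
    (hρ : IsFacet ρ σ) : IsFacet (ρ ⊔ ray c) (σ ⊔ ray c) := by
  constructor
  · obtain ⟨ℓ, h0, hm⟩ := isFace_iff.1 hρ.1
    -- Subtracting a multiple of `valueAt φ`, which is zero on `σ`, makes the functional vanish on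
    -- the added ray.
    have hval : ∀ y ∈ σ, ∀ t : ℝ, (ℓ - ℓ (rankOne c) • valueAt φ) (y + t • rankOne c) = ℓ y := by
      intro y hy t
      rw [LinearMap.sub_apply, LinearMap.smul_apply, h.valueAt_add hy, map_add, map_smul,
        smul_eq_mul, smul_eq_mul]
      ring
    refine isFace_iff.2 ⟨ℓ - ℓ (rankOne c) • valueAt φ, fun y hy => ?_, fun x => ?_⟩
    · obtain ⟨z, hz, t, ht, rfl⟩ := mem_sup_ray.1 hy
      rw [hval z hz]
      exact h0 z hz
    · constructor
      · intro hx
        obtain ⟨y, hy, t, ht, rfl⟩ := mem_sup_ray.1 hx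
        have hy' := (hm y).1 hy
        exact ⟨mem_sup_ray.2 ⟨y, hy'.1, t, ht, rfl⟩, by rw [hval y hy'.1, hy'.2]⟩
      · rintro ⟨hx, hx0⟩
        obtain ⟨y, hy, t, ht, rfl⟩ := mem_sup_ray.1 hx
        rw [hval y hy] at hx0
        exact mem_sup_ray.2 ⟨y, (hm y).2 ⟨hy, hx0⟩, t, ht, rfl⟩
  · rw [← h.dim_sup_ray, ← (h.mono hρ.le).dim_sup_ray, hρ.2]

/-- If the defining functional vanishes on the ray, the facet contains the ray and is `ρ' ⊔ ray c`.
If it is positive there, the facet is a face of `σ`, and it equals `σ` by dimension. -/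
theorem IsComplement.eq_or_of_isFacet {σ ρ : Cone g} {c φ : Fin g → ℤ} (h : IsComplement σ c φ)
    (hρ : IsFacet ρ (σ ⊔ ray c)) : ρ = σ ∨ ∃ ρ', IsFacet ρ' σ ∧ ρ' ⊔ ray c = ρ := by
  obtain ⟨ℓ, h0, hm⟩ := isFace_iff.1 hρ.1
  have h0σ : ∀ y ∈ σ, 0 ≤ ℓ y := fun y hy => h0 y (Submodule.mem_sup_left hy)
  have hc := h0 _ (rankOne_mem_sup σ c)
  have hd := hρ.2
  rw [← h.dim_sup_ray] at hd
  have hval : ∀ y ∈ σ, ∀ t : ℝ, 0 ≤ t →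
      (ℓ (y + t • rankOne c) = 0 ↔ ℓ y = 0 ∧ t * ℓ (rankOne c) = 0) := by
    intro y hy t ht
    rw [map_add, map_smul, smul_eq_mul]
    exact add_eq_zero_iff_of_nonneg (h0σ y hy) (mul_nonneg ht hc)
  have hmem : ∀ x, x ∈ ρ ↔ ∃ y ∈ zeroFace ℓ σ, ∃ t : ℝ, 0 ≤ t ∧ t * ℓ (rankOne c) = 0 ∧
      y + t • rankOne c = x := by
    intro x
    rw [hm]
    constructor
    · rintro ⟨hx, hx0⟩
      obtain ⟨y, hy, t, ht, rfl⟩ := mem_sup_ray.1 hx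
      rw [hval y hy t ht] at hx0
      exact ⟨y, mem_zeroFace.2 ⟨hy, hx0.1⟩, t, ht, hx0.2, rfl⟩
    · rintro ⟨y, hy, t, ht, h1, rfl⟩
      rw [mem_zeroFace] at hy
      exact ⟨mem_sup_ray.2 ⟨y, hy.1, t, ht, rfl⟩, (hval y hy.1 t ht).2 ⟨hy.2, h1⟩⟩
  by_cases hc0 : ℓ (rankOne c) = 0
  · right
    have e : zeroFace ℓ σ ⊔ ray c = ρ := by
      ext x
      rw [hmem, mem_sup_ray]
      simp [hc0]
    refine ⟨zeroFace ℓ σ, ⟨isFace_zeroFace h0σ, ?_⟩, e⟩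
    have := (h.mono (isFace_zeroFace h0σ).le).dim_sup_ray
    rw [e] at this
    omega
  · left
    have e : ρ = zeroFace ℓ σ := by
      ext x
      rw [hmem]
      constructor
      · rintro ⟨y, hy, t, ht, h1, rfl⟩
        have : t = 0 := (mul_eq_zero.1 h1).resolve_right hc0
        rwa [this, zero_smul, add_zero]
      · exact fun hx => ⟨x, hx, 0, le_rfl, by simp, by simp⟩
    by_contra hne
    have := dim_lt_of_isFace (isFace_zeroFace h0σ) (e ▸ hne)
    rw [← e] at this
    omega

/-- The cone is the sum of a ray and a cone supported in a complementary lattice. -/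
def HasColoop (σ : Cone g) : Prop := ∃ σ₀ c φ, IsComplement σ₀ c φ ∧ σ = σ₀ ⊔ ray c

theorem move_ray (h : Gl g) (c : Fin g → ℤ) :
    move h (ray c) = ray ((h : Matrix (Fin g) (Fin g) ℤ) *ᵥ c) := by
  rw [ray, move_hull, Set.image_singleton, act_rankOne, ray]

theorem move_sup_ray (h : Gl g) (σ : Cone g) (c : Fin g → ℤ) :
    move h (σ ⊔ ray c) = move h σ ⊔ ray ((h : Matrix (Fin g) (Fin g) ℤ) *ᵥ c) := by
  rw [← move_ray]; exact move_sup h σ (ray c)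

theorem IsComplement.move {σ : Cone g} {c φ : Fin g → ℤ} (hσ : IsComplement σ c φ) (h : Gl g) :
    IsComplement (move h σ) ((h : Matrix (Fin g) (Fin g) ℤ) *ᵥ c)
      (φ ᵥ* ((h⁻¹ : Gl g) : Matrix (Fin g) (Fin g) ℤ)) := by
  constructor
  · rw [← dotProduct_mulVec, mulVec_mulVec, ← Units.val_mul, inv_mul_cancel, Units.val_one,
      one_mulVec, hσ.1]
  · intro X hX
    obtain ⟨Y, hY, rfl⟩ := mem_move.1 hX
    have e : toReal (φ ᵥ* ((h⁻¹ : Gl g) : Matrix (Fin g) (Fin g) ℤ)) =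
        (realMat h⁻¹)ᵀ *ᵥ toReal φ := by
      rw [mulVec_transpose]
      funext i
      exact RingHom.map_vecMul (Int.castRingHom ℝ) _ _ _
    rw [e, act_apply, mulVec_mulVec, mul_assoc, ← transpose_mul, ← realMat_mul, inv_mul_cancel,
      realMat_one, transpose_one, mul_one, ← mulVec_mulVec, hσ.2 Y hY, mulVec_zero]

theorem HasColoop.move {σ : Cone g} (hσ : HasColoop σ) (h : Gl g) : HasColoop (move h σ) := by
  obtain ⟨σ₀, c, φ, hc, rfl⟩ := hσ
  exact ⟨_, _, _, hc.move h, move_sup_ray h σ₀ c⟩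

theorem hasColoop_move_iff {σ : Cone g} {h : Gl g} : HasColoop (move h σ) ↔ HasColoop σ := by
  refine ⟨fun H => ?_, fun H => H.move h⟩
  have := H.move h⁻¹
  rwa [move_inv_move] at this

/-- The exterior product of a form with the functional `X ↦ φᵗ X φ`. -/
def extendForm (D : Form g m) (φ : Fin g → ℤ) : Form g (m + 1) :=
  (-1 : ℝ) ^ m • AlternatingMap.alternatizeUncurryFin ((valueAt φ).smulRight D)

theorem extendForm_neg (D : Form g m) (φ : Fin g → ℤ) :
    extendForm (-D) φ = -extendForm D φ := by
  ext x
  simp [extendForm, AlternatingMap.alternatizeUncurryFin_apply]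

/-- The functional `valueAt φ` vanishes on the span of `σ`, so only the term in which it receives
the last vector survives; the sign in `extendForm` cancels the sign of that term. -/
theorem IsComplement.contr_extendForm {σ : Cone g} {c φ : Fin g → ℤ} (h : IsComplement σ c φ)
    (D : Form g m) {x : Fin m → Mat g} (hx : ∀ i, x i ∈ linSpan σ) :
    contr (extendForm D φ) (rankOne c) x = D x := by
  rw [contr_apply, extendForm, AlternatingMap.smul_apply,
    AlternatingMap.alternatizeUncurryFin_apply, Fin.sum_univ_castSucc]
  have h1 : ∀ i, valueAt φ (x i) = 0 := fun i => h.valueAt_eq_zero (hx i)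
  have h2 : (Fin.last m).removeNth (Fin.snoc x (rankOne c) : Fin (m + 1) → Mat g) = x := by
    funext i
    simp [Fin.removeNth]
  simp only [Fin.snoc_castSucc, Fin.snoc_last, LinearMap.smulRight_apply, h1, zero_smul,
    AlternatingMap.zero_apply, smul_zero, Finset.sum_const_zero, zero_add, valueAt_rankOne h.1,
    one_smul, h2, Fin.val_last]
  rw [zsmul_eq_mul, smul_eq_mul]
  push_cast
  rw [← mul_assoc, ← mul_pow]
  simp

theorem IsComplement.sameOn_contr_extendForm {σ : Cone g} {c φ : Fin g → ℤ}
    (h : IsComplement σ c φ) (D : Form g m) :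
    SameOn (linSpan σ) (contr (extendForm D φ) (rankOne c)) D :=
  .of_eq fun _ hx => h.contr_extendForm D hx

theorem IsComplement.isVol_extendForm {σ : Cone g} {c φ : Fin g → ℤ} (h : IsComplement σ c φ)
    {D : Form g m} (hD : IsVol (linSpan σ) D) :
    IsVol (linSpan (σ ⊔ ray c)) (extendForm D φ) := by
  have hd : Module.finrank ℝ (linSpan σ) + 1 = Module.finrank ℝ (linSpan (σ ⊔ ray c)) :=
    h.dim_sup_ray
  obtain ⟨hm, x, hx, hne⟩ := hD
  refine ⟨by omega, Fin.snoc x (rankOne c), fun i => ?_, ?_⟩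
  · refine Fin.lastCases ?_ (fun i => ?_) i
    · simpa using mem_linSpan (rankOne_mem_sup σ c)
    · simpa using linSpan_mono le_sup_left (hx i)
  · rw [← contr_apply, h.contr_extendForm D hx]
    exact hne

theorem IsComplement.sameOn_of_contr {σ : Cone g} {c φ : Fin g → ℤ} (h : IsComplement σ c φ)
    {D E : Form g (m + 1)} (hD : IsVol (linSpan (σ ⊔ ray c)) D)
    (hE : IsVol (linSpan (σ ⊔ ray c)) E)
    (hs : SameOn (linSpan σ) (contr D (rankOne c)) (contr E (rankOne c))) :
    SameOn (linSpan (σ ⊔ ray c)) D E :=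
  PerfectCone.sameOn_of_contr (linSpan_mono le_sup_left) h.dim_sup_ray
    (mem_linSpan (rankOne_mem_sup σ c)) h.rankOne_notMem_linSpan hD hE hs

theorem IsComplement.isVol_contr {σ : Cone g} {c φ : Fin g → ℤ} (h : IsComplement σ c φ)
    {D : Form g (m + 1)} (hD : IsVol (linSpan (σ ⊔ ray c)) D) :
    IsVol (linSpan σ) (contr D (rankOne c)) :=
  h.isFacet.isVol_contr hD (rankOne_mem_sup σ c) h.rankOne_notMem

/-- The functional `φ'` need not be the transform of `φ`: contracting with the rays removes both,
and what remains is the pull-back of `D`. -/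
theorem sameOn_pull_extendForm {σ : Cone g} {c φ φ' : Fin g → ℤ} (k : Gl g)
    (h : IsComplement σ c φ)
    (h' : IsComplement (move k σ) ((k : Matrix (Fin g) (Fin g) ℤ) *ᵥ c) φ') {D : Form g m}
    (hD : IsVol (linSpan (move k σ)) D) :
    SameOn (linSpan (σ ⊔ ray c)) (pull k (extendForm D φ')) (extendForm (pull k D) φ) := by
  refine h.sameOn_of_contr ?_ (h.isVol_extendForm (isVol_pull_iff.2 hD)) ?_
  · rw [isVol_pull_iff, move_sup_ray]
    exact h'.isVol_extendForm hD
  · rw [pull, contr_comp, act_rankOne]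
    exact (sameOn_pull_iff.2 (h'.sameOn_contr_extendForm D)).trans
      (h.sameOn_contr_extendForm (pull k D)).symm

end Coloops

/-! ### The homotopy operator -/

section Homotopy

open Matrix

variable {g m : ℕ} {Γ : Set (Cone g)} {ω : ∀ σ : Γ, ConeOrientation σ.1}

/-- An element that fixes `σ` pointwise and sends `c` to `c'` carries one extended oriented cone to
the other. -/
theorem cls_sup_ray_eq {σ : Cone g} (hσ : σ ∈ perfectCones g) {c φ c' φ' : Fin g → ℤ}
    (h : IsComplement σ c φ) (h' : IsComplement σ c' φ') {D : Form g m}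
    (hD : IsVol (linSpan σ) D) : cls Γ ω (σ ⊔ ray c) (extendForm D φ) =
      cls Γ ω (σ ⊔ ray c') (extendForm D φ') := by
  obtain ⟨k, rfl, hk⟩ := exists_gl_fixing hσ h h'
  have hkσ : move k σ = σ := by
    ext x
    rw [mem_move]
    exact ⟨fun ⟨y, hy, e⟩ => by rw [← e, hk y hy]; exact hy, fun hx => ⟨x, hx, hk x hx⟩⟩
  have h1 : σ ⊔ ray ((k : Matrix (Fin g) (Fin g) ℤ) *ᵥ c) = move k (σ ⊔ ray c) := by
    rw [move_sup_ray, hkσ]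
  have h2 : SameOn (linSpan σ) D (pull k D) := .of_eq fun x hx => by
    rw [pull, AlternatingMap.compLinearMap_apply]
    congr 1
    funext i
    have := eq_zero_of_mem_linSpan (ℓ := act k - LinearMap.id)
      (fun y hy => by simp [hk y hy]) (hx i)
    exact (sub_eq_zero.1 this).symm
  have h3 : SameOn (linSpan (σ ⊔ ray c)) (extendForm D φ) (extendForm (pull k D) φ) :=
    h.sameOn_of_contr (h.isVol_extendForm hD) (h.isVol_extendForm (h2.isVol hD))
      ((h.sameOn_contr_extendForm D).trans (h2.trans (h.sameOn_contr_extendForm (pull k D)).symm))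
  rw [h1, cls_move]
  exact cls_congr (h3.trans (sameOn_pull_extendForm k h (by rwa [hkσ]) (by rwa [hkσ])).symm)

variable (Γ ω)

open Classical in
/-- The class of the sum of an oriented cone without coloops and a complementary ray. -/
def coneExt (σ : Cone g) (D : Form g m) : Γ →₀ ℚ :=
  if h : ¬ HasColoop σ ∧ ∃ c φ, IsComplement σ c φ then
    cls Γ ω (σ ⊔ ray h.2.choose) (extendForm D h.2.choose_spec.choose) else 0

variable {Γ ω}

theorem coneExt_of_hasColoop {σ : Cone g} (h : HasColoop σ) (D : Form g m) :
    coneExt Γ ω σ D = 0 := dif_neg fun h' => h'.1 h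

theorem coneExt_eq {σ : Cone g} (hσ : σ ∈ perfectCones g) (hnc : ¬ HasColoop σ)
    {c φ : Fin g → ℤ} (h : IsComplement σ c φ) {D : Form g m} (hD : IsVol (linSpan σ) D) :
    coneExt Γ ω σ D = cls Γ ω (σ ⊔ ray c) (extendForm D φ) := by
  have h' : ¬ HasColoop σ ∧ ∃ c φ, IsComplement σ c φ := ⟨hnc, c, φ, h⟩
  rw [coneExt, dif_pos h']
  exact cls_sup_ray_eq hσ h'.2.choose_spec.choose_spec h hD

theorem coneExt_neg (σ : Cone g) (D : Form g m) : coneExt Γ ω σ (-D) = -coneExt Γ ω σ D := by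
  rw [coneExt, coneExt]
  split_ifs
  · rw [extendForm_neg, cls_neg]
  · rw [neg_zero]

theorem coneExt_congr {σ : Cone g} {D E : Form g m} (hD : IsVol (linSpan σ) D)
    (h : SameOn (linSpan σ) D E) : coneExt Γ ω σ D = coneExt Γ ω σ E := by
  rw [coneExt, coneExt]
  split_ifs with hc
  · have h' := hc.2.choose_spec.choose_spec
    exact cls_congr (h'.sameOn_of_contr (h'.isVol_extendForm hD)
      (h'.isVol_extendForm (h.isVol hD)) ((h'.sameOn_contr_extendForm D).trans
        (h.trans (h'.sameOn_contr_extendForm E).symm)))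
  · rfl

theorem coneExt_move {σ : Cone g} (hσ : σ ∈ perfectCones g) (k : Gl g) {D : Form g m}
    (hD : IsVol (linSpan (move k σ)) D) :
    coneExt Γ ω (move k σ) D = coneExt Γ ω σ (pull k D) := by
  by_cases hnc : HasColoop σ
  · rw [coneExt_of_hasColoop hnc, coneExt_of_hasColoop (hnc.move k)]
  by_cases hc : ∃ c φ, IsComplement σ c φ
  · obtain ⟨c, φ, h⟩ := hc
    rw [coneExt_eq (perfect_move hσ k) (mt hasColoop_move_iff.1 hnc) (h.move k) hD,
      coneExt_eq hσ hnc h (isVol_pull_iff.2 hD), ← move_sup_ray, cls_move]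
    exact cls_congr (sameOn_pull_extendForm k h (h.move k) hD)
  · have hc' : ¬ ∃ c φ, IsComplement (move k σ) c φ := by
      rintro ⟨c, φ, h⟩
      have := h.move k⁻¹
      rw [move_inv_move] at this
      exact hc ⟨_, _, this⟩
    rw [coneExt, coneExt, dif_neg fun h => hc' h.2, dif_neg fun h => hc h.2]

variable (Γ ω)

/-- The contracting homotopy. -/
def homotopy : (Γ →₀ ℚ) →ₗ[ℚ] (Γ →₀ ℚ) :=
  Finsupp.linearCombination ℚ fun τ : Γ => coneExt Γ ω τ.1 (volForm Γ ω τ)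

variable {Γ ω}

theorem homotopy_cls (hΓ : IsSystemOfRepresentatives Γ) {σ : Cone g}
    (hσ : σ ∈ perfectCones g) {D : Form g m} (hD : IsVol (linSpan σ) D) :
    homotopy Γ ω (cls Γ ω σ D) = coneExt Γ ω σ D := by
  refine map_cls hΓ (homotopy Γ ω) (fun σ D => coneExt Γ ω σ D) (fun τ D hD => ?_)
    (fun σ _ D _ => coneExt_neg σ D) (fun σ hσ h D hD => coneExt_move hσ h hD)
    (fun σ _ D E hD h => coneExt_congr hD h) hσ hD
  rw [homotopy, Finsupp.linearCombination_single, one_smul]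
  obtain rfl := hD.1.1
  exact coneExt_congr (represents_volForm Γ ω τ).1 ((represents_volForm Γ ω τ).sameOn hD)

/-! ### Cones with two coloops -/

theorem transpose_eq_of_mem {σ : Cone g} (hσ : σ ∈ perfectCones g) {X : Mat g} (hX : X ∈ σ) :
    Xᵀ = X := by
  obtain ⟨Q, hQ, rfl⟩ := mem_perfectCones_iff.1 hσ
  have h := mem_linSpan hX
  rw [unitCone, linSpan_hull] at h
  clear hX hσ
  induction h using Submodule.span_induction with
  | mem x hx =>
    obtain ⟨ξ, -, rfl⟩ := hx
    exact transpose_vecMulVec _ _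
  | zero => exact transpose_zero
  | add x y _ _ hx hy => rw [transpose_add, hx, hy]
  | smul a x _ hx => rw [transpose_smul, hx]

/-- The matrix of the reflection `x ↦ x + ψ(x) u`, where `ψ(u) = -2`. -/
def reflection (u ψ : Fin g → ℤ) (h : ψ ⬝ᵥ u = -2) : Gl g :=
  have e : (1 + vecMulVec u ψ) * (1 + vecMulVec u ψ) = 1 := by
    rw [mul_add, add_mul, add_mul, mul_one, mul_one, one_mul, vecMulVec_mul_vecMulVec, h]
    ext i j
    simp [vecMulVec_apply]
    ring
  ⟨1 + vecMulVec u ψ, 1 + vecMulVec u ψ, e, e⟩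

theorem reflection_mulVec (u ψ : Fin g → ℤ) (h : ψ ⬝ᵥ u = -2) (x : Fin g → ℤ) :
    (reflection u ψ h : Matrix (Fin g) (Fin g) ℤ) *ᵥ x = x + (ψ ⬝ᵥ x) • u := by
  change (1 + vecMulVec u ψ) *ᵥ x = _
  rw [add_mulVec, one_mulVec, vecMulVec_mulVec]
  simp

theorem act_reflection (u ψ : Fin g → ℤ) (h : ψ ⬝ᵥ u = -2) {X : Mat g} (hX : Xᵀ = X)
    (hψ : X *ᵥ toReal ψ = 0) : act (reflection u ψ h) X = X := by
  have e : realMat (reflection u ψ h) = 1 + vecMulVec (toReal u) (toReal ψ) := by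
    rw [realMat_eq]
    change (Int.castRingHom ℝ).mapMatrix (1 + vecMulVec u ψ) = _
    rw [map_add, map_one]
    congr 1
    ext i j
    simp [vecMulVec_apply, toReal]
  have hψ' : toReal ψ ᵥ* X = 0 := by rw [← hX, vecMul_transpose, hψ]
  rw [act_apply, e, transpose_add, transpose_one, transpose_vecMulVec, add_mul, one_mul, mul_add,
    mul_one, vecMulVec_mul, hψ']
  simp [mul_vecMulVec, hψ]

/-- A cone with two coloops has an orientation reversing automorphism. -/
theorem cls_eq_zero_of_two_coloops {σ : Cone g} {c φ : Fin g → ℤ}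
    (hσ : σ ∈ perfectCones g) (h : IsComplement σ c φ) (hc : HasColoop σ) {D : Form g m}
    (hD : IsVol (linSpan (σ ⊔ ray c)) D) : cls Γ ω (σ ⊔ ray c) D = 0 := by
  obtain ⟨σ₀, c', φ', h', rfl⟩ := hc
  have hφc' : φ ⬝ᵥ c' = 0 := by
    have hc0 : c' ≠ 0 := by
      rintro rfl
      have := h'.1
      rw [dotProduct_zero] at this
      exact zero_ne_one this
    exact dotProduct_eq_zero_of_rankOne_mulVec hc0 (h.2 _ (rankOne_mem_sup σ₀ c'))
  -- This `ψ` annihilates `σ₀` and has the values `-1` at `c` and `1` at `c'`, so the reflection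
  -- along `c - c'` exchanges the two rays. The middle term makes the `φ'` part vanish at `c`.
  set ψ : Fin g → ℤ := φ' - (φ' ⬝ᵥ c) • φ - φ with hψ
  have hψc : ψ ⬝ᵥ c = -1 := by
    rw [hψ, sub_dotProduct, sub_dotProduct, smul_dotProduct, h.1]; simp
  have hψc' : ψ ⬝ᵥ c' = 1 := by
    rw [hψ, sub_dotProduct, sub_dotProduct, smul_dotProduct, h'.1, hφc']; simp
  have hu : ψ ⬝ᵥ (c - c') = -2 := by rw [dotProduct_sub, hψc, hψc']; norm_num
  set k := reflection (c - c') ψ hu with hk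
  have hkc : (k : Matrix (Fin g) (Fin g) ℤ) *ᵥ c = c' := by
    rw [hk, reflection_mulVec, hψc]; simp
  have hkc' : (k : Matrix (Fin g) (Fin g) ℤ) *ᵥ c' = c := by
    rw [hk, reflection_mulVec, hψc']; simp
  have hfix : ∀ X ∈ σ₀, act k X = X := by
    intro X hX
    have hXσ : X ∈ σ₀ ⊔ ray c' := Submodule.mem_sup_left hX
    refine act_reflection _ _ _ (transpose_eq_of_mem hσ hXσ) ?_
    have e : toReal ψ = toReal φ' - ((φ' ⬝ᵥ c : ℤ) : ℝ) • toReal φ - toReal φ := by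
      funext i; simp [hψ, toReal]
    rw [e, mulVec_sub, mulVec_sub, mulVec_smul, h.2 X hXσ, h'.2 X hX]
    simp
  have hfix' : ∀ x ∈ linSpan σ₀, act k x = x := fun x hx => by
    have := eq_zero_of_mem_linSpan (ℓ := act k - LinearMap.id) (fun y hy => by simp [hfix y hy]) hx
    exact sub_eq_zero.1 this
  have hkσ₀ : move k σ₀ = σ₀ := by
    ext x
    rw [mem_move]
    exact ⟨fun ⟨y, hy, e⟩ => by rw [← e, hfix y hy]; exact hy, fun hx => ⟨x, hx, hfix x hx⟩⟩
  have hkσ : move k (σ₀ ⊔ ray c' ⊔ ray c) = σ₀ ⊔ ray c' ⊔ ray c := by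
    rw [move_sup_ray, move_sup_ray, hkσ₀, hkc, hkc', sup_assoc, sup_assoc, sup_comm (ray c)]
  have hm := hD.1
  have h1 : dim σ₀ + 1 = dim (σ₀ ⊔ ray c') := h'.dim_sup_ray
  have h2 : dim (σ₀ ⊔ ray c') + 1 = m := by rw [h.dim_sup_ray]; exact hm
  obtain ⟨n, rfl⟩ : ∃ n, m = n + 2 := ⟨dim σ₀, by omega⟩
  refine cls_eq_zero_of_sameOn_neg hkσ (h.sameOn_of_contr ?_ hD.neg ?_)
  · rw [isVol_pull_iff, hkσ]; exact hD
  have hpD : IsVol (linSpan (σ₀ ⊔ ray c' ⊔ ray c)) (pull k D) := by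
    rw [isVol_pull_iff, hkσ]; exact hD
  -- After contraction with both rays the comparison takes place on `σ₀`, where `k` is the identity;
  -- the exchange of the rays leaves only the sign of `contr_contr`.
  refine h'.sameOn_of_contr (h.isVol_contr hpD) (h.isVol_contr hD.neg) (.of_eq fun x hx => ?_)
  rw [contr_contr (-D), contr_neg, contr_neg, neg_neg, pull, contr_comp, act_rankOne, hkc,
    contr_comp, act_rankOne, hkc', AlternatingMap.compLinearMap_apply]
  simp only [hfix' _ (hx _)]

/-! ### The homotopy formula -/

theorem bd_sup_ray {σ : Cone g} (hσ : σ ∈ perfectCones g) {c φ : Fin g → ℤ}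
    (h : IsComplement σ c φ) {E : Form g (m + 1)} (hE : IsVol (linSpan (σ ⊔ ray c)) E) :
    bd Γ ω (σ ⊔ ray c) E = cls Γ ω σ (contr E (rankOne c)) +
      ∑ ρ ∈ facetFinset σ, cls Γ ω (ρ ⊔ ray c) (contr E (outer ρ σ)) := by
  classical
  have hσc := perfect_sup_ray hσ h.1 h.2
  have hset : facetFinset (σ ⊔ ray c) =
      insert σ ((facetFinset σ).image fun ρ => ρ ⊔ ray c) := by
    ext ρ
    rw [mem_facetFinset hσc, Finset.mem_insert, Finset.mem_image]
    constructor
    · intro hρ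
      refine (h.eq_or_of_isFacet hρ).imp_right ?_
      rintro ⟨ρ', hρ', e⟩
      exact ⟨ρ', (mem_facetFinset hσ).2 hρ', e⟩
    · rintro (rfl | ⟨ρ', hρ', rfl⟩)
      · exact h.isFacet
      · exact h.isFacet_sup_ray (isFacet_of_mem hρ')
  have hmem : ∀ ρ ≤ σ, ∀ x ∈ σ, x ∈ ρ ⊔ ray c → x ∈ ρ := fun ρ hρ x hx hxρ =>
    (h.mono hρ).mem_iff.2 ⟨hxρ, h.valueAt_eq_zero (mem_linSpan hx)⟩
  rw [bd, hset, Finset.sum_insert, Finset.sum_image]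
  · congr 1
    · exact cls_contr_eq h.isFacet hE (rankOne_mem_sup σ c) h.rankOne_notMem
    · refine Finset.sum_congr rfl fun ρ hρ => ?_
      have hρ := isFacet_of_mem hρ
      have ho := hρ.outer_spec
      exact cls_contr_eq (h.isFacet_sup_ray hρ) hE (Submodule.mem_sup_left ho.1)
        fun hx => ho.2 (hmem ρ hρ.le _ ho.1 hx)
  · intro ρ hρ ρ' hρ' e
    have hρ := (isFacet_of_mem hρ).le
    have hρ' := (isFacet_of_mem hρ').le
    have e : ρ ⊔ ray c = ρ' ⊔ ray c := e
    refine le_antisymm (fun x hx => ?_) fun x hx => ?_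
    · exact hmem ρ' hρ' x (hρ hx) (e ▸ Submodule.mem_sup_left hx)
    · exact hmem ρ hρ x (hρ' hx) (e ▸ Submodule.mem_sup_left hx)
  · rw [Finset.mem_image]
    rintro ⟨ρ, -, e⟩
    exact h.rankOne_notMem (e ▸ rankOne_mem_sup ρ c)

/-- On `ρ` the ray is added after contraction with the outer vector, on `σ` before it; exchanging
the order gives the minus sign. If `ρ` has a coloop, the left side is zero by definition and the
right side because `ρ ⊔ ray c` has two. -/
theorem coneExt_contr {σ ρ : Cone g} (hσ : σ ∈ perfectCones g) {c φ : Fin g → ℤ}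
    (h : IsComplement σ c φ) (hρ : IsFacet ρ σ) {D : Form g (m + 1)} (hD : IsVol (linSpan σ) D) :
    coneExt Γ ω ρ (contr D (outer ρ σ)) =
      -cls Γ ω (ρ ⊔ ray c) (contr (extendForm D φ) (outer ρ σ)) := by
  have hρp := perfect_of_isFacet hσ hρ
  have hρc := h.mono hρ.le
  have ho := hρ.outer_spec
  have hv := hρ.isVol_contr hD ho.1 ho.2
  have hv' : IsVol (linSpan (ρ ⊔ ray c)) (contr (extendForm D φ) (outer ρ σ)) :=
    (h.isFacet_sup_ray hρ).isVol_contr (h.isVol_extendForm hD) (Submodule.mem_sup_left ho.1)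
      fun hx => ho.2 (hρc.mem_iff.2 ⟨hx, h.valueAt_eq_zero (mem_linSpan ho.1)⟩)
  by_cases hc : HasColoop ρ
  · rw [coneExt_of_hasColoop hc, cls_eq_zero_of_two_coloops hρp hρc hc hv', neg_zero]
  · rw [coneExt_eq hρp hc hρc hv, ← cls_neg]
    refine cls_congr (hρc.sameOn_of_contr (hρc.isVol_extendForm hv) hv'.neg (.of_eq fun x hx => ?_))
    rw [hρc.contr_extendForm _ hx, contr_neg, contr_contr, neg_neg, contr_apply, contr_apply,
      h.contr_extendForm]
    intro i
    refine Fin.lastCases ?_ (fun i => ?_) i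
    · simpa using mem_linSpan ho.1
    · simpa using linSpan_mono hρ.le (hx i)

/-- If `σ = σ₀ + ray c`, the extension is zero and in `∂σ` only the facet `σ₀` survives under `H`,
the others having the coloop `c`. Its image is `σ`, or both are zero if `σ₀` has a coloop. If `σ`
has no coloop, `∂(σ + ray c)` is `σ` plus the terms of the `ρ + ray c`, which cancel against `H∂σ`.
-/
theorem boundary_homotopy_add (hΓ : IsSystemOfRepresentatives Γ) {σ : Cone g}
    (hσ : σ ∈ perfectCones g) (hdim : dim σ < g) {D : Form g m} (hD : IsVol (linSpan σ) D) :
    totalBoundary Γ ω (coneExt Γ ω σ D) + homotopy Γ ω (bd Γ ω σ D) = cls Γ ω σ D := by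
  by_cases hc : HasColoop σ
  · rw [coneExt_of_hasColoop hc, map_zero, zero_add]
    obtain ⟨σ₀, c, φ, h, rfl⟩ := hc
    have hσ₀ := perfect_of_isFacet hσ h.isFacet
    obtain ⟨n, rfl⟩ : ∃ n, m = n + 1 := ⟨dim σ₀, by rw [h.dim_sup_ray]; exact hD.1.symm⟩
    rw [bd_sup_ray hσ₀ h hD, map_add, map_sum, homotopy_cls hΓ hσ₀ (h.isVol_contr hD),
      Finset.sum_eq_zero, add_zero]
    · by_cases hc : HasColoop σ₀
      · rw [coneExt_of_hasColoop hc, cls_eq_zero_of_two_coloops hσ₀ h hc hD]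
      · rw [coneExt_eq hσ₀ hc h (h.isVol_contr hD)]
        exact cls_congr (h.sameOn_of_contr (h.isVol_extendForm (h.isVol_contr hD)) hD
          (h.sameOn_contr_extendForm _))
    · intro ρ hρ
      have hρ := isFacet_of_mem hρ
      have hρc := h.mono hρ.le
      have ho := hρ.outer_spec
      rw [homotopy_cls hΓ (perfect_of_isFacet hσ (h.isFacet_sup_ray hρ)),
        coneExt_of_hasColoop ⟨ρ, c, φ, hρc, rfl⟩]
      exact (h.isFacet_sup_ray hρ).isVol_contr hD (Submodule.mem_sup_left ho.1)
        fun hx => ho.2 (hρc.mem_iff.2 ⟨hx, h.valueAt_eq_zero (mem_linSpan ho.1)⟩)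
  · obtain ⟨c, φ, h⟩ := exists_isComplement hσ hdim
    have hE := h.isVol_extendForm hD
    rw [coneExt_eq hσ hc h hD, totalBoundary_cls hΓ (perfect_sup_ray hσ h.1 h.2) hE,
      bd_sup_ray hσ h hE, cls_congr (h.sameOn_contr_extendForm D), add_assoc, add_eq_left]
    cases m with
    | zero =>
      have : facetFinset σ = ∅ := Finset.eq_empty_of_forall_notMem fun ρ hρ => by
        have h1 := (isFacet_of_mem hρ).2
        have h2 : dim σ = 0 := hD.1
        omega
      rw [this]
      simp [bd]
    | succ m =>
      rw [bd, map_sum, ← Finset.sum_add_distrib]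
      refine Finset.sum_eq_zero fun ρ hρ => ?_
      have hρ := isFacet_of_mem hρ
      have ho := hρ.outer_spec
      rw [homotopy_cls hΓ (perfect_of_isFacet hσ hρ) (hρ.isVol_contr hD ho.1 ho.2),
        coneExt_contr hσ h hρ hD, add_neg_cancel]

theorem coneExt_apply_ne_zero {τ : Γ} {σ : Cone g} {D : Form g m} (h : coneExt Γ ω σ D τ ≠ 0) :
    dim τ.1 = dim σ + 1 := by
  rw [coneExt] at h
  split_ifs at h with hc
  · rw [hc.2.choose_spec.choose_spec.dim_sup_ray]
    by_contra hne
    exact h (cls_apply_of_not_equivalent fun he => hne he.dim_eq.symm)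
  · exact absurd rfl h

theorem homotopy_apply_ne_zero {x : Γ →₀ ℚ} {τ : Γ} (h : homotopy Γ ω x τ ≠ 0) :
    ∃ σ : Γ, x σ ≠ 0 ∧ dim τ.1 = dim σ.1 + 1 := by
  rw [homotopy, Finsupp.linearCombination_apply, Finsupp.sum, Finsupp.finsetSum_apply] at h
  obtain ⟨σ, hσ, hne⟩ := Finset.exists_ne_zero_of_sum_ne_zero h
  refine ⟨σ, Finsupp.mem_support_iff.1 hσ, coneExt_apply_ne_zero (ω := ω)
    (D := volForm Γ ω σ) fun e => hne ?_⟩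
  rw [Finsupp.smul_apply, e, smul_zero]

theorem totalBoundary_homotopy_add (hΓ : IsSystemOfRepresentatives Γ) {x : Γ →₀ ℚ}
    (hx : ∀ τ, x τ ≠ 0 → dim τ.1 < g) :
    totalBoundary Γ ω (homotopy Γ ω x) + homotopy Γ ω (totalBoundary Γ ω x) = x := by
  set T := totalBoundary Γ ω ∘ₗ homotopy Γ ω + homotopy Γ ω ∘ₗ totalBoundary Γ ω with hT
  have key : ∀ τ : Γ, dim τ.1 < g → T (Finsupp.single τ 1) = Finsupp.single τ 1 := by
    intro τ hτ
    have hr := represents_volForm Γ ω τ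
    have hp := (hΓ.1 _ τ.2).1
    rw [← cls_eq_single hΓ hr, hT, LinearMap.add_apply, LinearMap.comp_apply,
      LinearMap.comp_apply, homotopy_cls hΓ hp hr.1, totalBoundary_cls hΓ hp hr.1]
    exact boundary_homotopy_add hΓ hp hτ hr.1
  change T x = x
  have e : x = ∑ τ ∈ x.support, x τ • Finsupp.single τ (1 : ℚ) := by
    conv_lhs => rw [← Finsupp.sum_single x]
    simp [Finsupp.sum]
  conv_rhs => rw [e]
  conv_lhs => rw [e]
  rw [map_sum]
  refine Finset.sum_congr rfl fun τ hτ => ?_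
  rw [map_smul, key τ (hx τ (Finsupp.mem_support_iff.1 hτ))]

end Homotopy

end PerfectCone

end

theorem mainTheorem7 (g : ℕ) (Γ : Set (PerfectCone.Cone g))
    (hΓ : PerfectCone.IsSystemOfRepresentatives Γ)
    (ω : ∀ σ : Γ, PerfectCone.ConeOrientation σ.1) :
    ∃ hd : ∀ n : ℤ,
        PerfectCone.boundary Γ ω n ∘ₗ PerfectCone.boundary Γ ω (n + 1) = 0,
      ∀ k : ℤ, k ≤ (g : ℤ) - 2 →
        CategoryTheory.Limits.IsZero ((PerfectCone.perfectComplex Γ ω hd).homology k) := by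
  refine ⟨PerfectCone.boundary_comp_boundary hΓ, fun k hk => ?_⟩
  -- A chain of degree `k ≤ g - 2` is supported on cones of dimension `k + 1 < g`, where the
  -- homotopy formula holds; for a cycle `x` it reads `∂(H x) = x`.
  refine PerfectCone.isZero_homology hΓ _ k fun x hx hdx => ⟨PerfectCone.homotopy Γ ω x,
    fun τ hτ => ?_, ?_⟩
  · obtain ⟨σ, hσ, e⟩ := PerfectCone.homotopy_apply_ne_zero hτ
    have := hx σ hσ
    omega
  · have := PerfectCone.totalBoundary_homotopy_add (ω := ω) hΓ (x := x) fun τ hτ => by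
      have := hx τ hτ
      omega
    rwa [hdx, map_zero, add_zero] at this
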